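/- Let $M$ be a nonempty compact smooth manifold without boundary of dimension $n\ge 1$, let $\mathcal M$ be the space of smooth Riemannian metrics on $M$ (an open cone in the Fréchet space $\Gamma(S^2T^*M)$ of smooth symmetric $(0,2)$-tensor fields), let $V_g=\int_M dV_g$, and equip $\mathcal M$ with the weak Riemannian metric $$ g_N(h,k)|_g=\frac1{V_g}\int_M \operatorname{tr}(g^{-1}h\,g^{-1}k)\,dV_g . $$ Geodesics are smooth curves in $\mathcal M$ that are autoparallel for the Levi-Civita connection of $g_N$. Let $g(0)\in\mathcal M$, $\mu_0=dV_{g(0)}$, $V(0)=V_{g(0)}$. Let $\alpha$ be a smooth volume density (signed), so that $\alpha/\mu_0$ is a smooth function, and let $A\in\Gamma(S^2T^*M)$ satisfy $\operatorname{tr}(g(0)^{-1}A)=0$. The pair $(\alpha,A)$ denotes the tangent vector $\frac2n\frac{\alpha}{\mu_0}g(0)+A$ at $g(0)$. Put $\sigma=\|(\alpha,A)\|_{g_N}$ and $$a_0=\frac2{V(0)}\int_M\alpha,\quad b_0=\sqrt{\frac{n\sigma^2-a_0^2}{4}},\quad q=\frac{\alpha}{\mu_0}-\frac{a_0}2,\quad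 r=\sqrt{\frac n4\operatorname{tr}\big((g(0)^{-1}A)^2\big)} .$$ When $b_0\neq0$ put, with $\cos^{-1}$ valued in $[0,\pi]$, $$\theta(x)=\begin{cases}2\pi-\cos^{-1}\Big(\frac{q(x)^2-b_0^2}{q(x)^2+b_0^2}\Big)& q(x)\ge0,\\[2pt] \cos^{-1}\Big(\frac{q(x)^2-b_0^2}{q(x)^2+b_0^2}\Big)& q(x)<0,\end{cases}\qquad t_0=\inf\Big\{\frac{\theta(x)}{b_0}: A(x)=0\Big\}\in(0,\infty]\quad(\inf\emptyset=\infty).$$ (1) If $b_0=0$, then $|a_0|=\sigma\sqrt n$, and the geodesic emanating from $g(0)$ with initial tangent vector $(\alpha,A)$ is $g(t)=e^{a_0t/n}g(0)$ (that is, $e^{\pm t\sigma/\sqrt n}g(0)$, with the sign of $a_0$), with domain of definition $[0,\infty)$. (2) If $b_0\ne0$, the geodesic emanating from $g(0)$ with initial tangent vector $(\alpha,A)$ has domain of definition $[0,t_0)$, and for $t\in[0,t_0)$ and $x\in M$ it is $$g(t,x)=\Big(\tfrac12\big(1-\tfrac{q^2+r^2}{b_0^2}\big)\cos(b_0t)+\tfrac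 q{b_0}\sin(b_0t)+\tfrac12\big(1+\tfrac{q^2+r^2}{b_0^2}\big)\Big)^{2/n}e^{a_0t/n}\,g(0)\exp\Big[\tfrac2r\tan^{-1}\Big(\tfrac{r\sin(b_0t)}{b_0+b_0\cos(b_0t)+q\sin(b_0t)}\Big)g(0)^{-1}A\Big],$$ where the exponential is the identity if $A(x)=0$. If $A(x)\neq0$, the arctangent takes values in $[\pi k-\frac\pi2,\pi k+\frac\pi2]$ for $t\in\big[\frac{2\pi(k-1)+\theta(x)}{b_0},\frac{2\pi k+\theta(x)}{b_0}\big]$, $k\in\mathbb Z$; at the isolated times where the denominator vanishes, it is extended by continuity. In both cases "domain of definition" means that every geodesic with the same initial data, defined on a nondegenerate interval in $[0,\infty)$ starting at $0$, is a restriction of the given one. (3) If $b_0\neq 0$ and $t_0<\infty$, then as $t\to t_0^-$ the metrics $g(t)$ converge uniformly on $M$ to a continuous symmetric $(0,2)$-tensor field that is degenerate at some point $x\in M$, and at this point the volume form tends to zero: $\mu_{g(t)}(x)\to0$, where $\mu_{g(t)}=dV_{g(t)}$. -/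

import Mathlib

open Set Filter Topology MeasureTheory
open scoped Manifold ContDiff

namespace GenCalabi

section Tensors

variable {n : ℕ} {M : Type*} [TopologicalSpace M] [ChartedSpace (EuclideanSpace ℝ (Fin n)) M]

variable (n M) in
/-- `(0,2)`-tensor fields on an `n`-dimensional manifold, with no regularity imposed. -/
abbrev TensorField : Type _ :=
  ∀ x : M, TangentSpace (𝓡 n) x →L[ℝ] TangentSpace (𝓡 n) x →L[ℝ] ℝ

/-- The frame of `T_x M` given by the coordinate vectors of the preferred chart at `x`. -/
noncomputable def frame (x : M) (i : Fin n) : TangentSpace (𝓡 n) x :=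
  (EuclideanSpace.single i (1 : ℝ) : EuclideanSpace ℝ (Fin n))

/-- The matrix of a tensor field at `x` with respect to `frame x`. In this frame the endomorphism
`g⁻¹ h` of `T_x M` has the matrix `(gram g x)⁻¹ * gram h x`. -/
noncomputable def gram (h : TensorField n M) (x : M) : Matrix (Fin n) (Fin n) ℝ :=
  Matrix.of fun i j => h x (frame x i) (frame x j)

/-- `tr (g⁻¹ h g⁻¹ k)` at the point `x`. -/
noncomputable def traceProd (g h k : TensorField n M) (x : M) : ℝ :=
  ((gram g x)⁻¹ * gram h x * ((gram g x)⁻¹ * gram k x)).trace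

/-- The value of the Riemannian volume density of `g` at `x` on the frame `frame x`. -/
noncomputable def volDensity (g : TensorField n M) (x : M) : ℝ :=
  Real.sqrt (gram g x).det

/-- The coefficients `g(∂ᵢ, ∂ⱼ)` of a tensor field in the chart centred at `y`, at the point with
coordinates `z`. -/
noncomputable def chartGram (g : TensorField n M) (y : M) (z : EuclideanSpace ℝ (Fin n)) :
    Matrix (Fin n) (Fin n) ℝ :=
  Matrix.of fun i j =>
    g ((chartAt (EuclideanSpace ℝ (Fin n)) y).symm z)
      (mfderiv 𝓘(ℝ, EuclideanSpace ℝ (Fin n)) (𝓡 n)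
        (chartAt (EuclideanSpace ℝ (Fin n)) y).symm z (EuclideanSpace.single i (1 : ℝ)))
      (mfderiv 𝓘(ℝ, EuclideanSpace ℝ (Fin n)) (𝓡 n)
        (chartAt (EuclideanSpace ℝ (Fin n)) y).symm z (EuclideanSpace.single j (1 : ℝ)))

/-- The tangent vector at `g₀` of the space of metrics which corresponds to the volume form
`a • dV_{g₀}` and to the traceless tensor field `A` under the splitting of a metric into its volume
form and its conformal class, `(ν, h) ↦ (ν / dV_{g₀})^{2/n} h`. -/
noncomputable def tangentVector (g₀ : TensorField n M) (a : M → ℝ) (A : TensorField n M) :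
    TensorField n M :=
  fun x => (2 / (n : ℝ) * a x) • g₀ x + A x

/-- The pointwise time derivative at time `t` of a curve of tensor fields defined on `J`. For each
`x` it is taken in the fixed finite-dimensional space of bilinear forms on `T_x M`, where `T_x M`
is by definition the model space. -/
noncomputable def velocity (J : Set ℝ) (c : ℝ → TensorField n M) (t : ℝ) : TensorField n M :=
  fun x => derivWithin
    (F := EuclideanSpace ℝ (Fin n) →L[ℝ] EuclideanSpace ℝ (Fin n) →L[ℝ] ℝ) (fun s => c s x) J t

end Tensors

section Smoothness

variable {n : ℕ} {M : Type*} [TopologicalSpace M] [ChartedSpace (EuclideanSpace ℝ (Fin n)) M]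
  [IsManifold (𝓡 n) ∞ M]

/-- Smooth symmetric `(0,2)`-tensor fields, the elements of `Γ(S² T* M)`. -/
structure IsSmoothSym (h : TensorField n M) : Prop where
  symm : ∀ (x : M) (v w : TangentSpace (𝓡 n) x), h x v w = h x w v
  smooth : ContMDiff (𝓡 n)
    ((𝓡 n).prod 𝓘(ℝ, EuclideanSpace ℝ (Fin n) →L[ℝ] EuclideanSpace ℝ (Fin n) →L[ℝ] ℝ)) ∞
    (fun x : M => Bundle.TotalSpace.mk'
      (EuclideanSpace ℝ (Fin n) →L[ℝ] EuclideanSpace ℝ (Fin n) →L[ℝ] ℝ)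
      (E := fun x : M => TangentSpace (𝓡 n) x →L[ℝ] TangentSpace (𝓡 n) x →L[ℝ] ℝ) x (h x))

/-- Smooth Riemannian metrics. -/
structure IsMetric (g : TensorField n M) : Prop extends IsSmoothSym g where
  pos : ∀ (x : M) (v : TangentSpace (𝓡 n) x), v ≠ 0 → 0 < g x v v

/-- Continuous `(0,2)`-tensor fields. -/
def IsContinuousTensor (h : TensorField n M) : Prop :=
  Continuous (fun x : M => Bundle.TotalSpace.mk'
    (EuclideanSpace ℝ (Fin n) →L[ℝ] EuclideanSpace ℝ (Fin n) →L[ℝ] ℝ)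
    (E := fun x : M => TangentSpace (𝓡 n) x →L[ℝ] TangentSpace (𝓡 n) x →L[ℝ] ℝ) x (h x))

/-- Smooth curves `J → Γ(T* M ⊗ T* M)`: `c t x` is smooth in `(t, x)` jointly. -/
def IsSmoothCurveOn (J : Set ℝ) (c : ℝ → TensorField n M) : Prop :=
  ContMDiffOn (𝓘(ℝ, ℝ).prod (𝓡 n))
    ((𝓡 n).prod 𝓘(ℝ, EuclideanSpace ℝ (Fin n) →L[ℝ] EuclideanSpace ℝ (Fin n) →L[ℝ] ℝ)) ∞
    (fun p : ℝ × M => Bundle.TotalSpace.mk'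
      (EuclideanSpace ℝ (Fin n) →L[ℝ] EuclideanSpace ℝ (Fin n) →L[ℝ] ℝ)
      (E := fun x : M => TangentSpace (𝓡 n) x →L[ℝ] TangentSpace (𝓡 n) x →L[ℝ] ℝ)
      p.2 (c p.1 p.2))
    (J ×ˢ univ)

end Smoothness

/-- A compact manifold is covered by a sequence of chart domains. -/
theorem exists_chart_cover (n : ℕ) (M : Type*) [TopologicalSpace M]
    [ChartedSpace (EuclideanSpace ℝ (Fin n)) M] [CompactSpace M] [Nonempty M] :
    ∃ u : ℕ → M, ∀ x : M, ∃ k, x ∈ (chartAt (EuclideanSpace ℝ (Fin n)) (u k)).source := by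
  obtain ⟨s, hs⟩ := CompactSpace.elim_nhds_subcover
    (fun x : M => (chartAt (EuclideanSpace ℝ (Fin n)) x).source)
    (fun x => (chartAt (EuclideanSpace ℝ (Fin n)) x).open_source.mem_nhds
      (mem_chart_source _ x))
  have hne : (s : Set M).Nonempty := by
    obtain ⟨x⟩ := ‹Nonempty M›
    have hx : x ∈ ⋃ y ∈ s, (chartAt (EuclideanSpace ℝ (Fin n)) y).source := hs ▸ mem_univ x
    obtain ⟨y, hy, -⟩ := mem_iUnion₂.1 hx
    exact ⟨y, hy⟩
  obtain ⟨u, hu⟩ := s.countable_toSet.exists_eq_range hne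
  refine ⟨u, fun x => ?_⟩
  have hx : x ∈ ⋃ y ∈ s, (chartAt (EuclideanSpace ℝ (Fin n)) y).source := hs ▸ mem_univ x
  obtain ⟨y, hy, hxy⟩ := mem_iUnion₂.1 hx
  have hy' : y ∈ range u := hu ▸ Finset.mem_coe.2 hy
  obtain ⟨k, rfl⟩ := hy'
  exact ⟨k, hxy⟩

section Volume

variable {n : ℕ} {M : Type*} [TopologicalSpace M] [ChartedSpace (EuclideanSpace ℝ (Fin n)) M]
  [CompactSpace M] [Nonempty M] [MeasurableSpace M]

variable (n M) in
/-- Centres of a sequence of charts whose domains cover `M`. -/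
noncomputable def chartCentre : ℕ → M := Classical.choose (exists_chart_cover n M)

variable (n M) in
/-- A partition of `M` into pieces, the `k`-th of which lies in the domain of the `k`-th chart. -/
noncomputable def piece (k : ℕ) : Set M :=
  disjointed (fun j => (chartAt (EuclideanSpace ℝ (Fin n)) (chartCentre n M j)).source) k

/-- The Riemannian volume measure `dV_g`: on each piece it is the measure with the density
`√(det g_ij) dz` in the coordinates `z` of the chart around that piece. By the change of variables
formula the choice of the charts and of the pieces does not matter. -/
noncomputable def vol (g : TensorField n M) : Measure M :=
  Measure.sum fun k : ℕ =>
    Measure.map (chartAt (EuclideanSpace ℝ (Fin n)) (chartCentre n M k)).symm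
      ((volume.restrict
          ((chartAt (EuclideanSpace ℝ (Fin n)) (chartCentre n M k)).target ∩
            (chartAt (EuclideanSpace ℝ (Fin n)) (chartCentre n M k)).symm ⁻¹' piece n M k)).withDensity
        fun z => ENNReal.ofReal (Real.sqrt (chartGram g (chartCentre n M k) z).det))

/-- The total volume `V_g`. -/
noncomputable def totalVol (g : TensorField n M) : ℝ := (vol g).real univ

/-- The Ebin metric `∫ tr (g⁻¹ h g⁻¹ k) dV_g`. -/
noncomputable def ebin (g h k : TensorField n M) : ℝ := ∫ x, traceProd g h k x ∂(vol g)

/-- The generalized Calabi metric `g_N = g_E / V_g`. -/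
noncomputable def gN (g h k : TensorField n M) : ℝ := ebin g h k / totalVol g

/-- The derivative at `g`, in the direction `k`, of the function `g ↦ g_N(h, l)|_g`
(`h` and `l` being constant vector fields on the space of metrics). -/
noncomputable def gNDeriv (g k h l : TensorField n M) : ℝ :=
  deriv (fun s : ℝ => gN (g + s • k) h l) 0

/-- `g_N(∇_h k, l)` at `g`, where `h`, `k`, `l` are constant vector fields on the space of metrics
(an open subset of the vector space of tensor fields) and `∇` is the Levi-Civita connection of
`g_N`, as given by the Koszul formula. -/
noncomputable def koszul (g h k l : TensorField n M) : ℝ :=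
  (gNDeriv g h k l + gNDeriv g k h l - gNDeriv g l h k) / 2

variable [IsManifold (𝓡 n) ∞ M]

/-- `c` is a geodesic, defined on the interval `J`, of the space of smooth Riemannian metrics with
the weak Riemannian metric `g_N`: a smooth curve of metrics with `∇_{c'} c' = 0`, that is
`c'' + Γ(c', c') = 0`, for the Levi-Civita connection `∇ = D + Γ` of `g_N`. The equation is tested
against all tangent vectors `l`. -/
structure IsGeodesicOn (J : Set ℝ) (c : ℝ → TensorField n M) : Prop where
  metric : ∀ t ∈ J, IsMetric (c t)
  smooth : IsSmoothCurveOn J c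
  geodesic : ∀ t ∈ J, ∀ l : TensorField n M, IsSmoothSym l →
    gN (c t) (velocity J (velocity J c) t) l
      + koszul (c t) (velocity J c t) (velocity J c t) l = 0

/-- `c` is a geodesic on `J` which starts at `g₀` with the velocity `v`. -/
structure IsGeodesicFrom (g₀ v : TensorField n M) (J : Set ℝ) (c : ℝ → TensorField n M) :
    Prop extends IsGeodesicOn J c where
  init : c 0 = g₀
  init_velocity : velocity J c 0 = v

/-- The half-open interval `[0, T)`. -/
def domain (T : EReal) : Set ℝ := {t : ℝ | 0 ≤ t ∧ (t : EReal) < T}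

/-- `c`, on `[0, T)`, is the geodesic emanating from `g₀` with the initial velocity `v`, on its
full domain of definition: every other geodesic with these initial data, on whatever
nondegenerate interval that starts at `0`, is a restriction of it. -/
structure IsMaximalGeodesic (g₀ v : TensorField n M) (T : EReal) (c : ℝ → TensorField n M) :
    Prop where
  pos : 0 < T
  isGeodesicFrom : IsGeodesicFrom g₀ v (domain T) c
  maximal : ∀ (J : Set ℝ) (γ : ℝ → TensorField n M), J.OrdConnected → J.Nontrivial → 0 ∈ J →
    J ⊆ Ici 0 → IsGeodesicFrom g₀ v J γ → J ⊆ domain T ∧ ∀ t ∈ J, γ t = c t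

end Volume

section Formula

/-- The factor of the volume form: `p(t)` for the data `b₀, q, r`. -/
noncomputable def volFactor (b q r t : ℝ) : ℝ :=
  (1 / 2) * (1 - (q ^ 2 + r ^ 2) / b ^ 2) * Real.cos (b * t) + q / b * Real.sin (b * t)
    + (1 / 2) * (1 + (q ^ 2 + r ^ 2) / b ^ 2)

/-- The angle `θ`. -/
noncomputable def theta (b q : ℝ) : ℝ :=
  if 0 ≤ q then 2 * Real.pi - Real.arccos ((q ^ 2 - b ^ 2) / (q ^ 2 + b ^ 2))
  else Real.arccos ((q ^ 2 - b ^ 2) / (q ^ 2 + b ^ 2))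

/-- `ψ t` is the arctangent of `r sin (b t) / (b + b cos (b t) + q sin (b t))`, with values in
`[π k - π / 2, π k + π / 2]` for `t` in `[(2 π (k - 1) + θ) / b, (2 π k + θ) / b]`. At the isolated
times where the denominator vanishes (and the quotient is infinite or `0 / 0`), its value is the
one that makes `ψ` continuous. -/
structure IsArctanBranch (b q r : ℝ) (ψ : ℝ → ℝ) : Prop where
  continuous : Continuous ψ
  mem : ∀ (k : ℤ) (t : ℝ),
    t ∈ Icc ((2 * Real.pi * (k - 1) + theta b q) / b) ((2 * Real.pi * k + theta b q) / b) →
    ψ t ∈ Icc (Real.pi * k - Real.pi / 2) (Real.pi * k + Real.pi / 2)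
  eq_arctan : ∀ (k : ℤ) (t : ℝ),
    t ∈ Icc ((2 * Real.pi * (k - 1) + theta b q) / b) ((2 * Real.pi * k + theta b q) / b) →
    b + b * Real.cos (b * t) + q * Real.sin (b * t) ≠ 0 →
    ψ t = Real.arctan
      (r * Real.sin (b * t) / (b + b * Real.cos (b * t) + q * Real.sin (b * t))) + Real.pi * k

end Formula

end GenCalabi

/-! Write `H = g⁻¹ g'`. The Koszul formula contains the test field only linearly under integrals, so
it can be represented by `g_N`. Testing against the resulting defect tensor gives the pointwise
equation `H' = -½ (tr H - τ) H + ¼ (tr H² - ε) I`, where `τ = g_N(g, g')` and `ε = g_N(g', g')`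
(`geodesic_equation_iff`, `geodesicOn_iff`). Its only nonlocal ingredients are `τ` and `ε`, and both
are constant along a geodesic (`IsGeodesicOn.conserved`). Hence at each point of `M` a geodesic
solves an ordinary differential equation with constant coefficients.

That equation is integrable. Let `p` be the relative volume density times `exp (-τ t / 2)`. The
squared length of the traceless part of `H`, scaled by `p²`, is conserved, and so is `(p'² + b² p² +
r²) / p`. These two integrals turn the equation for `p` into `p'' + b² p = const`, solved by
`volFactor` (`volume_ode`). Moreover `p` times the traceless part of `H` is constant, so `g(t) =
p^(2/n) exp (τ t / n) g₀ exp (Ψ g₀⁻¹ A)` with `Ψ' = 1/p` and `Ψ(0) = 0`. Uniqueness follows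
pointwise. Conversely these curves are geodesics, because `∫ q = 0` and `∫ (q² + r²) = b² V` force
the averages defining `τ` and `ε` to keep their initial values (`isGeodesicFrom_expCurve`).

By half-angle formulas `b² p` is the squared modulus of `b cos u + q sin u + i r sin u` with `u = b
t / 2`, and `r Ψ / 2` is a continuous argument of that complex number; this gives the arctangent
(`cos_sin_branch`, `isArctanBranch_branch`). If `r ≠ 0`, then `p` never vanishes. If `r = 0`, its
first zero is at `θ / b`. The zero set of `A` is compact, so a finite `t₀` is attained, and no
geodesic can reach it because its volume factor must stay positive. When `b₀ = 0`, the integral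
identity forces `q = r = 0`, and only homotheties remain.

For the limit at `t₀`, `p^(2/n)` is continuous and `|Ψ| r` stays bounded, so the matrix exponential
is harmless wherever `p` tends to zero. This yields uniform convergence to a continuous tensor that
vanishes at the minimising point. -/

open Set Filter Topology MeasureTheory
open scoped Manifold ContDiff
namespace GenCalabi
-- Inverse charts, their derivatives and changes of frame
section
variable {n : ℕ} {M : Type*} [TopologicalSpace M] [ChartedSpace (EuclideanSpace ℝ (Fin n)) M]

local notation "𝔼" n => EuclideanSpace ℝ (Fin n)

/-- The derivative of the inverse of the chart centred at `y`, in the model space. -/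
noncomputable def chartDeriv (y : M) (z : 𝔼 n) : (𝔼 n) →L[ℝ] (𝔼 n) :=
  mfderiv 𝓘(ℝ, EuclideanSpace ℝ (Fin n)) (𝓡 n) (chartAt (EuclideanSpace ℝ (Fin n)) y).symm z

/-- The matrix of the coordinate vectors of the chart centred at `y` with respect to `frame`. -/
noncomputable def frameChange (y : M) (z : 𝔼 n) : Matrix (Fin n) (Fin n) ℝ :=
  Matrix.of fun i j => chartDeriv y z (EuclideanSpace.single j (1 : ℝ)) i

theorem euclidean_sum_single (v : 𝔼 n) :
    v = ∑ i, v i • (EuclideanSpace.single i (1 : ℝ) : 𝔼 n) := by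
  ext k; simp [Pi.single_apply]

theorem bilin_apply_eq (B : (𝔼 n) →L[ℝ] (𝔼 n) →L[ℝ] ℝ) (v w : 𝔼 n) : B v w =
    ∑ i, ∑ j, v i * B (EuclideanSpace.single i (1 : ℝ)) (EuclideanSpace.single j (1 : ℝ)) * w j := by
  conv_lhs => rw [euclidean_sum_single v, euclidean_sum_single w]
  simp only [map_sum, map_smul, sum_apply, smul_apply, smul_eq_mul, Finset.mul_sum]
  rw [Finset.sum_comm]
  exact Finset.sum_congr rfl fun i _ => Finset.sum_congr rfl fun j _ => by ring

theorem apply_eq_gram (h : TensorField n M) (x : M) (v w : 𝔼 n) :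
    h x v w = ∑ i, ∑ j, v i * gram h x i j * w j :=
  bilin_apply_eq (h x) v w

theorem tensorField_ext {h k : TensorField n M} {x : M} (hk : gram h x = gram k x) :
    h x = k x := by
  refine ContinuousLinearMap.ext fun v => ContinuousLinearMap.ext fun w => ?_
  refine (apply_eq_gram h x v w).trans (Eq.trans ?_ (apply_eq_gram k x v w).symm)
  rw [hk]

theorem chartGram_eq (h : TensorField n M) (y : M) (z : 𝔼 n) :
    chartGram h y z = (frameChange y z).transpose * gram h ((chartAt (𝔼 n) y).symm z) *
      frameChange y z := by
  ext i j
  rw [chartGram, Matrix.of_apply]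
  refine (apply_eq_gram h _ _ _).trans ?_
  simp only [Matrix.mul_apply, Matrix.transpose_apply, Finset.sum_mul]
  rw [Finset.sum_comm]
  rfl

variable [IsManifold (𝓡 n) ∞ M]

theorem contMDiffOn_chartSymm (y : M) :
    ContMDiffOn 𝓘(ℝ, EuclideanSpace ℝ (Fin n)) (𝓡 n) ∞ (chartAt (𝔼 n) y).symm
      (chartAt (𝔼 n) y).target := by
  have h := contMDiffOn_extChartAt_symm (I := 𝓡 n) (n := ∞) y
  simpa only [mfld_simps] using h

theorem contMDiffOn_chart (y : M) :
    ContMDiffOn (𝓡 n) 𝓘(ℝ, EuclideanSpace ℝ (Fin n)) ∞ (chartAt (𝔼 n) y)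
      (chartAt (𝔼 n) y).source := by
  have h := contMDiffOn_extChartAt (I := 𝓡 n) (n := ∞) (x := y)
  simpa only [mfld_simps] using h

/-- Chain rule for one inverse chart written as another composed with the transition map. The
Jacobian determinant of that map is the factor between the two coordinate densities, which makes the
volume measure chart independent. -/
theorem chartDeriv_comp (y y' : M) {z : 𝔼 n} (hz : z ∈ (chartAt (𝔼 n) y).target)
    (hz' : (chartAt (𝔼 n) y).symm z ∈ (chartAt (𝔼 n) y').source) :
    HasFDerivAt (fun u => chartAt (𝔼 n) y' ((chartAt (𝔼 n) y).symm u))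
      (fderiv ℝ (fun u => chartAt (𝔼 n) y' ((chartAt (𝔼 n) y).symm u)) z) z ∧
    chartDeriv y z = (chartDeriv y' (chartAt (𝔼 n) y' ((chartAt (𝔼 n) y).symm z))).comp
      (fderiv ℝ (fun u => chartAt (𝔼 n) y' ((chartAt (𝔼 n) y).symm u)) z) := by
  have h1 : MDifferentiableAt 𝓘(ℝ, EuclideanSpace ℝ (Fin n)) (𝓡 n) (chartAt (𝔼 n) y).symm z :=
    ((contMDiffOn_chartSymm y).contMDiffAt ((chartAt (𝔼 n) y).open_target.mem_nhds hz)).mdifferentiableAt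
      (by simp)
  have h2 : MDifferentiableAt (𝓡 n) 𝓘(ℝ, EuclideanSpace ℝ (Fin n)) (chartAt (𝔼 n) y')
      ((chartAt (𝔼 n) y).symm z) :=
    ((contMDiffOn_chart y').contMDiffAt ((chartAt (𝔼 n) y').open_source.mem_nhds hz')).mdifferentiableAt
      (by simp)
  have h3 : MDifferentiableAt 𝓘(ℝ, EuclideanSpace ℝ (Fin n)) (𝓡 n) (chartAt (𝔼 n) y').symm
      (chartAt (𝔼 n) y' ((chartAt (𝔼 n) y).symm z)) :=
    ((contMDiffOn_chartSymm y').contMDiffAt ((chartAt (𝔼 n) y').open_target.mem_nhds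
      ((chartAt (𝔼 n) y').map_source hz'))).mdifferentiableAt (by simp)
  have h4 : MDifferentiableAt 𝓘(ℝ, EuclideanSpace ℝ (Fin n)) 𝓘(ℝ, EuclideanSpace ℝ (Fin n))
      (fun u => chartAt (𝔼 n) y' ((chartAt (𝔼 n) y).symm u)) z := h2.comp z h1
  refine ⟨(mdifferentiableAt_iff_differentiableAt.1 h4).hasFDerivAt, ?_⟩
  have h5 : (chartAt (𝔼 n) y).symm =ᶠ[𝓝 z]
      (chartAt (𝔼 n) y').symm ∘ (fun u => chartAt (𝔼 n) y' ((chartAt (𝔼 n) y).symm u)) := by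
    have : (chartAt (𝔼 n) y).symm ⁻¹' (chartAt (𝔼 n) y').source ∈ 𝓝 z :=
      ((chartAt (𝔼 n) y).continuousAt_symm hz).preimage_mem_nhds
        ((chartAt (𝔼 n) y').open_source.mem_nhds hz')
    filter_upwards [this] with u hu
    exact ((chartAt (𝔼 n) y').left_inv hu).symm
  have h6 := mfderiv_comp z h3 h4
  rw [mfderiv_eq_fderiv] at h6
  refine Eq.trans ?_ h6
  have h7 := h5.mfderiv_eq (I := 𝓘(ℝ, EuclideanSpace ℝ (Fin n))) (I' := 𝓡 n)
  exact h7

/-- The derivative of the chart itself is a right inverse. One side is enough, since a square matrix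
with a right inverse is invertible. -/
theorem chartDeriv_self_comp (y : M) {z : 𝔼 n} (hz : z ∈ (chartAt (𝔼 n) y).target) :
    ∃ D : (𝔼 n) →L[ℝ] (𝔼 n), (chartDeriv y z).comp D = ContinuousLinearMap.id ℝ _ := by
  have : IsManifold (𝓡 n) 1 M := IsManifold.of_le (n := ∞) (by simp)
  have hx := (chartAt (𝔼 n) y).map_target hz
  have h := mfderivWithin_extChartAt_symm_comp_mfderiv_extChartAt' (I := 𝓡 n) (x := y)
    (y := (chartAt (𝔼 n) y).symm z) (by simpa using hx)
  simp only [mfld_simps, mfderivWithin_univ] at h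
  rw [(chartAt (𝔼 n) y).right_inv hz] at h
  exact ⟨_, h⟩

theorem isUnit_frameChange (y : M) {z : 𝔼 n} (hz : z ∈ (chartAt (𝔼 n) y).target) :
    IsUnit (frameChange y z) := by
  obtain ⟨D, hD⟩ := chartDeriv_self_comp y hz
  refine IsUnit.of_mul_eq_one (Matrix.of fun i j => D (EuclideanSpace.single j (1 : ℝ)) i) ?_
  ext i j
  have h := congrArg (fun L : (𝔼 n) →L[ℝ] (𝔼 n) => L (EuclideanSpace.single j (1 : ℝ)) i) hD
  simp only [ContinuousLinearMap.comp_apply, ContinuousLinearMap.id_apply] at h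
  rw [euclidean_sum_single (D _)] at h
  rw [Matrix.mul_apply]
  simp only [map_sum, map_smul] at h
  simp only [frameChange, Matrix.of_apply, Matrix.one_apply]
  rw [eq_comm] at h ⊢
  convert h using 1
  · simp
  · simp [mul_comm]

/-- Link between the tangent bundle trivialization and coordinate vectors, through which bundle
smoothness becomes smoothness of coefficients. -/
theorem symmL_eq_chartDeriv (y : M) {z : 𝔼 n} (hz : z ∈ (chartAt (𝔼 n) y).target) (v : 𝔼 n) :
    (trivializationAt (𝔼 n) (TangentSpace (𝓡 n)) y).symm ((chartAt (𝔼 n) y).symm z) v =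
    chartDeriv y z v := by
  have : IsManifold (𝓡 n) 1 M := IsManifold.of_le (n := ∞) (by simp)
  have h := TangentBundle.symmL_trivializationAt (I := 𝓡 n) ((chartAt (𝔼 n) y).map_target hz)
  simp only [mfld_simps, mfderivWithin_univ] at h
  rw [(chartAt (𝔼 n) y).right_inv hz] at h
  rw [← Bundle.Trivialization.symmL_apply (R := ℝ) _ (by simpa using (chartAt (𝔼 n) y).map_target hz)]
  rw [h]
  rfl
end
end GenCalabi

/-! ### Bilinear forms as matrices; smoothness read in charts -/

open Set Filter Topology MeasureTheory
open scoped Manifold ContDiff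
namespace GenCalabi
section
open scoped Matrix.Norms.Operator
variable {n : ℕ} {M : Type*} [TopologicalSpace M] [ChartedSpace (EuclideanSpace ℝ (Fin n)) M]

local notation "𝔼" n => EuclideanSpace ℝ (Fin n)
local notation "𝔹" n => (EuclideanSpace ℝ (Fin n)) →L[ℝ] (EuclideanSpace ℝ (Fin n)) →L[ℝ] ℝ

instance continuousAdd_bilin : ContinuousAdd (𝔹 n) :=
  (inferInstance : IsTopologicalAddGroup (𝔹 n)).toContinuousAdd

/-- The bilinear form with a given Gram matrix. -/
noncomputable def bilinOf (m : Matrix (Fin n) (Fin n) ℝ) : 𝔹 n :=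
  ∑ i, ∑ j, m i j • (EuclideanSpace.proj i : (𝔼 n) →L[ℝ] ℝ).smulRight
    (EuclideanSpace.proj j : (𝔼 n) →L[ℝ] ℝ)

theorem bilinOf_apply (m : Matrix (Fin n) (Fin n) ℝ) (v w : 𝔼 n) :
    bilinOf m v w = ∑ i, ∑ j, v i * m i j * w j := by
  simp only [bilinOf, sum_apply, smul_apply, ContinuousLinearMap.smulRight_apply, smul_eq_mul,
    PiLp.proj_apply]
  exact Finset.sum_congr rfl fun i _ => Finset.sum_congr rfl fun j _ => by ring

/-- Bilinear forms on the model space correspond to matrices. -/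
noncomputable def bilinEquiv (n : ℕ) : (𝔹 n) ≃ₗ[ℝ] Matrix (Fin n) (Fin n) ℝ where
  toFun B := Matrix.of fun i j =>
    B (EuclideanSpace.single i (1 : ℝ)) (EuclideanSpace.single j (1 : ℝ))
  map_add' B C := by ext i j; simp
  map_smul' a B := by ext i j; simp
  invFun := bilinOf
  left_inv B := by
    refine ContinuousLinearMap.ext fun v => ContinuousLinearMap.ext fun w => ?_
    rw [bilinOf_apply, bilin_apply_eq B v w]
    rfl
  right_inv m := by
    ext i j
    simp [bilinOf_apply]

/-- Bilinear forms on the model space correspond to matrices, continuously. -/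
noncomputable def bilinCLE (n : ℕ) : (𝔹 n) ≃L[ℝ] Matrix (Fin n) (Fin n) ℝ :=
  { bilinEquiv n with
    continuous_toFun := by
      exact continuous_matrix fun i j =>
        (continuous_id.clm_apply continuous_const).clm_apply continuous_const
    continuous_invFun := by
      change Continuous bilinOf
      unfold bilinOf
      exact continuous_finsetSum _ fun i _ => continuous_finsetSum _ fun j _ =>
        (continuous_id.matrix_elem i j).smul continuous_const }

/-- The tensor field with given Gram matrices. -/
noncomputable def ofGram (m : M → Matrix (Fin n) (Fin n) ℝ) : TensorField n M :=
  fun x => bilinOf (m x)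

theorem gram_ofGram (m : M → Matrix (Fin n) (Fin n) ℝ) (x : M) : gram (ofGram m) x = m x :=
  (bilinEquiv n).right_inv (m x)

/-- Curves of tensor fields with smooth coefficients in all charts. -/
def SmoothTensor (J : Set ℝ) (c : ℝ → TensorField n M) : Prop :=
  ∀ y : M, ContDiffOn ℝ ∞ (fun p : ℝ × 𝔼 n => chartGram (c p.1) y p.2)
    (J ×ˢ (chartAt (𝔼 n) y).target)

/-- Curves of functions which are smooth in all charts. -/
def SmoothFun {F : Type*} [NormedAddCommGroup F] [NormedSpace ℝ F] (J : Set ℝ) (f : ℝ → M → F) :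
    Prop :=
  ∀ y : M, ContDiffOn ℝ ∞ (fun p : ℝ × 𝔼 n => f p.1 ((chartAt (𝔼 n) y).symm p.2))
    (J ×ˢ (chartAt (𝔼 n) y).target)

variable [IsManifold (𝓡 n) ∞ M]

/-- The trivialization of the bundle of bilinear forms precomposes both slots with the inverse
tangent trivialization, that is, with the derivative of the inverse chart. -/
theorem tensor_trivialization_apply (y : M) (x : M) (hx : x ∈ (chartAt (𝔼 n) y).source)
    (h : 𝔹 n) (v w : 𝔼 n) :
    (trivializationAt (𝔹 n)
      (fun x : M => TangentSpace (𝓡 n) x →L[ℝ] TangentSpace (𝓡 n) x →L[ℝ] ℝ) y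
      ⟨x, h⟩).2 v w =
    h (chartDeriv y (chartAt (𝔼 n) y x) v) (chartDeriv y (chartAt (𝔼 n) y x) w) := by
  rw [hom_trivializationAt_apply]
  have h1 := symmL_eq_chartDeriv y ((chartAt (𝔼 n) y).map_source hx)
  rw [(chartAt (𝔼 n) y).left_inv hx] at h1
  have h2 := inCoordinates_apply_eq₂ (𝕜 := ℝ) (F₁ := 𝔼 n) (F₂ := 𝔼 n) (F₃ := ℝ)
    (E₁ := fun x : M => TangentSpace (𝓡 n) x) (E₂ := fun x : M => TangentSpace (𝓡 n) x)
    (E₃ := fun _ : M => ℝ) (x₀ := y) (x := x) (ϕ := h) (v := v) (w := w)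
    (by simpa using hx) (by simpa using hx) (by simp)
  refine h2.trans ?_
  rw [h1, h1]
  simp
  rfl

theorem contMDiffOn_chart_iff {F : Type*} [NormedAddCommGroup F] [NormedSpace ℝ F]
    {J : Set ℝ} {u : ℝ × M → F} (y : M) :
    ContMDiffOn (𝓘(ℝ, ℝ).prod (𝓡 n)) 𝓘(ℝ, F) ∞ u (J ×ˢ (chartAt (𝔼 n) y).source) ↔
    ContDiffOn ℝ ∞ (fun p : ℝ × 𝔼 n => u (p.1, (chartAt (𝔼 n) y).symm p.2))
      (J ×ˢ (chartAt (𝔼 n) y).target) := by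
  rw [← contMDiffOn_iff_contDiffOn]
  constructor
  · intro h
    have h1 : ContMDiffOn 𝓘(ℝ, ℝ × 𝔼 n) (𝓘(ℝ, ℝ).prod (𝓡 n)) ∞
        (fun p : ℝ × 𝔼 n => (p.1, (chartAt (𝔼 n) y).symm p.2))
        (J ×ˢ (chartAt (𝔼 n) y).target) := by
      refine ContMDiffOn.prodMk contDiff_fst.contMDiff.contMDiffOn ?_
      exact (contMDiffOn_chartSymm y).comp contDiff_snd.contMDiff.contMDiffOn
        fun p hp => hp.2
    exact h.comp h1 fun p hp => ⟨hp.1, (chartAt (𝔼 n) y).map_target hp.2⟩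
  · intro h
    have h1 : ContMDiffOn (𝓘(ℝ, ℝ).prod (𝓡 n)) 𝓘(ℝ, ℝ × 𝔼 n) ∞
        (fun p : ℝ × M => (p.1, (chartAt (𝔼 n) y) p.2))
        (J ×ˢ (chartAt (𝔼 n) y).source) := by
      refine ContMDiffOn.prodMk_space contMDiff_fst.contMDiffOn ?_
      exact (contMDiffOn_chart y).comp contMDiff_snd.contMDiffOn fun p hp => hp.2
    refine (h.comp h1 fun p hp => ⟨hp.1, (chartAt (𝔼 n) y).map_source hp.2⟩).congr ?_
    intro p hp
    simp only [Function.comp_apply, (chartAt (𝔼 n) y).left_inv hp.2]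

theorem bilinCLE_trivialization (y : M) {z : 𝔼 n} (hz : z ∈ (chartAt (𝔼 n) y).target)
    (h : TensorField n M) :
    bilinCLE n (trivializationAt (𝔹 n)
      (fun x : M => TangentSpace (𝓡 n) x →L[ℝ] TangentSpace (𝓡 n) x →L[ℝ] ℝ) y
      ⟨(chartAt (𝔼 n) y).symm z, h ((chartAt (𝔼 n) y).symm z)⟩).2 = chartGram h y z := by
  ext i j
  refine (tensor_trivialization_apply y _ ((chartAt (𝔼 n) y).map_target hz) _ _ _).trans ?_
  rw [(chartAt (𝔼 n) y).right_inv hz]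
  rfl

/-- Smoothness of a section may be tested near each point in the chart centred there. In that chart
the fibre component is the coefficient matrix, up to the fixed linear isomorphism `bilinCLE`. -/
theorem isSmoothCurveOn_iff {J : Set ℝ} {c : ℝ → TensorField n M} :
    IsSmoothCurveOn J c ↔ SmoothTensor J c := by
  have key : ∀ y : M, ContMDiffOn (𝓘(ℝ, ℝ).prod (𝓡 n)) ((𝓡 n).prod 𝓘(ℝ, 𝔹 n)) ∞
      (fun p : ℝ × M => Bundle.TotalSpace.mk' (𝔹 n)
        (E := fun x : M => TangentSpace (𝓡 n) x →L[ℝ] TangentSpace (𝓡 n) x →L[ℝ] ℝ)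
        p.2 (c p.1 p.2)) (J ×ˢ (chartAt (𝔼 n) y).source) ↔
      ContDiffOn ℝ ∞ (fun p : ℝ × 𝔼 n => chartGram (c p.1) y p.2)
        (J ×ˢ (chartAt (𝔼 n) y).target) := by
    intro y
    have : ∀ x : M, ContinuousAdd (TangentSpace (𝓡 n) x →L[ℝ] ℝ) :=
      fun x => inferInstanceAs (ContinuousAdd ((𝔼 n) →L[ℝ] ℝ))
    rw [(trivializationAt (𝔹 n) (fun x : M =>
        TangentSpace (𝓡 n) x →L[ℝ] TangentSpace (𝓡 n) x →L[ℝ] ℝ) y).contMDiffOn_iff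
        (fun p hp => by simpa [Bundle.TotalSpace.mk'] using hp.2)]
    rw [and_iff_right contMDiff_snd.contMDiffOn, contMDiffOn_chart_iff,
      ← (bilinCLE n).comp_contDiffOn_iff]
    refine contDiffOn_congr fun p hp => ?_
    exact bilinCLE_trivialization y hp.2 (c p.1)
  constructor
  · exact fun h y => (key y).1 (h.mono (prod_mono le_rfl (subset_univ _)))
  · intro h p hp
    have h1 := (key p.2).2 (h p.2) p ⟨hp.1, mem_chart_source _ _⟩
    refine h1.mono_of_mem_nhdsWithin ?_
    have h2 : (univ : Set ℝ) ×ˢ (chartAt (𝔼 n) p.2).source ∈ 𝓝 p :=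
      prod_mem_nhds univ_mem ((chartAt (𝔼 n) p.2).open_source.mem_nhds (mem_chart_source _ _))
    filter_upwards [self_mem_nhdsWithin, mem_nhdsWithin_of_mem_nhds h2] with q hq hq2
    exact ⟨hq.1, hq2.2⟩

theorem isSmoothSym_iff {h : TensorField n M} :
    IsSmoothSym h ↔ (∀ (x : M) (v w : TangentSpace (𝓡 n) x), h x v w = h x w v) ∧
      SmoothTensor univ (fun _ => h) := by
  rw [← isSmoothCurveOn_iff]
  constructor
  · intro hh
    exact ⟨hh.symm, hh.smooth.comp_contMDiffOn contMDiff_snd.contMDiffOn⟩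
  · intro hh
    refine ⟨hh.1, ?_⟩
    have h1 : ContMDiff (𝓡 n) (𝓘(ℝ, ℝ).prod (𝓡 n)) ∞ (fun x : M => ((0 : ℝ), x)) :=
      contMDiff_const.prodMk contMDiff_id
    have h2 := hh.2
    rw [IsSmoothCurveOn, univ_prod_univ, contMDiffOn_univ] at h2
    exact h2.comp h1

theorem smoothFun_iff {F : Type*} [NormedAddCommGroup F] [NormedSpace ℝ F] {J : Set ℝ}
    {f : ℝ → M → F} : SmoothFun (n := n) J f ↔ ContMDiffOn (𝓘(ℝ, ℝ).prod (𝓡 n)) 𝓘(ℝ, F) ∞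
      (fun p : ℝ × M => f p.1 p.2) (J ×ˢ univ) := by
  constructor
  · intro h p hp
    have h1 := (contMDiffOn_chart_iff (u := fun p : ℝ × M => f p.1 p.2) p.2).2 (h p.2) p
      ⟨hp.1, mem_chart_source _ _⟩
    refine h1.mono_of_mem_nhdsWithin ?_
    have h2 : (univ : Set ℝ) ×ˢ (chartAt (𝔼 n) p.2).source ∈ 𝓝 p :=
      prod_mem_nhds univ_mem ((chartAt (𝔼 n) p.2).open_source.mem_nhds (mem_chart_source _ _))
    filter_upwards [self_mem_nhdsWithin, mem_nhdsWithin_of_mem_nhds h2] with q hq hq2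
    exact ⟨hq.1, hq2.2⟩
  · intro h y
    exact (contMDiffOn_chart_iff (u := fun p : ℝ × M => f p.1 p.2) y).1
      (h.mono (prod_mono le_rfl (subset_univ _)))

end
end GenCalabi

/-! ### Matrix calculus and behaviour under change of frame -/

open Set Filter Topology MeasureTheory
open scoped Manifold ContDiff
namespace GenCalabi

section MatrixCalculus
open scoped Matrix.Norms.Operator

variable {n : ℕ}

local notation "Mat" => Matrix (Fin n) (Fin n) ℝ

theorem contDiff_matrix_entry (i j : Fin n) : ContDiff ℝ ∞ (fun m : Mat => m i j) :=
  (LinearMap.toContinuousLinearMap (Matrix.entryLinearMap ℝ ℝ i j)).contDiff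

theorem contDiff_matrix_trace : ContDiff ℝ ∞ (fun m : Mat => m.trace) :=
  (LinearMap.toContinuousLinearMap (Matrix.traceLinearMap (Fin n) ℝ ℝ)).contDiff

theorem contDiff_matrix_det : ContDiff ℝ ∞ (fun m : Mat => m.det) := by
  simp only [Matrix.det_apply]
  refine ContDiff.sum fun σ _ => ContDiff.const_smul _ ?_
  exact contDiff_prod fun i _ => contDiff_matrix_entry _ _

theorem contDiffAt_matrix_inv {m : Mat} (hm : m.det ≠ 0) :
    ContDiffAt ℝ ∞ (fun m : Mat => m⁻¹) m := by
  have h : (fun m : Mat => m⁻¹) = Ring.inverse := by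
    funext m; exact Matrix.nonsing_inv_eq_ringInverse m
  rw [h]
  have hu : IsUnit m := (Matrix.isUnit_iff_isUnit_det m).2 (isUnit_iff_ne_zero.2 hm)
  obtain ⟨u, rfl⟩ := hu
  exact contDiffAt_ringInverse ℝ u

theorem contDiffOn_matrix_inv {E : Type*} [NormedAddCommGroup E] [NormedSpace ℝ E] {s : Set E}
    {f : E → Mat} (hf : ContDiffOn ℝ ∞ f s) (h : ∀ p ∈ s, (f p).det ≠ 0) :
    ContDiffOn ℝ ∞ (fun p => (f p)⁻¹) s :=
  fun p hp => (contDiffAt_matrix_inv (h p hp)).comp_contDiffWithinAt p (hf p hp)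

theorem HasDerivWithinAt.matrix_entry {f : ℝ → Mat} {f' : Mat} {s : Set ℝ} {t : ℝ}
    (hf : HasDerivWithinAt f f' s t) (i j : Fin n) :
    HasDerivWithinAt (fun u => f u i j) (f' i j) s t :=
  (LinearMap.toContinuousLinearMap
    (Matrix.entryLinearMap ℝ ℝ i j)).hasFDerivAt.comp_hasDerivWithinAt t hf

theorem HasDerivWithinAt.matrix_trace {f : ℝ → Mat} {f' : Mat} {s : Set ℝ} {t : ℝ}
    (hf : HasDerivWithinAt f f' s t) :
    HasDerivWithinAt (fun u => (f u).trace) f'.trace s t :=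
  (LinearMap.toContinuousLinearMap
    (Matrix.traceLinearMap (Fin n) ℝ ℝ)).hasFDerivAt.comp_hasDerivWithinAt t hf

theorem HasDerivWithinAt.matrix_inv {f : ℝ → Mat} {f' : Mat} {s : Set ℝ} {t : ℝ}
    (hf : HasDerivWithinAt f f' s t) (h : (f t).det ≠ 0) :
    HasDerivWithinAt (fun u => (f u)⁻¹) (-((f t)⁻¹ * f' * (f t)⁻¹)) s t := by
  have h0 : (fun m : Mat => m⁻¹) = Ring.inverse := by
    funext m; exact Matrix.nonsing_inv_eq_ringInverse m
  have hu : IsUnit (f t) := (Matrix.isUnit_iff_isUnit_det _).2 (isUnit_iff_ne_zero.2 h)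
  obtain ⟨u, hu⟩ := hu
  have h1 := hasFDerivAt_ringInverse (𝕜 := ℝ) u
  rw [hu, ← h0] at h1
  have h2 := h1.comp_hasDerivWithinAt t hf
  have h3 : ((u⁻¹ : Matˣ) : Mat) = (f t)⁻¹ := by rw [← hu, Matrix.coe_units_inv]
  simpa [h3] using! h2

/-- Jacobi's formula at the identity, read off from the polynomial `det (1 + X m)`. The general case
follows by factoring `m` out of `m + s k`. -/
theorem hasDerivAt_det_one_add (m : Mat) :
    HasDerivAt (fun s : ℝ => (1 + s • m).det) m.trace 0 := by
  have h := Matrix.derivative_det_one_add_X_smul m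
  have h1 := (Matrix.det (1 + (Polynomial.X : Polynomial ℝ) • m.map Polynomial.C)).hasDerivAt 0
  rw [h] at h1
  refine h1.congr_of_eventuallyEq (Eventually.of_forall fun s => ?_)
  change (1 + s • m).det = _
  change (1 + s • m).det = Polynomial.evalRingHom s _
  rw [RingHom.map_det]
  congr 1
  ext i j
  simp [Matrix.one_apply, apply_ite (Polynomial.eval s)]
  ring

theorem fderiv_matrix_det {m : Mat} (hm : m.det ≠ 0) (k : Mat) :
    fderiv ℝ (fun m : Mat => m.det) m k = m.det * (m⁻¹ * k).trace := by
  have h1 : HasFDerivAt (fun m : Mat => m.det) (fderiv ℝ (fun m : Mat => m.det) m) m :=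
    (contDiff_matrix_det.differentiable (by simp) m).hasFDerivAt
  have h2 : HasDerivAt (fun s : ℝ => m + s • k) k 0 := by
    have h := ((hasDerivAt_id (0 : ℝ)).smul_const k).const_add m
    rwa [one_smul] at h
  have h3 : HasDerivAt (fun s : ℝ => (m + s • k).det) (fderiv ℝ (fun m : Mat => m.det) m k) 0 := by
    refine HasFDerivAt.comp_hasDerivAt (l := fun m : Mat => m.det) 0 ?_ h2
    rw [zero_smul, add_zero]
    exact h1
  have h4 := (hasDerivAt_det_one_add (m⁻¹ * k)).const_mul m.det
  refine h3.unique (h4.congr_of_eventuallyEq (Eventually.of_forall fun s => ?_))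
  change (m + s • k).det = m.det * (1 + s • (m⁻¹ * k)).det
  rw [← Matrix.det_mul, mul_add, mul_one, Matrix.mul_smul,
    Matrix.mul_nonsing_inv_cancel_left _ _ (isUnit_iff_ne_zero.2 hm)]

theorem HasDerivWithinAt.matrix_det {f : ℝ → Mat} {f' : Mat} {s : Set ℝ} {t : ℝ}
    (hf : HasDerivWithinAt f f' s t) (h : (f t).det ≠ 0) :
    HasDerivWithinAt (fun u => (f u).det) ((f t).det * ((f t)⁻¹ * f').trace) s t := by
  rw [← fderiv_matrix_det h]
  exact (contDiff_matrix_det.differentiable (by simp) (f t)).hasFDerivAt.comp_hasDerivWithinAt t hf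

/-- Gram matrices transform by congruence, so `G⁻¹ H` transforms by conjugation. Traces, products
and exponentials of such endomorphisms are therefore independent of the frame. -/
theorem inv_mul_congruence {P : Mat} (hP : IsUnit P) (G H : Mat) :
    (P.transpose * G * P)⁻¹ * (P.transpose * H * P) = P⁻¹ * (G⁻¹ * H) * P := by
  have hd : IsUnit P.det := (Matrix.isUnit_iff_isUnit_det P).1 hP
  have hd' : IsUnit P.transpose.det := by rwa [Matrix.det_transpose]
  rw [Matrix.mul_inv_rev, Matrix.mul_inv_rev]
  calc P⁻¹ * (G⁻¹ * P.transpose⁻¹) * (P.transpose * H * P)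
      = P⁻¹ * G⁻¹ * (P.transpose⁻¹ * P.transpose) * H * P := by noncomm_ring
    _ = _ := by rw [Matrix.nonsing_inv_mul _ hd']; noncomm_ring

theorem conj_mul_conj {P : Mat} (hP : IsUnit P) (X Y : Mat) :
    (P⁻¹ * X * P) * (P⁻¹ * Y * P) = P⁻¹ * (X * Y) * P := by
  have hd : IsUnit P.det := (Matrix.isUnit_iff_isUnit_det P).1 hP
  calc (P⁻¹ * X * P) * (P⁻¹ * Y * P) = P⁻¹ * X * (P * P⁻¹) * Y * P := by noncomm_ring
    _ = _ := by rw [Matrix.mul_nonsing_inv _ hd]; noncomm_ring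

theorem trace_conj {P : Mat} (hP : IsUnit P) (X : Mat) : (P⁻¹ * X * P).trace = X.trace := by
  have hd : IsUnit P.det := (Matrix.isUnit_iff_isUnit_det P).1 hP
  rw [Matrix.trace_mul_comm, ← mul_assoc, Matrix.mul_nonsing_inv _ hd, one_mul]

theorem congruence_mul_conj {P : Mat} (hP : IsUnit P) (G X : Mat) :
    (P.transpose * G * P) * (P⁻¹ * X * P) = P.transpose * (G * X) * P := by
  have hd : IsUnit P.det := (Matrix.isUnit_iff_isUnit_det P).1 hP
  calc (P.transpose * G * P) * (P⁻¹ * X * P) = P.transpose * G * (P * P⁻¹) * X * P := by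
        noncomm_ring
    _ = _ := by rw [Matrix.mul_nonsing_inv _ hd]; noncomm_ring

theorem exp_conj_frame {P : Mat} (hP : IsUnit P) (X : Mat) :
    NormedSpace.exp (P⁻¹ * X * P) = P⁻¹ * NormedSpace.exp X * P :=
  Matrix.exp_conj' P X hP

theorem contDiff_matrix_exp : ContDiff ℝ ∞ (fun m : Mat => NormedSpace.exp m) := by
  refine contDiff_iff_contDiffAt.2 fun m => ?_
  exact (NormedSpace.exp_analytic (𝕂 := ℝ) m).contDiffAt

end MatrixCalculus

end GenCalabi

/-! ### Operations on smooth curves of tensor fields -/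

open Set Filter Topology MeasureTheory
open scoped Manifold ContDiff
namespace GenCalabi

section
open scoped Matrix.Norms.Operator

variable {n : ℕ}

local notation "Mat" => Matrix (Fin n) (Fin n) ℝ
local notation "𝔼" n => EuclideanSpace ℝ (Fin n)

theorem hasDerivWithinAt_slice {E F : Type*} [NormedAddCommGroup E] [NormedSpace ℝ E]
    [NormedAddCommGroup F] [NormedSpace ℝ F] {J : Set ℝ} {T : Set E} {f : ℝ × E → F}
    (hf : ContDiffOn ℝ ∞ f (J ×ˢ T)) {p : ℝ × E} (hp : p ∈ J ×ˢ T) :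
    HasDerivWithinAt (fun s => f (s, p.2)) (fderivWithin ℝ f (J ×ˢ T) p (1, 0)) J p.1 := by
  have h1 := (hf.differentiableOn (by simp) p hp).hasFDerivWithinAt
  have h2 : HasDerivWithinAt (fun s : ℝ => (s, p.2)) ((1 : ℝ), (0 : E)) J p.1 :=
    (hasDerivWithinAt_id _ _).prodMk (hasDerivWithinAt_const _ _ _)
  have h3 : MapsTo (fun s : ℝ => (s, p.2)) J (J ×ˢ T) := fun s hs => ⟨hs, hp.2⟩
  exact h1.comp_hasDerivWithinAt p.1 h2 h3

/-- The time derivative is the total derivative applied to `(1, 0)`. Unique differentiability of `J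
×ˢ T` keeps it smooth up to an endpoint of `J`, which matters because geodesics live on intervals
`[0, T)`. -/
theorem contDiffOn_derivWithin_slice {E F : Type*} [NormedAddCommGroup E] [NormedSpace ℝ E]
    [NormedAddCommGroup F] [NormedSpace ℝ F] {J : Set ℝ} (hJ : UniqueDiffOn ℝ J) {T : Set E}
    (hT : IsOpen T) {f : ℝ × E → F} (hf : ContDiffOn ℝ ∞ f (J ×ˢ T)) :
    ContDiffOn ℝ ∞ (fun p : ℝ × E => derivWithin (fun s => f (s, p.2)) J p.1) (J ×ˢ T) := by
  have h1 := hf.fderivWithin (m := ∞) (hJ.prod hT.uniqueDiffOn) (by simp)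
  refine (h1.clm_apply (contDiffOn_const (c := ((1 : ℝ), (0 : E))))).congr fun p hp => ?_
  exact (hasDerivWithinAt_slice hf hp).derivWithin (hJ p.1 hp.1)

variable {M : Type*} [TopologicalSpace M] [ChartedSpace (𝔼 n) M]

theorem gram_add (h k : TensorField n M) (x : M) : gram (h + k) x = gram h x + gram k x := by
  ext i j; rfl

theorem gram_smul (a : ℝ) (h : TensorField n M) (x : M) : gram (a • h) x = a • gram h x := by
  ext i j; rfl

theorem gram_fun_smul_apply (a : M → ℝ) (h : TensorField n M) (x : M) :
    gram (fun x => a x • h x) x = a x • gram h x := by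
  ext i j; rfl

theorem chartGram_ofGram (m : M → Mat) (y : M) (z : 𝔼 n) :
    chartGram (ofGram m) y z =
      (frameChange y z).transpose * m ((chartAt (𝔼 n) y).symm z) * frameChange y z := by
  rw [chartGram_eq, gram_ofGram]

theorem SmoothTensor.mono {J J' : Set ℝ} {c : ℝ → TensorField n M} (hc : SmoothTensor J c)
    (h : J' ⊆ J) : SmoothTensor J' c :=
  fun y => (hc y).mono (prod_mono h le_rfl)

theorem SmoothFun.mono {F : Type*} [NormedAddCommGroup F] [NormedSpace ℝ F]
    {J J' : Set ℝ} {c : ℝ → M → F} (hc : SmoothFun (n := n) J c)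
    (h : J' ⊆ J) : SmoothFun (n := n) J' c :=
  fun y => (hc y).mono (prod_mono h le_rfl)

theorem SmoothTensor.const_curve {c : TensorField n M} (hc : SmoothTensor univ fun _ => c)
    (J : Set ℝ) : SmoothTensor J fun _ => c := hc.mono (subset_univ J)

theorem SmoothTensor.congr {J : Set ℝ} {c c' : ℝ → TensorField n M} (hc : SmoothTensor J c)
    (h : ∀ t ∈ J, ∀ x, gram (c' t) x = gram (c t) x) : SmoothTensor J c' := by
  refine fun y => (hc y).congr fun p hp => ?_
  rw [chartGram_eq, chartGram_eq, h _ hp.1]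

theorem SmoothFun.congr {F : Type*} [NormedAddCommGroup F] [NormedSpace ℝ F]
    {J : Set ℝ} {c c' : ℝ → M → F} (hc : SmoothFun (n := n) J c)
    (h : ∀ t ∈ J, ∀ x, c' t x = c t x) : SmoothFun (n := n) J c' :=
  fun y => (hc y).congr fun _ hp => h _ hp.1 _

theorem SmoothTensor.slice {J : Set ℝ} {c : ℝ → TensorField n M} (hc : SmoothTensor J c)
    {t : ℝ} (ht : t ∈ J) : SmoothTensor univ (fun _ => c t) := by
  intro y
  exact (hc y).comp (contDiff_const.prodMk contDiff_snd).contDiffOn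
    (g := fun p : ℝ × 𝔼 n => chartGram (c p.1) y p.2) fun p hp => ⟨ht, hp.2⟩

theorem SmoothTensor.add {J : Set ℝ} {c d : ℝ → TensorField n M} (hc : SmoothTensor J c)
    (hd : SmoothTensor J d) : SmoothTensor J (fun t => c t + d t) := by
  refine fun y => ((hc y).add (hd y)).congr fun p hp => ?_
  simp only [chartGram_eq, gram_add, mul_add, add_mul]

theorem SmoothTensor.smul {J : Set ℝ} {f : ℝ → M → ℝ} {c : ℝ → TensorField n M}
    (hf : SmoothFun (n := n) J f) (hc : SmoothTensor J c) :
    SmoothTensor J (fun t x => f t x • c t x) := by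
  refine fun y => ((hf y).smul (hc y)).congr fun p hp => ?_
  simp only [chartGram_eq, gram_fun_smul_apply, Matrix.mul_smul, Matrix.smul_mul]
  rfl

theorem SmoothFun.time {J : Set ℝ} {f : ℝ → ℝ} (hf : ContDiffOn ℝ ∞ f J) :
    SmoothFun (n := n) (M := M) J (fun t _ => f t) :=
  fun _ => hf.comp contDiff_fst.contDiffOn fun _ hp => hp.1

theorem SmoothFun.const {J : Set ℝ} (a : ℝ) :
    SmoothFun (n := n) (M := M) J (fun _ _ => a) :=
  fun _ => contDiffOn_const

theorem SmoothFun.add {J : Set ℝ} {f g : ℝ → M → ℝ} (hf : SmoothFun (n := n) J f)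
    (hg : SmoothFun (n := n) J g) : SmoothFun (n := n) J (fun t x => f t x + g t x) :=
  fun y => (hf y).add (hg y)

theorem SmoothFun.sub {J : Set ℝ} {f g : ℝ → M → ℝ} (hf : SmoothFun (n := n) J f)
    (hg : SmoothFun (n := n) J g) : SmoothFun (n := n) J (fun t x => f t x - g t x) :=
  fun y => (hf y).sub (hg y)

theorem SmoothFun.mul {J : Set ℝ} {f g : ℝ → M → ℝ} (hf : SmoothFun (n := n) J f)
    (hg : SmoothFun (n := n) J g) : SmoothFun (n := n) J (fun t x => f t x * g t x) :=
  fun y => (hf y).mul (hg y)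

theorem SmoothFun.sqrt {J : Set ℝ} {f : ℝ → M → ℝ} (hf : SmoothFun (n := n) J f)
    (h : ∀ t ∈ J, ∀ x, 0 < f t x) : SmoothFun (n := n) J (fun t x => Real.sqrt (f t x)) :=
  fun y => (hf y).sqrt fun _ hp => (h _ hp.1 _).ne'

variable [IsManifold (𝓡 n) ∞ M]

theorem chartGram_inv_mul (g h : TensorField n M) {y : M} {z : 𝔼 n}
    (hz : z ∈ (chartAt (𝔼 n) y).target) :
    (chartGram g y z)⁻¹ * chartGram h y z = (frameChange y z)⁻¹ *
      ((gram g ((chartAt (𝔼 n) y).symm z))⁻¹ * gram h ((chartAt (𝔼 n) y).symm z)) *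
        frameChange y z := by
  rw [chartGram_eq, chartGram_eq, inv_mul_congruence (isUnit_frameChange y hz)]

theorem traceProd_eq_chart (g h k : TensorField n M) {y : M} {z : 𝔼 n}
    (hz : z ∈ (chartAt (𝔼 n) y).target) :
    traceProd g h k ((chartAt (𝔼 n) y).symm z) =
      ((chartGram g y z)⁻¹ * chartGram h y z *
        ((chartGram g y z)⁻¹ * chartGram k y z)).trace := by
  rw [chartGram_inv_mul g h hz, chartGram_inv_mul g k hz, conj_mul_conj (isUnit_frameChange y hz),
    trace_conj (isUnit_frameChange y hz), traceProd]

theorem det_frameChange_ne_zero {y : M} {z : 𝔼 n} (hz : z ∈ (chartAt (𝔼 n) y).target) :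
    (frameChange y z).det ≠ 0 :=
  isUnit_iff_ne_zero.1 ((Matrix.isUnit_iff_isUnit_det _).1 (isUnit_frameChange y hz))

omit [IsManifold (𝓡 n) ∞ M] in
theorem det_chartGram (g : TensorField n M) (y : M) (z : 𝔼 n) :
    (chartGram g y z).det =
      (frameChange y z).det ^ 2 * (gram g ((chartAt (𝔼 n) y).symm z)).det := by
  rw [chartGram_eq, Matrix.det_mul, Matrix.det_mul, Matrix.det_transpose]; ring

theorem det_chartGram_ne_zero {g : TensorField n M} {y : M} {z : 𝔼 n}
    (hz : z ∈ (chartAt (𝔼 n) y).target) (hg : (gram g ((chartAt (𝔼 n) y).symm z)).det ≠ 0) :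
    (chartGram g y z).det ≠ 0 := by
  rw [det_chartGram]
  exact mul_ne_zero (pow_ne_zero _ (det_frameChange_ne_zero hz)) hg

theorem SmoothTensor.traceProd {J : Set ℝ} {g h k : ℝ → TensorField n M} (hg : SmoothTensor J g)
    (hh : SmoothTensor J h) (hk : SmoothTensor J k)
    (hdet : ∀ t ∈ J, ∀ x, (gram (g t) x).det ≠ 0) :
    SmoothFun (n := n) J (fun t x => traceProd (g t) (h t) (k t) x) := by
  intro y
  have hi := contDiffOn_matrix_inv (hg y) fun p hp =>
    det_chartGram_ne_zero hp.2 (hdet _ hp.1 _)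
  refine (contDiff_matrix_trace.comp_contDiffOn ((hi.mul (hh y)).mul (hi.mul (hk y)))).congr
    fun p hp => ?_
  exact traceProd_eq_chart _ _ _ hp.2

/-- Each determinant depends on the frame through the squared determinant of the frame change; these
factors cancel in the quotient, leaving a function on `M`. -/
theorem SmoothTensor.det_div {J : Set ℝ} {g h : ℝ → TensorField n M} (hg : SmoothTensor J g)
    (hh : SmoothTensor J h) (hdet : ∀ t ∈ J, ∀ x, (gram (g t) x).det ≠ 0) :
    SmoothFun (n := n) J (fun t x => (gram (h t) x).det / (gram (g t) x).det) := by
  intro y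
  refine ((contDiff_matrix_det.comp_contDiffOn (hh y)).div (contDiff_matrix_det.comp_contDiffOn
    (hg y)) fun p hp => det_chartGram_ne_zero hp.2 (hdet _ hp.1 _)).congr fun p hp => ?_
  change _ = (chartGram (h p.1) y p.2).det / (chartGram (g p.1) y p.2).det
  rw [det_chartGram, det_chartGram, mul_div_mul_left _ _ (pow_ne_zero _ (det_frameChange_ne_zero hp.2))]

theorem SmoothTensor.sandwich {J : Set ℝ} {g h k : ℝ → TensorField n M} (hg : SmoothTensor J g)
    (hh : SmoothTensor J h) (hk : SmoothTensor J k)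
    (hdet : ∀ t ∈ J, ∀ x, (gram (g t) x).det ≠ 0) :
    SmoothTensor J (fun t => ofGram fun x =>
      gram (h t) x * ((gram (g t) x)⁻¹ * gram (k t) x)) := by
  intro y
  have hi := contDiffOn_matrix_inv (hg y) fun p hp =>
    det_chartGram_ne_zero hp.2 (hdet _ hp.1 _)
  refine ((hh y).mul (hi.mul (hk y))).congr fun p hp => ?_
  rw [chartGram_inv_mul _ _ hp.2, chartGram_ofGram, chartGram_eq,
    congruence_mul_conj (isUnit_frameChange y hp.2)]

/-- The exponential commutes with conjugation, so `G exp (f G⁻¹ H)` again transforms by congruence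
and defines a tensor field. -/
theorem SmoothTensor.mul_exp {J : Set ℝ} {g h : ℝ → TensorField n M} {f : ℝ → M → ℝ}
    (hg : SmoothTensor J g) (hh : SmoothTensor J h) (hf : SmoothFun (n := n) J f)
    (hdet : ∀ t ∈ J, ∀ x, (gram (g t) x).det ≠ 0) :
    SmoothTensor J (fun t => ofGram fun x =>
      gram (g t) x * NormedSpace.exp (f t x • ((gram (g t) x)⁻¹ * gram (h t) x))) := by
  intro y
  have hi := contDiffOn_matrix_inv (hg y) fun p hp =>
    det_chartGram_ne_zero hp.2 (hdet _ hp.1 _)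
  refine ((hg y).mul (contDiff_matrix_exp.comp_contDiffOn
    ((hf y).smul (hi.mul (hh y))))).congr fun p hp => ?_
  change _ = chartGram (g p.1) y p.2 * NormedSpace.exp (f p.1 ((chartAt (𝔼 n) y).symm p.2) •
    ((chartGram (g p.1) y p.2)⁻¹ * chartGram (h p.1) y p.2))
  have hs : ∀ (a : ℝ) (P X : Mat), a • (P⁻¹ * X * P) = P⁻¹ * (a • X) * P := fun a P X => by
    rw [Matrix.mul_smul, Matrix.smul_mul]
  rw [chartGram_inv_mul _ _ hp.2, chartGram_ofGram, chartGram_eq, hs,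
    exp_conj_frame (isUnit_frameChange y hp.2),
    congruence_mul_conj (isUnit_frameChange y hp.2)]

theorem gram_eq_chartGram (h : TensorField n M) {y : M} {z : 𝔼 n}
    (hz : z ∈ (chartAt (𝔼 n) y).target) :
    gram h ((chartAt (𝔼 n) y).symm z) = (frameChange y z).transpose⁻¹ * chartGram h y z *
      (frameChange y z)⁻¹ := by
  have hd : IsUnit (frameChange y z).det := isUnit_iff_ne_zero.2 (det_frameChange_ne_zero hz)
  have hd' : IsUnit (frameChange y z).transpose.det := by rwa [Matrix.det_transpose]
  rw [chartGram_eq]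
  rw [← mul_assoc, Matrix.mul_nonsing_inv_cancel_right _ _ hd, Matrix.nonsing_inv_mul_cancel_left _ _ hd']

/-- The Gram matrix at `x` and the coefficients in the chart centred at `x` differ by matrices
independent of time. `bilinCLE` then passes between matrices and the space of bilinear forms in
which `velocity` is defined. -/
theorem SmoothTensor.hasDerivWithinAt_gram {J : Set ℝ} {c : ℝ → TensorField n M}
    (hc : SmoothTensor J c) {t : ℝ} (ht : t ∈ J) (x : M) :
    HasDerivWithinAt (fun s => gram (c s) x) (gram (velocity J c t) x) J t := by
  have hx := mem_chart_target (𝔼 n) x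
  have h1 := hasDerivWithinAt_slice (hc x) (p := (t, chartAt (𝔼 n) x x)) ⟨ht, hx⟩
  have h2 := (h1.const_mul (frameChange x (chartAt (𝔼 n) x x)).transpose⁻¹).mul_const
    (frameChange x (chartAt (𝔼 n) x x))⁻¹
  simp only [← gram_eq_chartGram _ hx, (chartAt (𝔼 n) x).left_inv (mem_chart_source _ x)] at h2
  have h3 : DifferentiableWithinAt ℝ (F := (𝔼 n) →L[ℝ] (𝔼 n) →L[ℝ] ℝ) (fun s => c s x) J t := by
    have h4 := HasFDerivAt.comp_hasDerivWithinAt (F := Mat)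
      (E := (𝔼 n) →L[ℝ] (𝔼 n) →L[ℝ] ℝ) t
      (ContinuousLinearMap.hasFDerivAt (E := Mat) (F := (𝔼 n) →L[ℝ] (𝔼 n) →L[ℝ] ℝ)
        ((bilinCLE n).symm : Mat →L[ℝ] ((𝔼 n) →L[ℝ] (𝔼 n) →L[ℝ] ℝ))) h2
    refine h4.differentiableWithinAt.congr (fun s _ => ?_) ?_
    · exact ((bilinCLE n).symm_apply_apply (c s x)).symm
    · exact ((bilinCLE n).symm_apply_apply (c t x)).symm
  have h5 : HasDerivWithinAt (F := (𝔼 n) →L[ℝ] (𝔼 n) →L[ℝ] ℝ) (fun s => c s x)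
    (GenCalabi.velocity J c t x) J t :=
    DifferentiableWithinAt.hasDerivWithinAt (𝕜 := ℝ) (F := (𝔼 n) →L[ℝ] (𝔼 n) →L[ℝ] ℝ) h3
  have h6 := (bilinCLE n : ((𝔼 n) →L[ℝ] (𝔼 n) →L[ℝ] ℝ) →L[ℝ] Mat).hasFDerivAt
    (x := (c t x : (𝔼 n) →L[ℝ] (𝔼 n) →L[ℝ] ℝ))
  exact HasFDerivAt.comp_hasDerivWithinAt (F := (𝔼 n) →L[ℝ] (𝔼 n) →L[ℝ] ℝ) (E := Mat) t h6 h5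

theorem SmoothTensor.velocity {J : Set ℝ} (hJ : UniqueDiffOn ℝ J) {c : ℝ → TensorField n M}
    (hc : SmoothTensor J c) : SmoothTensor J (velocity J c) := by
  intro y
  refine (contDiffOn_derivWithin_slice hJ (chartAt (𝔼 n) y).open_target (hc y)).congr
    fun p hp => ?_
  have h2 := ((hc.hasDerivWithinAt_gram hp.1 ((chartAt (𝔼 n) y).symm p.2)).const_mul
    (frameChange y p.2).transpose).mul_const (frameChange y p.2)
  simp only [← chartGram_eq] at h2
  exact (h2.derivWithin (hJ _ hp.1)).symm

end
end GenCalabi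

/-! ### The Riemannian volume measure -/

open Set Filter Topology MeasureTheory
open scoped Manifold ContDiff
namespace GenCalabi

section
open scoped Matrix.Norms.Operator

variable {n : ℕ}

local notation "Mat" => Matrix (Fin n) (Fin n) ℝ
local notation "𝔼" n => EuclideanSpace ℝ (Fin n)

variable {M : Type*} [TopologicalSpace M] [ChartedSpace (𝔼 n) M]

theorem det_frameChange (y : M) (z : 𝔼 n) : (frameChange y z).det = (chartDeriv y z).det := by
  rw [ContinuousLinearMap.det,
    ← LinearMap.det_toMatrix (EuclideanSpace.basisFun (Fin n) ℝ).toBasis]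
  congr 1

theorem measurableSet_chart_preimage [MeasurableSpace M] [BorelSpace M] (y : M) {S : Set M}
    (hS : MeasurableSet S) :
    MeasurableSet ((chartAt (𝔼 n) y).target ∩ (chartAt (𝔼 n) y).symm ⁻¹' S) := by
  have h1 := (continuousOn_iff_continuous_domRestrict.1
    (chartAt (𝔼 n) y).continuousOn_symm).measurable hS
  have h2 := MeasurableSet.subtype_image (chartAt (𝔼 n) y).open_target.measurableSet h1
  convert h2 using 1
  ext z
  simp [and_comm]

theorem image_chart_eq (y : M) {S : Set M} (hS : S ⊆ (chartAt (𝔼 n) y).source) :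
    chartAt (𝔼 n) y '' S = (chartAt (𝔼 n) y).target ∩ (chartAt (𝔼 n) y).symm ⁻¹' S := by
  ext z
  constructor
  · rintro ⟨x, hx, rfl⟩
    refine ⟨(chartAt (𝔼 n) y).map_source (hS hx), ?_⟩
    rw [mem_preimage, (chartAt (𝔼 n) y).left_inv (hS hx)]
    exact hx
  · rintro ⟨hz, hx⟩
    exact ⟨_, hx, (chartAt (𝔼 n) y).right_inv hz⟩

theorem measurableSet_piece [CompactSpace M] [Nonempty M] [MeasurableSpace M] [BorelSpace M]
    (k : ℕ) : MeasurableSet (piece n M k) :=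
  MeasurableSet.disjointed (fun j => (chartAt (𝔼 n) (chartCentre n M j)).open_source.measurableSet) k

theorem iUnion_piece [CompactSpace M] [Nonempty M] : ⋃ k, piece n M k = univ := by
  simp only [piece, iUnion_disjointed]
  refine eq_univ_of_forall fun x => ?_
  obtain ⟨k, hk⟩ := Classical.choose_spec (exists_chart_cover n M) x
  exact mem_iUnion.2 ⟨k, hk⟩

/-- The density of the volume measure in the chart centred at `y`. -/
noncomputable def chartDensity (g : TensorField n M) (y : M) (z : 𝔼 n) : ENNReal :=
  ENNReal.ofReal (Real.sqrt (chartGram g y z).det)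

variable [IsManifold (𝓡 n) ∞ M]

theorem chartDensity_transition (g : TensorField n M) (y y' : M) {z : 𝔼 n}
    (hz : z ∈ (chartAt (𝔼 n) y).target)
    (hz' : (chartAt (𝔼 n) y).symm z ∈ (chartAt (𝔼 n) y').source) :
    chartDensity g y z = ENNReal.ofReal
      |(fderiv ℝ (fun u => chartAt (𝔼 n) y' ((chartAt (𝔼 n) y).symm u)) z).det| *
      chartDensity g y' (chartAt (𝔼 n) y' ((chartAt (𝔼 n) y).symm z)) := by
  rw [chartDensity, chartDensity, ← ENNReal.ofReal_mul (abs_nonneg _), det_chartGram,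
    det_chartGram, (chartAt (𝔼 n) y').left_inv hz', det_frameChange, det_frameChange,
    (chartDeriv_comp y y' hz hz').2, ContinuousLinearMap.det, ContinuousLinearMap.toLinearMap_comp,
    LinearMap.det_comp, Real.sqrt_mul (sq_nonneg _), Real.sqrt_mul (sq_nonneg _),
    Real.sqrt_sq_eq_abs, Real.sqrt_sq_eq_abs, abs_mul]
  simp only [ContinuousLinearMap.det]
  congr 1
  ring

omit [IsManifold (𝓡 n) ∞ M] in
theorem SmoothTensor.continuousOn_chartGram {g : TensorField n M}
    (hg : SmoothTensor univ fun _ => g) (y : M) :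
    ContinuousOn (fun z => chartGram g y z) (chartAt (𝔼 n) y).target := by
  have h := (hg y).continuousOn
  generalize (chartAt (𝔼 n) y).target = S at h
  have h1 : ContinuousOn (fun z : 𝔼 n => ((0 : ℝ), z)) S :=
    (Continuous.prodMk_right (0 : ℝ)).continuousOn
  have h2 : MapsTo (fun z : 𝔼 n => ((0 : ℝ), z)) S (univ ×ˢ S) :=
    fun z hz => mk_mem_prod (mem_univ _) hz
  intro z hz
  have h3 := (h (0, z) ⟨mem_univ _, hz⟩).comp (h1 z hz) h2
  exact h3

omit [IsManifold (𝓡 n) ∞ M] in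
theorem SmoothTensor.continuousOn_density {g : TensorField n M}
    (hg : SmoothTensor univ fun _ => g) (y : M) :
    ContinuousOn (chartDensity g y) (chartAt (𝔼 n) y).target :=
  ENNReal.continuous_ofReal.comp_continuousOn (Real.continuous_sqrt.comp_continuousOn
    (contDiff_matrix_det.continuous.comp_continuousOn (hg.continuousOn_chartGram y)))

variable [CompactSpace M] [Nonempty M] [MeasurableSpace M] [BorelSpace M]

omit [IsManifold (𝓡 n) ∞ M] in
theorem lintegral_vol {g : TensorField n M} (hg : SmoothTensor univ fun _ => g)
    {f : M → ENNReal} (hf : Measurable f) :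
    ∫⁻ x, f x ∂(vol g) = ∑' k, ∫⁻ z in ((chartAt (𝔼 n) (chartCentre n M k)).target ∩
      (chartAt (𝔼 n) (chartCentre n M k)).symm ⁻¹' piece n M k),
      chartDensity g (chartCentre n M k) z *
        f ((chartAt (𝔼 n) (chartCentre n M k)).symm z) := by
  rw [vol, lintegral_sum_measure]
  refine tsum_congr fun k => ?_
  have hD := measurableSet_chart_preimage (n := n) (chartCentre n M k)
    (measurableSet_piece (n := n) (M := M) k)
  have h1 : AEMeasurable (chartAt (𝔼 n) (chartCentre n M k)).symm
      (volume.restrict ((chartAt (𝔼 n) (chartCentre n M k)).target ∩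
      (chartAt (𝔼 n) (chartCentre n M k)).symm ⁻¹' piece n M k)) :=
    ((chartAt (𝔼 n) (chartCentre n M k)).continuousOn_symm.mono
      inter_subset_left).aemeasurable hD
  have h2 : AEMeasurable (chartDensity g (chartCentre n M k))
      (volume.restrict ((chartAt (𝔼 n) (chartCentre n M k)).target ∩
      (chartAt (𝔼 n) (chartCentre n M k)).symm ⁻¹' piece n M k)) :=
    ((hg.continuousOn_density _).mono inter_subset_left).aemeasurable hD
  rw [lintegral_map' hf.aemeasurable (h1.mono_ac (withDensity_absolutelyContinuous _ _))]
  exact lintegral_withDensity_eq_lintegral_mul₀ h2 (hf.comp_aemeasurable h1)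

/-- Independence of the charts used to define `vol`: on each piece, the change of variables formula
for the transition map carries the density of the piece's chart to that of the chart at `y`; the
disjoint pieces are then summed. -/
theorem vol_apply_of_subset_source {g : TensorField n M} (hg : SmoothTensor univ fun _ => g)
    (y : M) {S : Set M} (hS : MeasurableSet S) (hSy : S ⊆ (chartAt (𝔼 n) y).source) :
    vol g S = ∫⁻ z in chartAt (𝔼 n) y '' S, chartDensity g y z := by
  have h1 : vol g S = ∫⁻ x, S.indicator 1 x ∂(vol g) := by
    rw [lintegral_indicator_one hS]
  rw [h1, lintegral_vol hg (measurable_one.indicator hS)]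
  have h2 : ∀ k, ∫⁻ z in ((chartAt (𝔼 n) (chartCentre n M k)).target ∩
      (chartAt (𝔼 n) (chartCentre n M k)).symm ⁻¹' piece n M k),
      chartDensity g (chartCentre n M k) z *
        S.indicator 1 ((chartAt (𝔼 n) (chartCentre n M k)).symm z) =
      ∫⁻ z in chartAt (𝔼 n) y '' (piece n M k ∩ S), chartDensity g y z := by
    intro k
    set e := chartAt (𝔼 n) (chartCentre n M k) with he
    have hpS := (measurableSet_piece (n := n) (M := M) k).inter hS
    have h3 : ∀ z, chartDensity g (chartCentre n M k) z * S.indicator 1 (e.symm z) =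
        (e.symm ⁻¹' S).indicator (chartDensity g (chartCentre n M k)) z := by
      intro z
      by_cases hz : e.symm z ∈ S <;> simp [hz]
    have h4 : piece n M k ⊆ e.source := disjointed_subset _ k
    simp only [h3]
    have h5 : ∫⁻ z in e.target ∩ e.symm ⁻¹' piece n M k,
        (e.symm ⁻¹' S).indicator (chartDensity g (chartCentre n M k)) z =
        ∫⁻ z in e.target ∩ e.symm ⁻¹' (piece n M k ∩ S),
          chartDensity g (chartCentre n M k) z := by
      rw [← lintegral_indicator (measurableSet_chart_preimage _ (measurableSet_piece k)),
        ← lintegral_indicator (measurableSet_chart_preimage _ hpS), indicator_indicator]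
      rw [preimage_inter, ← inter_assoc]
    rw [h5]
    -- Writing the image as an image under the transition map puts the integral in the form of the
    -- change of variables formula.
    have h6 : chartAt (𝔼 n) y '' (piece n M k ∩ S) =
        (fun u => chartAt (𝔼 n) y (e.symm u)) '' (e.target ∩ e.symm ⁻¹' (piece n M k ∩ S)) := by
      rw [← image_chart_eq _ (inter_subset_left.trans h4), image_image]
      refine image_congr fun x hx => ?_
      rw [e.left_inv (h4 hx.1)]
    rw [h6, lintegral_image_eq_lintegral_abs_det_fderiv_mul volume
      (measurableSet_chart_preimage _ hpS)
      (fun z hz => (chartDeriv_comp (chartCentre n M k) y hz.1 (hSy hz.2.2)).1.hasFDerivWithinAt)]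
    · refine setLIntegral_congr_fun (measurableSet_chart_preimage _ hpS) fun z hz => ?_
      exact chartDensity_transition g _ y hz.1 (hSy hz.2.2)
    · intro z hz z' hz' h
      have h7 := (chartAt (𝔼 n) y).injOn (hSy hz.2.2) (hSy hz'.2.2) h
      exact e.symm.injOn hz.1 hz'.1 h7
  simp only [h2]
  rw [← lintegral_iUnion]
  · rw [← image_iUnion, ← iUnion_inter, iUnion_piece, univ_inter]
  · intro k
    rw [image_chart_eq y (inter_subset_right.trans hSy)]
    exact measurableSet_chart_preimage _ ((measurableSet_piece k).inter hS)
  · intro j k hjk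
    have h8 : Disjoint (piece n M j) (piece n M k) := disjoint_disjointed _ hjk
    change Disjoint (chartAt (𝔼 n) y '' (piece n M j ∩ S)) (chartAt (𝔼 n) y '' (piece n M k ∩ S))
    rw [image_chart_eq y (inter_subset_right.trans hSy),
      image_chart_eq y (inter_subset_right.trans hSy)]
    exact (((h8.mono inter_subset_left inter_subset_left).preimage _).mono inter_subset_right
      inter_subset_right)

/-- The density is bounded on compact subsets of a chart, so the measure is locally finite;
compactness of `M` does the rest. -/
theorem isFiniteMeasure_vol [T2Space M] {g : TensorField n M} (hg : SmoothTensor univ fun _ => g) :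
    IsFiniteMeasure (vol g) := by
  have : IsLocallyFiniteMeasure (vol g) := by
    refine ⟨fun x => ?_⟩
    obtain ⟨K, hK, hxK, hKs⟩ := exists_compact_subset (chartAt (𝔼 n) x).open_source
      (mem_chart_source (𝔼 n) x)
    refine ⟨K, mem_interior_iff_mem_nhds.1 hxK, ?_⟩
    rw [vol_apply_of_subset_source hg x hK.measurableSet hKs]
    have hc : IsCompact (chartAt (𝔼 n) x '' K) :=
      hK.image_of_continuousOn ((chartAt (𝔼 n) x).continuousOn.mono hKs)
    have hs : chartAt (𝔼 n) x '' K ⊆ (chartAt (𝔼 n) x).target := by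
      rw [image_chart_eq x hKs]; exact inter_subset_left
    obtain ⟨C, hC⟩ := (hc.bddAbove_image (f := fun z => Real.sqrt (chartGram g x z).det)
      (Real.continuous_sqrt.comp_continuousOn (contDiff_matrix_det.continuous.comp_continuousOn
        ((hg.continuousOn_chartGram x).mono hs))))
    calc ∫⁻ z in chartAt (𝔼 n) x '' K, chartDensity g x z
        ≤ ∫⁻ z in chartAt (𝔼 n) x '' K, ENNReal.ofReal C := by
          refine setLIntegral_mono measurable_const fun z hz => ?_
          exact ENNReal.ofReal_le_ofReal (hC ⟨z, hz, rfl⟩)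
      _ < ⊤ := by
          rw [setLIntegral_const]
          exact ENNReal.mul_lt_top ENNReal.ofReal_lt_top hc.measure_lt_top
  infer_instance

/-- In a chart the density is strictly positive and nonempty open sets have positive Lebesgue
measure. This later upgrades vanishing almost everywhere of continuous functions to vanishing
everywhere. -/
theorem isOpenPosMeasure_vol {g : TensorField n M} (hg : SmoothTensor univ fun _ => g)
    (hdet : ∀ x, 0 < (gram g x).det) : (vol g).IsOpenPosMeasure := by
  refine ⟨fun U hU hne h0 => ?_⟩
  obtain ⟨x, hx⟩ := hne
  have hS : IsOpen (U ∩ (chartAt (𝔼 n) x).source) := hU.inter (chartAt (𝔼 n) x).open_source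
  have h1 : vol g (U ∩ (chartAt (𝔼 n) x).source) = 0 := measure_mono_null inter_subset_left h0
  rw [vol_apply_of_subset_source hg x hS.measurableSet inter_subset_right] at h1
  have hso : IsOpen (chartAt (𝔼 n) x '' (U ∩ (chartAt (𝔼 n) x).source)) :=
    (chartAt (𝔼 n) x).isOpen_image_of_subset_source hS inter_subset_right
  have hs : chartAt (𝔼 n) x '' (U ∩ (chartAt (𝔼 n) x).source) ⊆ (chartAt (𝔼 n) x).target := by
    rw [image_chart_eq x inter_subset_right]; exact inter_subset_left
  rw [lintegral_eq_zero_iff' (((hg.continuousOn_density x).mono hs).aemeasurable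
    hso.measurableSet), Filter.EventuallyEq, ae_restrict_iff' hso.measurableSet] at h1
  have h2 : volume (chartAt (𝔼 n) x '' (U ∩ (chartAt (𝔼 n) x).source)) = 0 := by
    refine measure_mono_null (fun z hz => ?_) (ae_iff.1 h1)
    simp only [mem_ofPred_eq, Classical.not_imp]
    refine ⟨hz, ?_⟩
    rw [chartDensity, Pi.zero_apply, ENNReal.ofReal_eq_zero, not_le, Real.sqrt_pos, det_chartGram]
    exact mul_pos (by have := det_frameChange_ne_zero (hs hz); positivity) (hdet _)
  exact (hso.measure_pos volume ⟨_, x, ⟨hx, mem_chart_source _ x⟩, rfl⟩).ne' h2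

omit [IsManifold (𝓡 n) ∞ M] in
-- Both measures are built from the same charts and pieces, so it suffices to compare densities
-- chart by chart, where the Jacobian factors cancel. Every volume in the sequel is transported to a
-- fixed reference metric in this way.
theorem vol_eq_withDensity {g g' : TensorField n M} (hg : SmoothTensor univ fun _ => g)
    (hg' : SmoothTensor univ fun _ => g') (hdet : ∀ x, 0 < (gram g x).det)
    (hm : Measurable fun x => (gram g' x).det / (gram g x).det) :
    vol g' = (vol g).withDensity
      (fun x => ENNReal.ofReal (Real.sqrt ((gram g' x).det / (gram g x).det))) := by
  have hm' : Measurable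
      (fun x => ENNReal.ofReal (Real.sqrt ((gram g' x).det / (gram g x).det))) := by fun_prop
  refine Measure.ext_of_lintegral _ fun f hf => ?_
  rw [lintegral_withDensity_eq_lintegral_mul _ hm' hf, lintegral_vol hg (hm'.mul hf),
    lintegral_vol hg' hf]
  refine tsum_congr fun k => ?_
  refine setLIntegral_congr_fun (measurableSet_chart_preimage _ (measurableSet_piece k))
    fun z hz => ?_
  simp only [Pi.mul_apply]
  rw [← mul_assoc]
  congr 1
  have hd := hdet ((chartAt (𝔼 n) (chartCentre n M k)).symm z)
  rw [chartDensity, chartDensity, ← ENNReal.ofReal_mul (Real.sqrt_nonneg _), det_chartGram,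
    det_chartGram, Real.sqrt_div' _ hd.le, Real.sqrt_mul (sq_nonneg _), Real.sqrt_mul (sq_nonneg _),
    mul_assoc, mul_div_cancel₀ _ (Real.sqrt_pos.2 hd).ne']

end
end GenCalabi

/-! ### Positive definiteness in terms of Gram matrices -/

open Set Filter Topology MeasureTheory
open scoped Manifold ContDiff
namespace GenCalabi

section PosDef
open scoped MatrixOrder Matrix.Norms.L2Operator

variable {n : ℕ}

local notation "Mat" => Matrix (Fin n) (Fin n) ℝ

theorem exists_isUnit_transpose_mul_self {G : Mat} (hG : G.PosDef) :
    ∃ S : Mat, IsUnit S ∧ G = S.transpose * S := by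
  obtain ⟨y, hy, h⟩ := CStarAlgebra.isStrictlyPositive_iff_eq_star_mul_self.mp
    hG.isStrictlyPositive
  exact ⟨y, hy, by rw [h, Matrix.star_eq_conjTranspose, Matrix.conjTranspose_eq_transpose_of_trivial]⟩

/-- With `G⁻¹ = Sᵀ S`, cyclicity turns `tr ((G⁻¹ R)²)` into the sum of squares of the entries of the
symmetric matrix `S R Sᵀ`. Nonnegativity and definiteness of the pairing follow. -/
theorem trace_sq_eq {G : Mat} (hG : G.PosDef) {R : Mat} (hR : R.transpose = R) :
    ∃ S : Mat, IsUnit S ∧ (S * R * S.transpose).transpose = S * R * S.transpose ∧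
      G⁻¹ = S.transpose * S ∧
      (G⁻¹ * R * (G⁻¹ * R)).trace =
        ((S * R * S.transpose).transpose * (S * R * S.transpose)).trace := by
  obtain ⟨S, hS, hGS⟩ := exists_isUnit_transpose_mul_self hG.inv
  have hX : (S * R * S.transpose).transpose = S * R * S.transpose := by
    simp only [Matrix.transpose_mul, Matrix.transpose_transpose, hR, mul_assoc]
  refine ⟨S, hS, hX, hGS, ?_⟩
  rw [hX, hGS, show S.transpose * S * R * (S.transpose * S * R) =
    S.transpose * (S * R * S.transpose * S * R) by noncomm_ring, Matrix.trace_mul_comm]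
  congr 1
  noncomm_ring

theorem trace_sq_nonneg {G : Mat} (hG : G.PosDef) {R : Mat} (hR : R.transpose = R) :
    0 ≤ (G⁻¹ * R * (G⁻¹ * R)).trace := by
  obtain ⟨S, -, -, -, h⟩ := trace_sq_eq hG hR
  rw [h, ← Matrix.conjTranspose_eq_transpose_of_trivial]
  exact (Matrix.posSemidef_conjTranspose_mul_self _).trace_nonneg

theorem eq_zero_of_trace_sq_eq_zero {G : Mat} (hG : G.PosDef) {R : Mat}
    (hR : R.transpose = R) (h0 : (G⁻¹ * R * (G⁻¹ * R)).trace = 0) : R = 0 := by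
  obtain ⟨S, hS, -, -, h⟩ := trace_sq_eq hG hR
  rw [h, ← Matrix.conjTranspose_eq_transpose_of_trivial,
    Matrix.trace_conjTranspose_mul_self_eq_zero_iff] at h0
  have hd : IsUnit S.det := (Matrix.isUnit_iff_isUnit_det S).1 hS
  have hd' : IsUnit S.transpose.det := by rwa [Matrix.det_transpose]
  calc R = S⁻¹ * (S * R * S.transpose) * S.transpose⁻¹ := by
        rw [Matrix.mul_assoc, Matrix.mul_nonsing_inv_cancel_right _ _ hd',
          Matrix.nonsing_inv_mul_cancel_left _ _ hd]
    _ = 0 := by rw [h0, mul_zero, zero_mul]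

end PosDef

section Gram
variable {n : ℕ} {M : Type*} [TopologicalSpace M] [ChartedSpace (EuclideanSpace ℝ (Fin n)) M]
local notation "𝔼" n => EuclideanSpace ℝ (Fin n)

theorem gram_transpose_iff {h : TensorField n M} {x : M} :
    (gram h x).transpose = gram h x ↔ ∀ v w : TangentSpace (𝓡 n) x, h x v w = h x w v := by
  constructor
  · intro hh v w
    refine (apply_eq_gram h x v w).trans (Eq.trans ?_ (apply_eq_gram h x w v).symm)
    rw [Finset.sum_comm]
    refine Finset.sum_congr rfl fun i _ => Finset.sum_congr rfl fun j _ => ?_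
    have := congrFun (congrFun hh i) j
    rw [Matrix.transpose_apply] at this
    rw [this]; ring
  · intro hh
    ext i j
    exact hh _ _

theorem gram_posDef_iff {h : TensorField n M} {x : M}
    (hs : (gram h x).transpose = gram h x) :
    (gram h x).PosDef ↔ ∀ v : TangentSpace (𝓡 n) x, v ≠ 0 → 0 < h x v v := by
  have key : ∀ v : 𝔼 n, h x v v = dotProduct (star v.ofLp) ((gram h x).mulVec v.ofLp) := by
    intro v
    rw [apply_eq_gram h x v v]
    simp only [dotProduct, Matrix.mulVec, star_trivial, Finset.mul_sum, mul_assoc]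
  constructor
  · intro hp v hv
    refine lt_of_lt_of_eq (hp.dotProduct_mulVec_pos (x := (v : 𝔼 n).ofLp) ?_) (key v).symm
    intro h0
    exact hv ((WithLp.ofLp_eq_zero 2).1 h0)
  · intro hp
    refine Matrix.PosDef.of_dotProduct_mulVec_pos
      (by rw [Matrix.IsHermitian, Matrix.conjTranspose_eq_transpose_of_trivial, hs]) fun v hv => ?_
    refine lt_of_lt_of_eq (hp (WithLp.toLp 2 v : 𝔼 n) ?_) (key (WithLp.toLp 2 v))
    intro h0
    exact hv ((WithLp.toLp_eq_zero 2).1 h0)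

variable [IsManifold (𝓡 n) ∞ M]

theorem isSmoothSym_iff_gram {h : TensorField n M} :
    IsSmoothSym h ↔ (∀ x, (gram h x).transpose = gram h x) ∧ SmoothTensor univ (fun _ => h) := by
  rw [isSmoothSym_iff]
  exact and_congr_left fun _ => forall_congr' fun x => gram_transpose_iff.symm

theorem isMetric_iff_gram {h : TensorField n M} :
    IsMetric h ↔ (∀ x, (gram h x).PosDef) ∧ SmoothTensor univ (fun _ => h) := by
  constructor
  · intro hh
    have h1 := isSmoothSym_iff_gram.1 hh.toIsSmoothSym
    exact ⟨fun x => (gram_posDef_iff (h1.1 x)).2 (hh.pos x), h1.2⟩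
  · intro hh
    have h1 : ∀ x, (gram h x).transpose = gram h x := fun x => by
      have := (hh.1 x).1
      rwa [Matrix.IsHermitian, Matrix.conjTranspose_eq_transpose_of_trivial] at this
    exact ⟨isSmoothSym_iff_gram.2 ⟨h1, hh.2⟩, fun x => (gram_posDef_iff (h1 x)).1 (hh.1 x)⟩

end Gram

/-! ### Integrals over `M` depending on time -/

section Integrals
open scoped Matrix.Norms.Operator

variable {n : ℕ}

local notation "𝔼" n => EuclideanSpace ℝ (Fin n)

/-- Tube lemma: continuity at every `(t, y)` becomes uniform in `y` by compactness of `M`. -/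
theorem eventually_forall_abs_sub_lt {M : Type*} [TopologicalSpace M] [CompactSpace M]
    {J : Set ℝ} {f : ℝ → M → ℝ}
    (hf : ContinuousOn (fun p : ℝ × M => f p.1 p.2) (J ×ˢ univ)) {t : ℝ} (ht : t ∈ J)
    {ε : ℝ} (hε : 0 < ε) : ∀ᶠ s in 𝓝[J] t, ∀ x, |f s x - f t x| < ε := by
  rw [eventually_nhdsWithin_iff]
  have h := (isCompact_univ (X := M)).eventually_forall_of_forall_eventually (x₀ := t)
    (P := fun s x => s ∈ J → |f s x - f t x| < ε) ?_
  · exact h.mono fun s hs hsJ x => hs x (mem_univ x) hsJ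
  intro y _
  have h1 : ∀ᶠ p in 𝓝[J ×ˢ univ] (t, y), |f p.1 p.2 - f t y| < ε / 2 := by
    have := Metric.continuousWithinAt_iff'.1 (hf (t, y) ⟨ht, mem_univ _⟩) (ε / 2) (half_pos hε)
    simpa only [Real.dist_eq] using this
  rw [eventually_nhdsWithin_iff] at h1
  have h2 : ContinuousAt (fun p : ℝ × M => (t, p.2)) (t, y) := by fun_prop
  have h3 := h2.eventually h1
  filter_upwards [h1, h3] with p hp hp3 hpJ
  have e1 := hp ⟨hpJ, mem_univ _⟩
  have e2 := hp3 ⟨ht, mem_univ _⟩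
  rw [abs_lt] at *
  constructor <;> linarith [e1.1, e1.2, e2.1, e2.2]

theorem continuousOn_integral_of_continuousOn {M : Type*} [TopologicalSpace M] [CompactSpace M]
    [MeasurableSpace M] [BorelSpace M] {J : Set ℝ} {f : ℝ → M → ℝ} (μ : Measure M)
    [IsFiniteMeasure μ]
    (hf : ContinuousOn (fun p : ℝ × M => f p.1 p.2) (J ×ˢ univ)) :
    ContinuousOn (fun t => ∫ x, f t x ∂μ) J := by
  intro t ht
  have hc : ∀ s ∈ J, Continuous (f s) := fun s hs =>
    continuousOn_univ.1 (hf.comp (f := fun x : M => (s, x)) (by fun_prop)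
      fun x _ => ⟨hs, mem_univ _⟩)
  have hi : ∀ s ∈ J, Integrable (f s) μ := fun s hs =>
    (hc s hs).integrable_of_hasCompactSupport (HasCompactSupport.of_compactSpace _)
  rw [ContinuousWithinAt, Metric.tendsto_nhds]
  intro ε hε
  set m := μ.real univ with hm
  have hm0 : 0 ≤ m := measureReal_nonneg
  have h1 := eventually_forall_abs_sub_lt hf ht (ε := ε / (m + 1)) (by positivity)
  filter_upwards [h1, self_mem_nhdsWithin] with s hs hsJ
  rw [Real.dist_eq, ← integral_sub (hi s hsJ) (hi t ht)]
  calc |∫ x, f s x - f t x ∂μ| ≤ ε / (m + 1) * m := by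
        rw [← Real.norm_eq_abs]
        exact norm_integral_le_of_norm_le_const (Eventually.of_forall fun x => (hs x).le)
    _ < ε := by
        rw [div_mul_eq_mul_div, div_lt_iff₀ (by positivity)]
        nlinarith

variable {M : Type*} [TopologicalSpace M] [ChartedSpace (𝔼 n) M] [IsManifold (𝓡 n) ∞ M]

theorem SmoothFun.continuousOn {J : Set ℝ} {f : ℝ → M → ℝ} (hf : SmoothFun (n := n) J f) :
    ContinuousOn (fun p : ℝ × M => f p.1 p.2) (J ×ˢ univ) :=
  (smoothFun_iff.1 hf).continuousOn

theorem SmoothFun.continuous {J : Set ℝ} {f : ℝ → M → ℝ} (hf : SmoothFun (n := n) J f)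
    {t : ℝ} (ht : t ∈ J) : Continuous (f t) :=
  continuousOn_univ.1 (hf.continuousOn.comp (f := fun x : M => (t, x)) (by fun_prop)
    fun x _ => ⟨ht, mem_univ _⟩)

omit [IsManifold (𝓡 n) ∞ M] in
theorem SmoothFun.hasDerivWithinAt {J : Set ℝ} {f : ℝ → M → ℝ}
    (hf : SmoothFun (n := n) J f) {t : ℝ} (ht : t ∈ J) (x : M) :
    HasDerivWithinAt (fun s => f s x) (derivWithin (fun s => f s x) J t) J t := by
  have h := hasDerivWithinAt_slice (hf x) (p := (t, chartAt (𝔼 n) x x))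
    ⟨ht, mem_chart_target (𝔼 n) x⟩
  simp only [(chartAt (𝔼 n) x).left_inv (mem_chart_source _ x)] at h
  exact h.differentiableWithinAt.hasDerivWithinAt

omit [IsManifold (𝓡 n) ∞ M] in
theorem SmoothFun.derivWithin {J : Set ℝ} (hJ : UniqueDiffOn ℝ J) {f : ℝ → M → ℝ}
    (hf : SmoothFun (n := n) J f) :
    SmoothFun (n := n) J (fun t x => derivWithin (fun s => f s x) J t) :=
  fun y => contDiffOn_derivWithin_slice hJ (chartAt (𝔼 n) y).open_target (hf y)

variable [CompactSpace M] [MeasurableSpace M] [BorelSpace M]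

theorem SmoothFun.integrable {J : Set ℝ} {f : ℝ → M → ℝ} (hf : SmoothFun (n := n) J f)
    (μ : Measure M) [IsFiniteMeasure μ] {t : ℝ} (ht : t ∈ J) : Integrable (f t) μ :=
  (hf.continuous ht).integrable_of_hasCompactSupport (HasCompactSupport.of_compactSpace _)

theorem SmoothFun.hasDerivAt_integral {J : Set ℝ} (hJ : UniqueDiffOn ℝ J) {f : ℝ → M → ℝ}
    (hf : SmoothFun (n := n) J f) (μ : Measure M) [IsFiniteMeasure μ] {t : ℝ} (ht : J ∈ 𝓝 t)
    {f' : M → ℝ} (hf' : ∀ x, HasDerivWithinAt (fun s => f s x) (f' x) J t) :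
    HasDerivAt (fun s => ∫ x, f s x ∂μ) (∫ x, f' x ∂μ) t := by
  have htJ : t ∈ J := mem_of_mem_nhds ht
  have hd := hf.derivWithin hJ
  have hf'' : f' = fun x => _root_.derivWithin (fun s => f s x) J t :=
    funext fun x => ((hf' x).derivWithin (hJ t htJ)).symm
  rw [hf'']
  obtain ⟨C, hC⟩ := (isCompact_range (hd.continuous htJ)).isBounded.exists_norm_le
  have h1 := eventually_forall_abs_sub_lt
    (f := fun s x => _root_.derivWithin (fun s => f s x) J s) hd.continuousOn htJ one_pos
  rw [nhdsWithin_eq_nhds.2 ht] at h1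
  obtain ⟨V, hV, hVo, htV⟩ := eventually_nhds_iff.1 (h1.and (eventually_mem_nhds_iff.2 ht))
  -- The dominating constant `C + 1` comes from a bound `C` for the derivative at time `t` and its
  -- uniform closeness to the derivatives at nearby times.
  refine (hasDerivAt_integral_of_dominated_loc_of_deriv_le (s := V) (hVo.mem_nhds htV)
    (F' := fun s x => _root_.derivWithin (fun s => f s x) J s) (bound := fun _ => C + 1)
    ?_ (hf.integrable μ htJ) (hd.integrable μ htJ).aestronglyMeasurable ?_
    (integrable_const _) ?_).2
  · filter_upwards [ht] with s hs using (hf.integrable μ hs).aestronglyMeasurable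
  · refine Eventually.of_forall fun x s hs => ?_
    have e1 := (hV s hs).1 x
    have e2 := hC _ ⟨x, rfl⟩
    rw [Real.norm_eq_abs] at *
    rw [abs_lt] at e1
    rw [abs_le] at *
    constructor <;> linarith [e1.1, e1.2, e2.1, e2.2]
  · refine Eventually.of_forall fun x s hs => ?_
    exact (hf.hasDerivWithinAt (mem_of_mem_nhds (hV s hs).2) x).hasDerivAt (hV s hs).2

theorem SmoothFun.continuousOn_integral {J : Set ℝ} {f : ℝ → M → ℝ}
    (hf : SmoothFun (n := n) J f) (μ : Measure M) [IsFiniteMeasure μ] :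
    ContinuousOn (fun s => ∫ x, f s x ∂μ) J :=
  continuousOn_integral_of_continuousOn μ hf.continuousOn

end Integrals
end GenCalabi

/-! ### The Levi-Civita connection and the strong geodesic equation -/

open Set Filter Topology MeasureTheory
open scoped Manifold ContDiff
namespace GenCalabi

section
open scoped Matrix.Norms.Operator

variable {n : ℕ}
local notation "Mat" => Matrix (Fin n) (Fin n) ℝ
local notation "𝔼" n => EuclideanSpace ℝ (Fin n)

/-- The matrix of the endomorphism `g⁻¹ h` at `x`. -/
noncomputable def endo {M : Type*} [TopologicalSpace M] [ChartedSpace (𝔼 n) M]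
    (g h : TensorField n M) (x : M) : Mat := (gram g x)⁻¹ * gram h x

/-- The quotient of the volume densities of `g'` and `g`. -/
noncomputable def volRatio {M : Type*} [TopologicalSpace M] [ChartedSpace (𝔼 n) M]
    (g g' : TensorField n M) (x : M) : ℝ := Real.sqrt ((gram g' x).det / (gram g x).det)

variable {M : Type*} [TopologicalSpace M] [ChartedSpace (𝔼 n) M]

theorem traceProd_eq_endo (g h k : TensorField n M) (x : M) :
    traceProd g h k x = (endo g h x * endo g k x).trace := rfl

theorem endo_self {g : TensorField n M} {x : M} (hg : (gram g x).det ≠ 0) : endo g g x = 1 :=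
  Matrix.nonsing_inv_mul _ (isUnit_iff_ne_zero.2 hg)

theorem traceProd_self_left {g : TensorField n M} {x : M} (hg : (gram g x).det ≠ 0)
    (h : TensorField n M) : traceProd g g h x = (endo g h x).trace := by
  rw [traceProd_eq_endo, endo_self hg, one_mul]

theorem volRatio_self {g : TensorField n M} {x : M} (hg : (gram g x).det ≠ 0) :
    volRatio g g x = 1 := by
  rw [volRatio, div_self hg, Real.sqrt_one]

theorem hasDerivWithinAt_volRatio {g : TensorField n M} {x : M} (hg : 0 < (gram g x).det)
    {c : ℝ → TensorField n M} {J : Set ℝ} {t : ℝ} {K : Mat}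
    (hc : HasDerivWithinAt (fun s => gram (c s) x) K J t) (hct : 0 < (gram (c t) x).det) :
    HasDerivWithinAt (fun s => volRatio g (c s) x)
      (1 / 2 * ((gram (c t) x)⁻¹ * K).trace * volRatio g (c t) x) J t := by
  have h1 := ((HasDerivWithinAt.matrix_det hc hct.ne').div_const (gram g x).det).sqrt
    (div_pos hct hg).ne'
  refine h1.congr_deriv ?_
  have h2 : 0 < Real.sqrt ((gram (c t) x).det / (gram g x).det) := Real.sqrt_pos.2 (div_pos hct hg)
  have h3 : Real.sqrt ((gram (c t) x).det / (gram g x).det) ^ 2 =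
    (gram (c t) x).det / (gram g x).det := Real.sq_sqrt (div_pos hct hg).le
  rw [volRatio, div_eq_iff (by positivity)]
  generalize hs : Real.sqrt ((gram (c t) x).det / (gram g x).det) = s at h2 h3 ⊢
  rw [mul_div_right_comm, ← h3]
  ring

theorem hasDerivWithinAt_traceProd {x : M}
    {c : ℝ → TensorField n M} {J : Set ℝ} {t : ℝ} {K : Mat}
    (hc : HasDerivWithinAt (fun s => gram (c s) x) K J t) (hct : (gram (c t) x).det ≠ 0)
    (h l : TensorField n M) :
    HasDerivWithinAt (fun s => traceProd (c s) h l x)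
      (-(((gram (c t) x)⁻¹ * K) * endo (c t) h x * endo (c t) l x).trace
        - (endo (c t) h x * ((gram (c t) x)⁻¹ * K) * endo (c t) l x).trace) J t := by
  have h1 := HasDerivWithinAt.matrix_inv hc hct
  have h2 := HasDerivWithinAt.matrix_trace
    ((h1.mul_const (gram h x)).mul (h1.mul_const (gram l x)))
  refine h2.congr_deriv ?_
  rw [← Matrix.trace_neg, ← Matrix.trace_sub]
  congr 1
  simp only [endo]
  noncomm_ring

variable [IsManifold (𝓡 n) ∞ M]

theorem IsMetric.posDef {g : TensorField n M} (hg : IsMetric g) (x : M) : (gram g x).PosDef :=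
  (isMetric_iff_gram.1 hg).1 x

theorem IsMetric.det_pos {g : TensorField n M} (hg : IsMetric g) (x : M) :
    0 < (gram g x).det := (hg.posDef x).det_pos

theorem IsMetric.smoothTensor {g : TensorField n M} (hg : IsMetric g) :
    SmoothTensor univ (fun _ => g) := (isMetric_iff_gram.1 hg).2

theorem IsSmoothSym.smoothTensor {g : TensorField n M} (hg : IsSmoothSym g) :
    SmoothTensor univ (fun _ => g) := (isSmoothSym_iff_gram.1 hg).2

theorem IsSmoothSym.gram_symm {g : TensorField n M} (hg : IsSmoothSym g) (x : M) :
    (gram g x).transpose = gram g x := (isSmoothSym_iff_gram.1 hg).1 x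

theorem SmoothTensor.volRatio {J : Set ℝ} {g : TensorField n M} (hg : IsMetric g)
    {c : ℝ → TensorField n M} (hc : SmoothTensor J c)
    (hdet : ∀ t ∈ J, ∀ x, 0 < (gram (c t) x).det) :
    SmoothFun (n := n) J (fun t x => volRatio g (c t) x) :=
  ((hg.smoothTensor.const_curve J).det_div hc fun _ _ x => (hg.det_pos x).ne').sqrt
    fun t ht x => div_pos (hdet t ht x) (hg.det_pos x)

variable [CompactSpace M] [Nonempty M] [MeasurableSpace M] [BorelSpace M]

theorem integral_vol {g g' : TensorField n M} (hg : IsMetric g)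
    (hg' : SmoothTensor univ fun _ => g') (f : M → ℝ) :
    ∫ x, f x ∂(vol g') = ∫ x, f x * volRatio g g' x ∂(vol g) := by
  have hc : Continuous (fun x => (gram g' x).det / (gram g x).det) :=
    (hg.smoothTensor.det_div hg' fun _ _ x => (hg.det_pos x).ne').continuous (mem_univ (0 : ℝ))
  have hm : Measurable fun x => ENNReal.ofReal √((gram g' x).det / (gram g x).det) :=
    ENNReal.measurable_ofReal.comp (Real.continuous_sqrt.measurable.comp hc.measurable)
  rw [vol_eq_withDensity hg.smoothTensor hg' hg.det_pos hc.measurable,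
    integral_withDensity_eq_integral_toReal_smul hm
      (Eventually.of_forall fun x => ENNReal.ofReal_lt_top)]
  refine integral_congr_ae (Eventually.of_forall fun x => ?_)
  simp only [volRatio, smul_eq_mul]
  rw [ENNReal.toReal_ofReal (Real.sqrt_nonneg _), mul_comm]

theorem totalVol_eq_integral {g g' : TensorField n M} (hg : IsMetric g)
    (hg' : SmoothTensor univ fun _ => g') :
    totalVol g' = ∫ x, volRatio g g' x ∂(vol g) := by
  have h := integral_vol hg hg' (fun _ => 1)
  simp only [one_mul] at h
  rw [← h, totalVol]
  simp

variable [T2Space M]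

theorem IsMetric.isFiniteMeasure {g : TensorField n M} (hg : IsMetric g) :
    IsFiniteMeasure (vol g) := isFiniteMeasure_vol hg.smoothTensor

theorem IsMetric.totalVol_pos {g : TensorField n M} (hg : IsMetric g) : 0 < totalVol g := by
  have := hg.isFiniteMeasure
  have := isOpenPosMeasure_vol hg.smoothTensor hg.det_pos
  exact ENNReal.toReal_pos (isOpen_univ.measure_pos (vol g) univ_nonempty).ne' (measure_ne_top _ _)

omit [Nonempty M] [MeasurableSpace M] [BorelSpace M] [T2Space M] in
-- By compactness the ratio of determinants is uniformly near `1` for small `s`. Positivity of the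
-- determinant is all that differentiating the volume and the inverse requires.
theorem exists_det_pos_nhds {g : TensorField n M} (hg : IsMetric g) {c : ℝ → TensorField n M}
    (hc : SmoothTensor univ c) (h0 : c 0 = g) :
    ∃ U : Set ℝ, IsOpen U ∧ (0 : ℝ) ∈ U ∧ ∀ s ∈ U, ∀ x, 0 < (gram (c s) x).det := by
  have h1 := (hg.smoothTensor.const_curve univ).det_div hc fun _ _ x => (hg.det_pos x).ne'
  have h2 := eventually_forall_abs_sub_lt
    (f := fun t x => (gram (c t) x).det / (gram g x).det) h1.continuousOn (mem_univ 0) one_pos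
  rw [nhdsWithin_univ] at h2
  obtain ⟨U, hU, hUo, h0U⟩ := eventually_nhds_iff.1 h2
  refine ⟨U, hUo, h0U, fun s hs x => ?_⟩
  have h3 := hU s hs x
  simp only [h0, div_self (hg.det_pos x).ne'] at h3
  rw [abs_lt] at h3
  have h4 : 0 < (gram (c s) x).det / (gram g x).det := by linarith [h3.1]
  exact (div_pos_iff_of_pos_right (hg.det_pos x)).1 h4

/-- The derivative of the generalized Calabi metric in terms of integrals. -/
theorem gNDeriv_eq {g k h l : TensorField n M} (hg : IsMetric g) (hk : IsSmoothSym k)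
    (hh : IsSmoothSym h) (hl : IsSmoothSym l) :
    gNDeriv g k h l = ((∫ x, (1 / 2 * (endo g k x).trace * traceProd g h l x
        - (endo g k x * endo g h x * endo g l x).trace
        - (endo g h x * endo g k x * endo g l x).trace) ∂(vol g)) / totalVol g)
      - gN g h l * (1 / 2 * gN g g k) := by
  have := hg.isFiniteMeasure
  set c : ℝ → TensorField n M := fun s => g + s • k with hcdef
  have hc : SmoothTensor univ c := by
    have h1 : SmoothTensor univ (fun (s : ℝ) (x : M) => s • k x) :=
      SmoothTensor.smul (SmoothFun.time contDiffOn_id) hk.smoothTensor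
    exact hg.smoothTensor.add h1
  have hc0 : c 0 = g := by
    refine funext fun x => tensorField_ext ?_
    rw [hcdef, gram_add, gram_smul, zero_smul, add_zero]
  obtain ⟨U, hUo, h0U, hdet⟩ := exists_det_pos_nhds hg hc hc0
  have hcU := hc.mono (subset_univ U)
  have hUn : U ∈ 𝓝 (0 : ℝ) := hUo.mem_nhds h0U
  have hgr : ∀ x, HasDerivWithinAt (fun s => gram (c s) x) (gram k x) U 0 := by
    intro x
    have h1 := (((hasDerivAt_id (0 : ℝ)).smul_const (gram k x)).const_add
      (gram g x)).hasDerivWithinAt (s := U)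
    rw [one_smul] at h1
    refine h1.congr (fun s _ => ?_) ?_
    · rw [hcdef, gram_add, gram_smul]; rfl
    · rw [hcdef, gram_add, gram_smul]; rfl
  have hv := hcU.volRatio hg hdet
  have htp := hcU.traceProd (hh.smoothTensor.const_curve U) (hl.smoothTensor.const_curve U)
    fun s hs x => (hdet s hs x).ne'
  have hv' : ∀ x, HasDerivWithinAt (fun s => volRatio g (c s) x)
      (1 / 2 * (endo g k x).trace) U 0 := by
    intro x
    have h1 := hasDerivWithinAt_volRatio (hg.det_pos x) (hgr x) (hdet 0 h0U x)
    simpa only [hc0, volRatio_self (hg.det_pos x).ne', mul_one] using! h1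
  have htp' : ∀ x, HasDerivWithinAt (fun s => traceProd (c s) h l x * volRatio g (c s) x)
      (1 / 2 * (endo g k x).trace * traceProd g h l x
        - (endo g k x * endo g h x * endo g l x).trace
        - (endo g h x * endo g k x * endo g l x).trace) U 0 := by
    intro x
    have h1 := (hasDerivWithinAt_traceProd (hgr x) (hdet 0 h0U x).ne' h l).mul (hv' x)
    simp only [hc0, volRatio_self (hg.det_pos x).ne'] at h1
    refine h1.congr_deriv ?_
    rw [show (gram g x)⁻¹ * gram k x = endo g k x from rfl]
    ring
  have hE := (htp.mul hv).hasDerivAt_integral hUo.uniqueDiffOn (vol g) hUn htp'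
  have hV := hv.hasDerivAt_integral hUo.uniqueDiffOn (vol g) hUn hv'
  have hgN : ∀ s ∈ U, gN (c s) h l = (∫ x, traceProd (c s) h l x * volRatio g (c s) x ∂(vol g)) /
      ∫ x, volRatio g (c s) x ∂(vol g) := by
    intro s hs
    have hs1 := hc.slice (mem_univ s)
    rw [gN, ebin, integral_vol hg hs1, totalVol_eq_integral hg hs1]
  have hV0 : ∫ x, volRatio g (c 0) x ∂(vol g) = totalVol g := by
    rw [hc0, totalVol_eq_integral hg hg.smoothTensor]
  have hE0 : ∫ x, traceProd (c 0) h l x * volRatio g (c 0) x ∂(vol g) = ebin g h l := by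
    rw [hc0, ebin, ← integral_vol hg hg.smoothTensor]
  have hVpos := hg.totalVol_pos
  -- Quotient rule for `g_N = ebin / totalVol`. Since the volume has derivative `½ ∫ tr (g⁻¹ k)`,
  -- the denominator contributes the term `-½ g_N(h, l) g_N(g, k)`.
  have hD := hE.div hV (by rw [hV0]; exact hVpos.ne')
  have hD' : HasDerivAt (fun s => gN (c s) h l) _ 0 :=
    hD.congr_of_eventuallyEq (by filter_upwards [hUn] with s hs using hgN s hs)
  rw [gNDeriv, hD'.deriv, hV0, hE0]
  have htr : gN g g k = (∫ x, (endo g k x).trace ∂(vol g)) / totalVol g := by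
    rw [gN, ebin]
    congr 1
    exact integral_congr_ae (Eventually.of_forall fun x =>
      traceProd_self_left (hg.det_pos x).ne' k)
  rw [htr, gN, integral_const_mul]
  field_simp

/-- The tensor field whose vanishing is the geodesic equation. -/
noncomputable def geodesicDefect (g k N : TensorField n M) : TensorField n M := fun x =>
  N x + (-1 : ℝ) • (ofGram fun x => gram k x * ((gram g x)⁻¹ * gram k x)) x
    + (1 / 2 * traceProd g g k x - 1 / 2 * gN g g k) • k x
    + (1 / 4 * gN g k k - 1 / 4 * traceProd g k k x) • g x

omit [IsManifold (𝓡 n) ∞ M] [BorelSpace M] [T2Space M] in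
theorem gram_geodesicDefect (g k N : TensorField n M) (x : M) :
    gram (geodesicDefect g k N) x = gram N x - gram k x * endo g k x
      + (1 / 2 * traceProd g g k x - 1 / 2 * gN g g k) • gram k x
      + (1 / 4 * gN g k k - 1 / 4 * traceProd g k k x) • gram g x := by
  have h1 : gram (geodesicDefect g k N) x = gram N x + (-1 : ℝ) • gram (ofGram fun x =>
      gram k x * ((gram g x)⁻¹ * gram k x)) x
      + (1 / 2 * traceProd g g k x - 1 / 2 * gN g g k) • gram k x
      + (1 / 4 * gN g k k - 1 / 4 * traceProd g k k x) • gram g x := by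
    ext i j; rfl
  rw [h1, gram_ofGram, endo]
  module

omit [BorelSpace M] [T2Space M] in
-- Smoothness and symmetry make the defect itself an admissible test field.
theorem isSmoothSym_geodesicDefect {g k N : TensorField n M} (hg : IsMetric g)
    (hk : IsSmoothSym k) (hN : IsSmoothSym N) : IsSmoothSym (geodesicDefect g k N) := by
  have hd : ∀ x, (gram g x).det ≠ 0 := fun x => (hg.det_pos x).ne'
  refine isSmoothSym_iff_gram.2 ⟨fun x => ?_, ?_⟩
  · rw [gram_geodesicDefect]
    simp only [Matrix.transpose_add, Matrix.transpose_sub, Matrix.transpose_smul,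
      Matrix.transpose_mul, endo, Matrix.transpose_nonsing_inv, hk.gram_symm, hN.gram_symm,
      hg.toIsSmoothSym.gram_symm, mul_assoc]
  · have h1 := hg.smoothTensor.sandwich hk.smoothTensor hk.smoothTensor fun _ _ => hd
    have h2 := hg.smoothTensor.traceProd hg.smoothTensor hk.smoothTensor fun _ _ => hd
    have h3 := hg.smoothTensor.traceProd hk.smoothTensor hk.smoothTensor fun _ _ => hd
    exact ((hN.smoothTensor.add (SmoothTensor.smul (SmoothFun.const (-1)) h1)).add
      (SmoothTensor.smul (((SmoothFun.const (1 / 2)).mul h2).sub (SmoothFun.const _))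
        hk.smoothTensor)).add (SmoothTensor.smul ((SmoothFun.const _).sub
          ((SmoothFun.const (1 / 4)).mul h3)) hg.smoothTensor)

/-- By cyclicity of the trace every cubic term equals the pairing of `k g⁻¹ k` with `l`, and `tr
(g⁻¹ l)` is the pairing of `g` with `l`. So `l` enters all terms through the same pairing and can be
split off, leaving the defect. -/
theorem gN_add_koszul {g k N l : TensorField n M} (hg : IsMetric g)
    (hk : IsSmoothSym k) (hN : IsSmoothSym N) (hl : IsSmoothSym l) :
    gN g N l + koszul g k k l = gN g (geodesicDefect g k N) l := by
  have := hg.isFiniteMeasure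
  have hd : ∀ x, (gram g x).det ≠ 0 := fun x => (hg.det_pos x).ne'
  have hV := hg.totalVol_pos
  have hs := hg.smoothTensor.sandwich hk.smoothTensor hk.smoothTensor fun _ _ => hd
  have hNl := (hg.smoothTensor.traceProd hN.smoothTensor hl.smoothTensor fun _ _ => hd)
  have hkkl := (hg.smoothTensor.traceProd hs hl.smoothTensor fun _ _ => hd)
  have hgk := (hg.smoothTensor.traceProd hg.smoothTensor hk.smoothTensor fun _ _ => hd)
  have hgl := (hg.smoothTensor.traceProd hg.smoothTensor hl.smoothTensor fun _ _ => hd)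
  have hkl := (hg.smoothTensor.traceProd hk.smoothTensor hl.smoothTensor fun _ _ => hd)
  have hkk := (hg.smoothTensor.traceProd hk.smoothTensor hk.smoothTensor fun _ _ => hd)
  set S : TensorField n M := ofGram fun x => gram k x * ((gram g x)⁻¹ * gram k x) with hS
  have eS : ∀ m x, traceProd g S m x = (endo g k x * endo g k x * endo g m x).trace := by
    intro m x
    rw [traceProd_eq_endo, endo, hS, gram_ofGram]
    simp only [endo, mul_assoc]
  have e1 : ∀ x, (endo g k x * endo g l x * endo g k x).trace = traceProd g S l x := by
    intro x
    rw [eS, Matrix.trace_mul_comm, ← mul_assoc]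
  have e2 : ∀ x, (endo g l x * endo g k x * endo g k x).trace = traceProd g S l x := by
    intro x
    rw [eS, mul_assoc, Matrix.trace_mul_comm]
  have e3 : ∀ m x, (endo g m x).trace = traceProd g g m x := fun m x =>
    (traceProd_self_left (hd x) m).symm
  rw [koszul, gNDeriv_eq hg hk hk hl, gNDeriv_eq hg hl hk hk]
  simp only [e1, e2, ← eS, e3]
  have i1 : Integrable (fun x => 1 / 2 * traceProd g g k x * traceProd g k l x) (vol g) :=
    (((SmoothFun.const (n := n) (M := M) (J := univ) (1 / 2)).mul hgk).mul hkl).integrable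
    (vol g) (mem_univ 0)
  have i2 : Integrable (fun x => 1 / 2 * traceProd g g l x * traceProd g k k x) (vol g) :=
    (((SmoothFun.const (n := n) (M := M) (J := univ) (1 / 2)).mul hgl).mul hkk).integrable
    (vol g) (mem_univ 0)
  have i3 : Integrable (fun x => traceProd g S l x) (vol g) := hkkl.integrable (vol g) (mem_univ 0)
  have i4 : Integrable (fun x => traceProd g N l x) (vol g) := hNl.integrable (vol g) (mem_univ 0)
  have i5 : Integrable (fun x => traceProd g g l x) (vol g) := hgl.integrable (vol g) (mem_univ 0)
  have i6 : Integrable (fun x => traceProd g k l x) (vol g) := hkl.integrable (vol g) (mem_univ 0)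
  have e4 : ∀ x, traceProd g (geodesicDefect g k N) l x = traceProd g N l x - traceProd g S l x
      + 1 / 2 * traceProd g g k x * traceProd g k l x - 1 / 2 * gN g g k * traceProd g k l x
      + 1 / 4 * gN g k k * traceProd g g l x
      - 1 / 2 * (1 / 2 * traceProd g g l x * traceProd g k k x) := by
    intro x
    rw [traceProd_eq_endo g (geodesicDefect g k N), endo, gram_geodesicDefect, eS,
      traceProd_self_left (hd x) l, traceProd_eq_endo g N l, traceProd_eq_endo g k l]
    have h5 : (gram g x)⁻¹ * gram g x = 1 := endo_self (hd x)
    simp only [mul_add, mul_sub, add_mul, sub_mul, Matrix.trace_add, Matrix.trace_sub,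
      Matrix.mul_smul, Matrix.smul_mul, Matrix.trace_smul, h5, one_mul, smul_eq_mul]
    rw [← mul_assoc]
    simp only [endo]
    ring
  have e5 : ebin g (geodesicDefect g k N) l = ebin g N l - ebin g S l
      + (∫ x, 1 / 2 * traceProd g g k x * traceProd g k l x ∂(vol g))
      - 1 / 2 * gN g g k * ebin g k l + 1 / 4 * gN g k k * ebin g g l
      - 1 / 2 * (∫ x, 1 / 2 * traceProd g g l x * traceProd g k k x ∂(vol g)) := by
    have j2 : Integrable (fun x => traceProd g N l x - traceProd g S l x) (vol g) := i4.sub i3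
    have j3 : Integrable (fun x => traceProd g N l x - traceProd g S l x
      + 1 / 2 * traceProd g g k x * traceProd g k l x) (vol g) := j2.add i1
    have j4 : Integrable (fun x => traceProd g N l x - traceProd g S l x
      + 1 / 2 * traceProd g g k x * traceProd g k l x
      - 1 / 2 * gN g g k * traceProd g k l x) (vol g) := j3.sub (i6.const_mul _)
    have j5 : Integrable (fun x => traceProd g N l x - traceProd g S l x
      + 1 / 2 * traceProd g g k x * traceProd g k l x
      - 1 / 2 * gN g g k * traceProd g k l x
      + 1 / 4 * gN g k k * traceProd g g l x) (vol g) := j4.add (i5.const_mul _)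
    simp only [ebin, e4]
    rw [integral_sub j5 (i2.const_mul _), integral_add j4 (i5.const_mul _),
      integral_sub j3 (i6.const_mul _), integral_add j2 i1, integral_sub i4 i3,
      integral_const_mul, integral_const_mul, integral_const_mul]
  have i7 : ∫ x, (1 / 2 * traceProd g g k x * traceProd g k l x - traceProd g S l x
      - traceProd g S l x) ∂(vol g) =
      (∫ x, 1 / 2 * traceProd g g k x * traceProd g k l x ∂(vol g)) - ebin g S l - ebin g S l := by
    have j : Integrable (fun x => 1 / 2 * traceProd g g k x * traceProd g k l x - traceProd g S l x)
      (vol g) := i1.sub i3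
    rw [integral_sub j i3, integral_sub i1 i3]; rfl
  have i8 : ∫ x, (1 / 2 * traceProd g g l x * traceProd g k k x - traceProd g S l x
      - traceProd g S l x) ∂(vol g) =
      (∫ x, 1 / 2 * traceProd g g l x * traceProd g k k x ∂(vol g)) - ebin g S l - ebin g S l := by
    have j : Integrable (fun x => 1 / 2 * traceProd g g l x * traceProd g k k x - traceProd g S l x)
      (vol g) := i2.sub i3
    rw [integral_sub j i3, integral_sub i2 i3]; rfl
  rw [i7, i8]
  have f1 : ∀ h m, gN g h m = ebin g h m / totalVol g := fun _ _ => rfl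
  rw [f1 (geodesicDefect g k N) l, e5, f1 N l, f1 k l, f1 g l]
  generalize gN g g k = τ
  generalize gN g k k = ε
  field_simp
  ring

/-- The geodesic equation for `g_N`, in strong form. -/
theorem geodesic_equation_iff {g k N : TensorField n M} (hg : IsMetric g)
    (hk : IsSmoothSym k) (hN : IsSmoothSym N) :
    (∀ l : TensorField n M, IsSmoothSym l → gN g N l + koszul g k k l = 0) ↔
      ∀ x, gram N x = gram k x * endo g k x
        - (1 / 2 * traceProd g g k x - 1 / 2 * gN g g k) • gram k x
        + (1 / 4 * traceProd g k k x - 1 / 4 * gN g k k) • gram g x := by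
  have := hg.isFiniteMeasure
  have := isOpenPosMeasure_vol hg.smoothTensor hg.det_pos
  have hE := isSmoothSym_geodesicDefect hg hk hN
  have hkey : (∀ x, gram (geodesicDefect g k N) x = 0) ↔
      ∀ x, gram N x = gram k x * endo g k x
        - (1 / 2 * traceProd g g k x - 1 / 2 * gN g g k) • gram k x
        + (1 / 4 * traceProd g k k x - 1 / 4 * gN g k k) • gram g x := by
    refine forall_congr' fun x => ?_
    rw [gram_geodesicDefect, ← sub_eq_zero (a := gram N x)]
    refine Eq.congr ?_ rfl
    module
  rw [← hkey]
  constructor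
  · intro h
    -- Testing the defect against itself gives a vanishing integral of a continuous nonnegative
    -- function, hence a pointwise zero.
    have h1 := h _ hE
    rw [gN_add_koszul hg hk hN hE, gN, div_eq_zero_iff, or_iff_left hg.totalVol_pos.ne', ebin] at h1
    have hsm := (hg.smoothTensor.traceProd hE.smoothTensor hE.smoothTensor
      fun _ _ x => (hg.det_pos x).ne')
    have hnn : ∀ x, 0 ≤ traceProd g (geodesicDefect g k N) (geodesicDefect g k N) x := fun x =>
      trace_sq_nonneg (hg.posDef x) (hE.gram_symm x)
    rw [integral_eq_zero_iff_of_nonneg hnn (hsm.integrable (vol g) (mem_univ 0)),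
      Continuous.ae_eq_iff_eq (vol g) (hsm.continuous (mem_univ 0)) continuous_zero] at h1
    exact fun x => eq_zero_of_trace_sq_eq_zero (hg.posDef x) (hE.gram_symm x) (congrFun h1 x)
  · intro h l hl
    rw [gN_add_koszul hg hk hN hl, gN, ebin]
    have : ∀ x, traceProd g (geodesicDefect g k N) l x = 0 := fun x => by
      rw [traceProd, h x]; simp
    simp [this]

end
end GenCalabi

/-! ### The geodesic equation at a point: conserved quantities and uniqueness -/

open Set Filter Topology MeasureTheory
open scoped Manifold ContDiff
namespace GenCalabi

section
open scoped Matrix.Norms.Operator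

variable {n : ℕ}
local notation "Mat" => Matrix (Fin n) (Fin n) ℝ
local notation "𝔼" n => EuclideanSpace ℝ (Fin n)

theorem eq_of_hasDerivWithinAt_zero {E : Type*} [NormedAddCommGroup E] [NormedSpace ℝ E]
    {J : Set ℝ} (hJ : Convex ℝ J) {f : ℝ → E} (hf : ∀ t ∈ J, HasDerivWithinAt f 0 J t)
    {s t : ℝ} (hs : s ∈ J) (ht : t ∈ J) : f t = f s := by
  have h := hJ.norm_image_sub_le_of_norm_hasDerivWithin_le (f' := fun _ => 0) (C := 0)
    hf (fun _ _ => by simp) hs ht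
  rw [zero_mul] at h
  exact sub_eq_zero.1 (norm_le_zero_iff.1 h)

/-- Integrals over `M` are differentiated only at interior times; continuity extends constancy to
the endpoints of `J`. -/
theorem eq_of_hasDerivAt_zero_interior {J : Set ℝ} (hJ : Convex ℝ J) {f : ℝ → ℝ}
    (hc : ContinuousOn f J) (hf : ∀ t ∈ interior J, HasDerivAt f 0 t)
    {s t : ℝ} (hs : s ∈ J) (ht : t ∈ J) : f t = f s := by
  have hd : DifferentiableOn ℝ f (interior J) := fun t ht =>
    (hf t ht).differentiableAt.differentiableWithinAt
  have h1 := monotoneOn_of_deriv_nonneg hJ hc hd fun t ht => (hf t ht).deriv.ge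
  have h2 := antitoneOn_of_deriv_nonpos hJ hc hd fun t ht => (hf t ht).deriv.le
  rcases le_total s t with h | h
  · exact le_antisymm (h2 hs ht h) (h1 hs ht h)
  · exact le_antisymm (h1 ht hs h) (h2 ht hs h)

/-- Two solutions of `u'' + b² u = κ` with the same initial data agree. -/
theorem harmonic_unique {J : Set ℝ} (hJ : Convex ℝ J) (h0 : (0 : ℝ) ∈ J) {b κ : ℝ}
    {u v du dv : ℝ → ℝ} (hu : ∀ t ∈ J, HasDerivWithinAt u (du t) J t)
    (hdu : ∀ t ∈ J, HasDerivWithinAt du (κ - b ^ 2 * u t) J t)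
    (hv : ∀ t ∈ J, HasDerivWithinAt v (dv t) J t)
    (hdv : ∀ t ∈ J, HasDerivWithinAt dv (κ - b ^ 2 * v t) J t)
    (huv : u 0 = v 0) (hduv : du 0 = dv 0) {t : ℝ} (ht : t ∈ J) : u t = v t ∧ du t = dv t := by
  have hd : ∀ t ∈ J, du t = dv t := by
    intro t ht
    -- The energy of the difference is conserved and initially zero. Since `b = 0` is allowed, it
    -- controls only the difference of the derivatives; the functions themselves are compared
    -- afterwards.
    have h1 : ∀ t ∈ J, HasDerivWithinAt
        (fun t => (du t - dv t) ^ 2 + b ^ 2 * (u t - v t) ^ 2) 0 J t := by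
      intro t ht
      refine ((((hdu t ht).sub (hdv t ht)).pow 2).add
        ((((hu t ht).sub (hv t ht)).pow 2).const_mul (b ^ 2))).congr_deriv ?_
      simp only [Pi.sub_apply]
      push_cast
      ring
    have h2 := eq_of_hasDerivWithinAt_zero hJ h1 h0 ht
    simp only [huv, hduv, sub_self] at h2
    have h3 : 0 ≤ b ^ 2 * (u t - v t) ^ 2 := by positivity
    have h4 : (du t - dv t) ^ 2 = 0 := le_antisymm (by nlinarith) (sq_nonneg _)
    exact sub_eq_zero.1 (pow_eq_zero_iff two_ne_zero |>.1 h4)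
  refine ⟨?_, hd t ht⟩
  have h1 : ∀ t ∈ J, HasDerivWithinAt (fun t => u t - v t) 0 J t := fun t ht =>
    ((hu t ht).sub (hv t ht)).congr_deriv (by rw [hd t ht, sub_self])
  have h2 := eq_of_hasDerivWithinAt_zero hJ h1 h0 ht
  simp only [huv, sub_self] at h2
  exact sub_eq_zero.1 h2

/-- The volume factor of a solution of the geodesic equation satisfies a linear equation. -/
theorem volume_ode {J : Set ℝ} (hJ : Convex ℝ J) (h0 : (0 : ℝ) ∈ J) {ν τ ε b q r : ℝ}
    (hb : 4 * b ^ 2 = ν * ε - τ ^ 2) {ρ S T : ℝ → ℝ} (hpos : ∀ t ∈ J, 0 < ρ t)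
    (hρ : ∀ t ∈ J, HasDerivWithinAt ρ (1 / 2 * (S t - τ) * ρ t) J t)
    (hS : ∀ t ∈ J, HasDerivWithinAt S
      (-(1 / 2) * (S t - τ) * S t + ν / 4 * (T t - ε)) J t)
    (hT : ∀ t ∈ J, HasDerivWithinAt T
      (-(S t - τ) * T t + 1 / 2 * (T t - ε) * S t) J t)
    (hρ0 : ρ 0 = 1) (hq : 2 * q = S 0 - τ) (hr : 4 * r ^ 2 = ν * T 0 - S 0 ^ 2)
    {p dp : ℝ → ℝ} (hp : ∀ t ∈ J, HasDerivWithinAt p (dp t) J t)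
    (hdp : ∀ t ∈ J, HasDerivWithinAt dp ((q ^ 2 + b ^ 2 + r ^ 2) / 2 - b ^ 2 * p t) J t)
    (hp0 : p 0 = 1) (hdp0 : dp 0 = q) {t : ℝ} (ht : t ∈ J) :
    ρ t = p t ∧ 1 / 2 * (S t - τ) * ρ t = dp t := by
  -- Up to a factor `ν`, `ν T - S²` is the squared length of the traceless part of `H`, and this
  -- part scales like `1 / ρ`.
  have hR : ∀ t ∈ J, ρ t ^ 2 * (ν * T t - S t ^ 2) = 4 * r ^ 2 := by
    intro t ht
    have h1 : ∀ t ∈ J, HasDerivWithinAt (fun t => ρ t ^ 2 * (ν * T t - S t ^ 2)) 0 J t := by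
      intro t ht
      refine (((hρ t ht).pow 2).mul (((hT t ht).const_mul ν).sub ((hS t ht).pow 2))).congr_deriv ?_
      simp only [Pi.sub_apply, Pi.pow_apply]
      push_cast
      ring
    have h2 := eq_of_hasDerivWithinAt_zero hJ h1 h0 ht
    simp only [hρ0] at h2
    rw [h2, hr]; ring
  -- `w` is the derivative of `ρ`. The relations for `b²` and `r²` eliminate `ε` and `T`, giving an
  -- equation in `ρ` and `w` alone.
  set w : ℝ → ℝ := fun t => 1 / 2 * (S t - τ) * ρ t with hw
  have hw0 : w 0 = q := by rw [hw]; simp only [hρ0, ← hq]; ring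
  have hdw : ∀ t ∈ J, HasDerivWithinAt w
      ((w t ^ 2 + b ^ 2 * ρ t ^ 2 + r ^ 2) / (2 * ρ t) - b ^ 2 * ρ t) J t := by
    intro t ht
    have hp := (hpos t ht).ne'
    refine ((((hS t ht).sub_const τ).const_mul (1 / 2)).mul (hρ t ht)).congr_deriv ?_
    have h1 : r ^ 2 = ρ t ^ 2 * (ν * T t - S t ^ 2) / 4 := by rw [hR t ht]; ring
    have h2 : b ^ 2 = (ν * ε - τ ^ 2) / 4 := by rw [← hb]; ring
    rw [h1, h2, hw]
    field_simp
    ring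
  -- This quotient is a first integral. Replacing it by its initial value makes the second-order
  -- equation for `ρ` linear.
  have hK : ∀ t ∈ J, (w t ^ 2 + b ^ 2 * ρ t ^ 2 + r ^ 2) / (2 * ρ t) =
      (q ^ 2 + b ^ 2 + r ^ 2) / 2 := by
    intro t ht
    have h1 : ∀ t ∈ J, HasDerivWithinAt
        (fun t => (w t ^ 2 + b ^ 2 * ρ t ^ 2 + r ^ 2) / (2 * ρ t)) 0 J t := by
      intro t ht
      have hp := (hpos t ht).ne'
      have hρw : HasDerivWithinAt ρ (w t) J t := hρ t ht
      refine (((((hdw t ht).pow 2).add ((hρw.pow 2).const_mul (b ^ 2))).add_const (r ^ 2)).div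
        (hρw.const_mul 2) (by positivity)).congr_deriv ?_
      simp only [Pi.add_apply, Pi.pow_apply]
      push_cast
      field_simp
      ring
    have h2 := eq_of_hasDerivWithinAt_zero hJ h1 h0 ht
    simp only [hρ0, hw0] at h2
    rw [h2]; ring
  exact harmonic_unique hJ h0 (u := ρ) (du := w) hρ
    (fun t ht => (hdw t ht).congr_deriv (by rw [hK t ht])) hp hdp (hρ0.trans hp0.symm)
    (hw0.trans hdp0.symm) ht

/-- The geodesic equation at a point, as a system for the metric `G` and for `H = G⁻¹ G'`. -/
structure SolvesAt (J : Set ℝ) (τ ε : ℝ) (G H : ℝ → Mat) : Prop where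
  det_pos : ∀ t ∈ J, 0 < (G t).det
  deriv_left : ∀ t ∈ J, HasDerivWithinAt G (G t * H t) J t
  deriv_right : ∀ t ∈ J, HasDerivWithinAt H
    ((-(1 / 2) * ((H t).trace - τ)) • H t + (1 / 4 * ((H t * H t).trace - ε)) • (1 : Mat)) J t

theorem SolvesAt.mono {J J' : Set ℝ} {τ ε : ℝ} {G H : ℝ → Mat} (h : SolvesAt J τ ε G H)
    (hJ : J' ⊆ J) : SolvesAt J' τ ε G H :=
  ⟨fun t ht => h.det_pos t (hJ ht), fun t ht => (h.deriv_left t (hJ ht)).mono hJ,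
    fun t ht => (h.deriv_right t (hJ ht)).mono hJ⟩

theorem SolvesAt.hasDerivWithinAt_trace {J : Set ℝ} {τ ε : ℝ} {G H : ℝ → Mat}
    (h : SolvesAt J τ ε G H) {t : ℝ} (ht : t ∈ J) :
    HasDerivWithinAt (fun t => (H t).trace)
      (-(1 / 2) * ((H t).trace - τ) * (H t).trace + n / 4 * ((H t * H t).trace - ε)) J t := by
  refine (HasDerivWithinAt.matrix_trace (h.deriv_right t ht)).congr_deriv ?_
  simp only [Matrix.trace_add, Matrix.trace_smul, Matrix.trace_one, Fintype.card_fin, smul_eq_mul]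
  ring

theorem SolvesAt.hasDerivWithinAt_trace_sq {J : Set ℝ} {τ ε : ℝ} {G H : ℝ → Mat}
    (h : SolvesAt J τ ε G H) {t : ℝ} (ht : t ∈ J) :
    HasDerivWithinAt (fun t => (H t * H t).trace)
      (-((H t).trace - τ) * (H t * H t).trace + 1 / 2 * ((H t * H t).trace - ε) * (H t).trace)
      J t := by
  refine (HasDerivWithinAt.matrix_trace ((h.deriv_right t ht).mul
    (h.deriv_right t ht))).congr_deriv ?_
  simp only [Matrix.trace_add, Matrix.trace_smul, smul_eq_mul, add_mul, mul_add, Matrix.smul_mul,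
    Matrix.mul_smul, one_mul, mul_one]
  ring

theorem SolvesAt.hasDerivWithinAt_sqrt_det {J : Set ℝ} {τ ε d : ℝ} {G H : ℝ → Mat}
    (h : SolvesAt J τ ε G H) (hd : 0 < d) {t : ℝ} (ht : t ∈ J) :
    HasDerivWithinAt (fun t => Real.sqrt ((G t).det / d))
      (1 / 2 * (H t).trace * Real.sqrt ((G t).det / d)) J t := by
  have hG := h.det_pos t ht
  have h1 := ((HasDerivWithinAt.matrix_det (h.deriv_left t ht) hG.ne').div_const d).sqrt
    (div_pos hG hd).ne'
  refine h1.congr_deriv ?_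
  have h2 : 0 < Real.sqrt ((G t).det / d) := Real.sqrt_pos.2 (div_pos hG hd)
  have h3 : Real.sqrt ((G t).det / d) ^ 2 = (G t).det / d := Real.sq_sqrt (div_pos hG hd).le
  rw [div_eq_iff (by positivity), ← mul_assoc,
    Matrix.nonsing_inv_mul _ (isUnit_iff_ne_zero.2 hG.ne'), one_mul]
  generalize hs : Real.sqrt ((G t).det / d) = s at h2 h3 ⊢
  rw [mul_div_right_comm, ← h3]
  ring

/-- The factor `exp (-τ t / 2)` changes the logarithmic derivative `½ tr H` of the volume density
into `½ (tr H - τ)`, the normalisation in which `volume_ode` applies. -/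
theorem SolvesAt.volume_eq {J : Set ℝ} (hJ : Convex ℝ J) (h0 : (0 : ℝ) ∈ J) {τ ε b q r : ℝ}
    {G H : ℝ → Mat} (h : SolvesAt J τ ε G H) (hb : 4 * b ^ 2 = n * ε - τ ^ 2)
    (hq : 2 * q = (H 0).trace - τ) (hr : 4 * r ^ 2 = n * (H 0 * H 0).trace - (H 0).trace ^ 2)
    {p dp : ℝ → ℝ} (hp : ∀ t ∈ J, HasDerivWithinAt p (dp t) J t)
    (hdp : ∀ t ∈ J, HasDerivWithinAt dp ((q ^ 2 + b ^ 2 + r ^ 2) / 2 - b ^ 2 * p t) J t)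
    (hp0 : p 0 = 1) (hdp0 : dp 0 = q) {t : ℝ} (ht : t ∈ J) :
    Real.sqrt ((G t).det / (G 0).det) * Real.exp (-(τ * t / 2)) = p t ∧
      1 / 2 * ((H t).trace - τ) * p t = dp t := by
  have hρ : ∀ t ∈ J, HasDerivWithinAt
      (fun t => Real.sqrt ((G t).det / (G 0).det) * Real.exp (-(τ * t / 2)))
      (1 / 2 * ((H t).trace - τ) *
        (Real.sqrt ((G t).det / (G 0).det) * Real.exp (-(τ * t / 2)))) J t := by
    intro t ht
    have h1 : HasDerivAt (fun t => Real.exp (-(τ * t / 2)))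
        (Real.exp (-(τ * t / 2)) * -(τ * 1 / 2)) t :=
      ((((hasDerivAt_id t).const_mul τ).div_const 2).neg).exp
    refine ((h.hasDerivWithinAt_sqrt_det (h.det_pos 0 h0) ht).mul
      h1.hasDerivWithinAt).congr_deriv ?_
    ring
  have h1 := volume_ode hJ h0 (ν := n) (ε := ε) (b := b) (q := q) (r := r) hb
    (fun t ht => mul_pos (Real.sqrt_pos.2 (div_pos (h.det_pos t ht) (h.det_pos 0 h0)))
      (Real.exp_pos _)) hρ (fun t ht => h.hasDerivWithinAt_trace ht)
    (fun t ht => h.hasDerivWithinAt_trace_sq ht)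
    (by simp [div_self (h.det_pos 0 h0).ne']) hq hr hp hdp hp0 hdp0 ht
  refine ⟨h1.1, ?_⟩
  rw [← h1.1]
  exact h1.2

/-- The scalar term of the equation drops out of the traceless part of `H`, which therefore decays
at rate `½ (tr H - τ)`, exactly the rate at which `p` grows. -/
theorem SolvesAt.traceless_eq {J : Set ℝ} (hJ : Convex ℝ J) (h0 : (0 : ℝ) ∈ J) {τ ε : ℝ}
    {G H : ℝ → Mat} (h : SolvesAt J τ ε G H) (hn : 0 < n) {p : ℝ → ℝ}
    (hp : ∀ t ∈ J, HasDerivWithinAt p (1 / 2 * ((H t).trace - τ) * p t) J t) (hp0 : p 0 = 1)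
    {t : ℝ} (ht : t ∈ J) :
    p t • (H t - ((H t).trace / n) • (1 : Mat)) = H 0 - ((H 0).trace / n) • (1 : Mat) := by
  have hn' : (n : ℝ) ≠ 0 := by exact_mod_cast hn.ne'
  have h1 : ∀ t ∈ J, HasDerivWithinAt
      (fun t => p t • (H t - ((H t).trace / n) • (1 : Mat))) 0 J t := by
    intro t ht
    refine ((hp t ht).smul ((h.deriv_right t ht).sub
      (((h.hasDerivWithinAt_trace ht).div_const (n : ℝ)).smul_const (1 : Mat)))).congr_deriv ?_
    have h2 : (-(1 / 2) * ((H t).trace - τ) * (H t).trace + n / 4 * ((H t * H t).trace - ε)) /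
        (n : ℝ) = -(1 / 2) * ((H t).trace - τ) * ((H t).trace / n) +
          1 / 4 * ((H t * H t).trace - ε) := by
      field_simp
    rw [h2]
    simp only [Pi.sub_apply]
    module
  have h2 := eq_of_hasDerivWithinAt_zero hJ h1 h0 ht
  simpa only [hp0, one_smul] using h2

/-- Uniqueness for the geodesic equation at a point. -/
theorem SolvesAt.unique {J : Set ℝ} (hJ : Convex ℝ J) (h0 : (0 : ℝ) ∈ J) {τ ε b q r : ℝ}
    {G H G' H' : ℝ → Mat} (h : SolvesAt J τ ε G H) (h' : SolvesAt J τ ε G' H') (hn : 0 < n)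
    (hb : 4 * b ^ 2 = n * ε - τ ^ 2)
    (hq : 2 * q = (H 0).trace - τ) (hr : 4 * r ^ 2 = n * (H 0 * H 0).trace - (H 0).trace ^ 2)
    {p dp : ℝ → ℝ} (hp : ∀ t ∈ J, HasDerivWithinAt p (dp t) J t)
    (hdp : ∀ t ∈ J, HasDerivWithinAt dp ((q ^ 2 + b ^ 2 + r ^ 2) / 2 - b ^ 2 * p t) J t)
    (hp0 : p 0 = 1) (hdp0 : dp 0 = q) (hG0 : G 0 = G' 0) (hH0 : H 0 = H' 0) {t : ℝ} (ht : t ∈ J) :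
    G t = G' t := by
  have e := fun t ht => h.volume_eq hJ h0 hb hq hr hp hdp hp0 hdp0 (t := t) ht
  have e' := fun t ht => h'.volume_eq hJ h0 hb (hH0 ▸ hq) (hH0 ▸ hr) hp hdp hp0 hdp0 (t := t) ht
  have hpos : ∀ t ∈ J, p t ≠ 0 := fun t ht => by
    rw [← (e t ht).1]
    exact (mul_pos (Real.sqrt_pos.2 (div_pos (h.det_pos t ht) (h.det_pos 0 h0)))
      (Real.exp_pos _)).ne'
  -- The trace of `H` is determined by `p` and `dp`, and the traceless part by its conserved
  -- multiple by `p`; both agree for the two solutions.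
  have eH : ∀ t ∈ J, H t = H' t := by
    intro t ht
    have htr : (H t).trace = (H' t).trace := by
      have h1 := (e t ht).2.trans (e' t ht).2.symm
      have h2 := mul_right_cancel₀ (hpos t ht) h1
      linarith
    have h1 := h.traceless_eq hJ h0 hn (p := p)
      (fun t ht => (hp t ht).congr_deriv (e t ht).2.symm) hp0 ht
    have h2 := h'.traceless_eq hJ h0 hn (p := p)
      (fun t ht => (hp t ht).congr_deriv (e' t ht).2.symm) hp0 ht
    rw [hH0, ← h2, htr] at h1
    simpa using smul_right_injective _ (hpos t ht) h1
  -- Once the logarithmic derivatives coincide, the quotient of the two metrics is constant.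
  have h1 : ∀ t ∈ J, HasDerivWithinAt (fun t => G t * (G' t)⁻¹) 0 J t := by
    intro t ht
    have hd := (h'.det_pos t ht).ne'
    refine ((h.deriv_left t ht).mul
      (HasDerivWithinAt.matrix_inv (h'.deriv_left t ht) hd)).congr_deriv ?_
    have h3 : (G' t)⁻¹ * (G' t * H' t) = H' t := by
      rw [← mul_assoc, Matrix.nonsing_inv_mul _ (isUnit_iff_ne_zero.2 hd), one_mul]
    rw [← eH t ht] at h3 ⊢
    rw [h3]
    noncomm_ring
  have h2 := eq_of_hasDerivWithinAt_zero hJ h1 h0 ht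
  simp only [hG0] at h2
  rw [Matrix.mul_nonsing_inv _ (isUnit_iff_ne_zero.2 (h'.det_pos 0 h0).ne')] at h2
  have h3 := congrArg (fun X => X * G' t) h2
  simpa only [one_mul, mul_assoc,
    Matrix.nonsing_inv_mul _ (isUnit_iff_ne_zero.2 (h'.det_pos t ht).ne'), mul_one] using h3

end
end GenCalabi

/-! ### Geodesics on `M`: the evolution of `g⁻¹ g'` and conservation laws -/

open Set Filter Topology MeasureTheory
open scoped Manifold ContDiff
namespace GenCalabi

section
open scoped Matrix.Norms.Operator

variable {n : ℕ}
local notation "Mat" => Matrix (Fin n) (Fin n) ℝ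
local notation "𝔼" n => EuclideanSpace ℝ (Fin n)

variable {M : Type*} [TopologicalSpace M] [ChartedSpace (𝔼 n) M] [IsManifold (𝓡 n) ∞ M]

theorem isSmoothSym_velocity {J : Set ℝ} (hJ : UniqueDiffOn ℝ J)
    {c : ℝ → TensorField n M} (hc : SmoothTensor J c) (hs : ∀ t ∈ J, IsSmoothSym (c t))
    {t : ℝ} (ht : t ∈ J) : IsSmoothSym (velocity J c t) := by
  refine isSmoothSym_iff_gram.2 ⟨fun x => ?_, (hc.velocity hJ).slice ht⟩
  ext i j
  have h1 := HasDerivWithinAt.matrix_entry (hc.hasDerivWithinAt_gram ht x) i j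
  have h2 := HasDerivWithinAt.matrix_entry (hc.hasDerivWithinAt_gram ht x) j i
  have h3 : ∀ s ∈ J, gram (c s) x i j = gram (c s) x j i := fun s hs' => by
    conv_rhs => rw [← (hs s hs').gram_symm x]
    rfl
  exact (hJ t ht).eq_deriv _ (h2.congr h3 (h3 t ht)) h1

/-- The derivative of `g⁻¹ g'` along a curve of metrics. -/
theorem hasDerivWithinAt_endo {J : Set ℝ} (hJ : UniqueDiffOn ℝ J)
    {c : ℝ → TensorField n M} (hc : SmoothTensor J c) (hd : ∀ t ∈ J, ∀ x, (gram (c t) x).det ≠ 0)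
    {t : ℝ} (ht : t ∈ J) (x : M) :
    HasDerivWithinAt (fun s => endo (c s) (velocity J c s) x)
      ((gram (c t) x)⁻¹ * gram (velocity J (velocity J c) t) x -
        endo (c t) (velocity J c t) x * endo (c t) (velocity J c t) x) J t := by
  refine ((HasDerivWithinAt.matrix_inv (hc.hasDerivWithinAt_gram ht x) (hd t ht x)).mul
    ((hc.velocity hJ).hasDerivWithinAt_gram ht x)).congr_deriv ?_
  simp only [endo]
  noncomm_ring

variable [CompactSpace M] [Nonempty M] [MeasurableSpace M] [BorelSpace M] [T2Space M]

/-- The geodesic equation for a smooth curve of metrics. -/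
theorem geodesicOn_iff {J : Set ℝ} (hJ : UniqueDiffOn ℝ J) {c : ℝ → TensorField n M}
    (hm : ∀ t ∈ J, IsMetric (c t)) (hc : SmoothTensor J c) :
    (∀ t ∈ J, ∀ l : TensorField n M, IsSmoothSym l →
      gN (c t) (velocity J (velocity J c) t) l
        + koszul (c t) (velocity J c t) (velocity J c t) l = 0) ↔
    ∀ t ∈ J, ∀ x, HasDerivWithinAt (fun s => endo (c s) (velocity J c s) x)
      ((-(1 / 2) * ((endo (c t) (velocity J c t) x).trace - gN (c t) (c t) (velocity J c t))) •
        endo (c t) (velocity J c t) x +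
      (1 / 4 * ((endo (c t) (velocity J c t) x * endo (c t) (velocity J c t) x).trace -
        gN (c t) (velocity J c t) (velocity J c t))) • (1 : Mat)) J t := by
  have hv : ∀ t ∈ J, IsSmoothSym (velocity J c t) := fun t ht =>
    isSmoothSym_velocity hJ hc (fun t ht => (hm t ht).toIsSmoothSym) ht
  have ha : ∀ t ∈ J, IsSmoothSym (velocity J (velocity J c) t) := fun t ht =>
    isSmoothSym_velocity hJ (hc.velocity hJ) hv ht
  refine forall₂_congr fun t ht => ?_
  rw [geodesic_equation_iff (hm t ht) (hv t ht) (ha t ht)]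
  refine forall_congr' fun x => ?_
  have hd := ((hm t ht).det_pos x).ne'
  have hu := isUnit_iff_ne_zero.2 hd
  have h1 := hasDerivWithinAt_endo hJ hc (fun t ht x => ((hm t ht).det_pos x).ne') ht x
  have h2 : (gram (c t) x) * endo (c t) (velocity J c t) x = gram (velocity J c t) x := by
    rw [endo, ← mul_assoc, Matrix.mul_nonsing_inv _ hu, one_mul]
  rw [traceProd_self_left hd, traceProd_eq_endo, ← h2]
  constructor
  · intro h
    refine h1.congr_deriv ?_
    rw [h]
    simp only [mul_add, mul_sub, Matrix.mul_smul, ← mul_assoc, Matrix.nonsing_inv_mul _ hu, one_mul]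
    module
  · intro h
    have h3 := (hJ t ht).eq_deriv _ h1 h
    have h4 := congrArg (fun X => gram (c t) x * X) (sub_eq_iff_eq_add.1 h3)
    simp only [← mul_assoc, Matrix.mul_nonsing_inv _ hu, one_mul] at h4
    rw [h4]
    simp only [mul_add, Matrix.mul_smul, ← mul_assoc, mul_one]
    module

/-- Along a geodesic, `g_N(g, g')` and `g_N(g', g')` are constant. -/
theorem IsGeodesicOn.conserved {J : Set ℝ} (hJc : Convex ℝ J) (hJ : UniqueDiffOn ℝ J)
    {c : ℝ → TensorField n M} (hc : IsGeodesicOn J c) {s t : ℝ} (hs : s ∈ J) (ht : t ∈ J) :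
    gN (c t) (c t) (velocity J c t) = gN (c s) (c s) (velocity J c s) ∧
    gN (c t) (velocity J c t) (velocity J c t) = gN (c s) (velocity J c s) (velocity J c s) := by
  have hsm : SmoothTensor J c := isSmoothCurveOn_iff.1 hc.smooth
  have hm := hc.metric
  have hg := hm s hs
  have := hg.isFiniteMeasure
  have heq := (geodesicOn_iff hJ hm hsm).1 hc.geodesic
  have hdp : ∀ t ∈ J, ∀ x, 0 < (gram (c t) x).det := fun t ht x => (hm t ht).det_pos x
  have hdn : ∀ t ∈ J, ∀ x, (gram (c t) x).det ≠ 0 := fun t ht x => (hdp t ht x).ne'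
  have hρ := hsm.volRatio hg hdp
  have hS := hsm.traceProd hsm (hsm.velocity hJ) hdn
  have hT := hsm.traceProd (hsm.velocity hJ) (hsm.velocity hJ) hdn
  set H : ℝ → M → Mat := fun t x => endo (c t) (velocity J c t) x with hH
  set ρ : ℝ → M → ℝ := fun t x => volRatio (c s) (c t) x with hρdef
  have eS : ∀ t ∈ J, ∀ x, traceProd (c t) (c t) (velocity J c t) x = (H t x).trace :=
    fun t ht x => traceProd_self_left (hdn t ht x) _
  replace hS : SmoothFun (n := n) J (fun t x => (H t x).trace) :=
    hS.congr fun t ht x => (eS t ht x).symm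
  replace hT : SmoothFun (n := n) J (fun t x => (H t x * H t x).trace) := hT
  -- All integrals are taken against the fixed measure of the metric at time `s`, the volume ratio
  -- `ρ` carrying the time dependence.
  set V : ℝ → ℝ := fun t => ∫ x, ρ t x ∂(vol (c s)) with hV
  set I : ℝ → ℝ := fun t => ∫ x, (H t x).trace * ρ t x ∂(vol (c s)) with hI
  set E : ℝ → ℝ := fun t => ∫ x, (H t x * H t x).trace * ρ t x ∂(vol (c s)) with hE
  have eV : ∀ t ∈ J, totalVol (c t) = V t := fun t ht =>
    totalVol_eq_integral hg (hsm.slice ht)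
  have hVpos : ∀ t ∈ J, 0 < V t := fun t ht => eV t ht ▸ (hm t ht).totalVol_pos
  have eI : ∀ t ∈ J, gN (c t) (c t) (velocity J c t) = I t / V t := by
    intro t ht
    rw [gN, ebin, integral_vol hg (hsm.slice ht), eV t ht]
    simp only [eS t ht]
    rfl
  have eE : ∀ t ∈ J, gN (c t) (velocity J c t) (velocity J c t) = E t / V t := by
    intro t ht
    rw [gN, ebin, integral_vol hg (hsm.slice ht), eV t ht]
    rfl
  have dρ : ∀ t ∈ J, ∀ x, HasDerivWithinAt (fun t => ρ t x) (1 / 2 * (H t x).trace * ρ t x) J t :=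
    fun t ht x => hasDerivWithinAt_volRatio (hg.det_pos x) (hsm.hasDerivWithinAt_gram ht x)
      (hdp t ht x)
  have dH : ∀ t ∈ J, ∀ x, HasDerivWithinAt (fun t => H t x)
      ((-(1 / 2) * ((H t x).trace - I t / V t)) • H t x +
        (1 / 4 * ((H t x * H t x).trace - E t / V t)) • (1 : Mat)) J t := by
    intro t ht x
    rw [← eI t ht, ← eE t ht]
    exact heq t ht x
  have dV : ∀ t ∈ interior J, HasDerivAt V (1 / 2 * I t) t := by
    intro t ht
    have htJ := interior_subset ht
    have h1 := hρ.hasDerivAt_integral hJ (vol (c s)) (mem_interior_iff_mem_nhds.1 ht)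
      (fun x => dρ t htJ x)
    refine h1.congr_deriv ?_
    rw [hI]
    simp only [← integral_const_mul, mul_assoc]
  -- The last term cancels after integration, so `I' = ½ I² / V`. Likewise `E' = ½ I E / V`, and
  -- with `V' = ½ I` both quotients `I / V` and `E / V` are stationary.
  have dI : ∀ t ∈ interior J, HasDerivAt I (1 / 2 * (I t / V t) * I t
      + n / 4 * (E t - E t / V t * V t)) t := by
    intro t ht
    have htJ := interior_subset ht
    have h1 := (hS.mul hρ).hasDerivAt_integral hJ (vol (c s)) (mem_interior_iff_mem_nhds.1 ht)
      (f' := fun x => 1 / 2 * (I t / V t) * ((H t x).trace * ρ t x) +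
        n / 4 * ((H t x * H t x).trace * ρ t x - E t / V t * ρ t x)) (fun x => ?_)
    · refine h1.congr_deriv ?_
      have i1 : Integrable (fun x => (H t x).trace * ρ t x) (vol (c s)) :=
        (hS.mul hρ).integrable _ htJ
      have i2 : Integrable (fun x => (H t x * H t x).trace * ρ t x) (vol (c s)) :=
        (hT.mul hρ).integrable _ htJ
      have i3 : Integrable (fun x => ρ t x) (vol (c s)) := hρ.integrable _ htJ
      have i4 : Integrable (fun x => (H t x * H t x).trace * ρ t x - E t / V t * ρ t x)
        (vol (c s)) := i2.sub (i3.const_mul _)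
      rw [integral_add (i1.const_mul _) (i4.const_mul _), integral_const_mul, integral_const_mul,
        integral_sub i2 (i3.const_mul _), integral_const_mul]
    · refine ((HasDerivWithinAt.matrix_trace (dH t htJ x)).mul (dρ t htJ x)).congr_deriv ?_
      simp only [Matrix.trace_add, Matrix.trace_smul, Matrix.trace_one, Fintype.card_fin,
        smul_eq_mul]
      ring
  have dE : ∀ t ∈ interior J, HasDerivAt E (I t / V t * E t - 1 / 2 * (E t / V t) * I t) t := by
    intro t ht
    have htJ := interior_subset ht
    have h1 := (hT.mul hρ).hasDerivAt_integral hJ (vol (c s)) (mem_interior_iff_mem_nhds.1 ht)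
      (f' := fun x => I t / V t * ((H t x * H t x).trace * ρ t x) -
        1 / 2 * (E t / V t) * ((H t x).trace * ρ t x)) (fun x => ?_)
    · refine h1.congr_deriv ?_
      have i1 : Integrable (fun x => (H t x).trace * ρ t x) (vol (c s)) :=
        (hS.mul hρ).integrable _ htJ
      have i2 : Integrable (fun x => (H t x * H t x).trace * ρ t x) (vol (c s)) :=
        (hT.mul hρ).integrable _ htJ
      rw [integral_sub (i2.const_mul _) (i1.const_mul _), integral_const_mul, integral_const_mul]
    · refine ((HasDerivWithinAt.matrix_trace ((dH t htJ x).mul (dH t htJ x))).mul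
        (dρ t htJ x)).congr_deriv ?_
      simp only [Matrix.trace_add, Matrix.trace_smul, smul_eq_mul, add_mul, mul_add,
        Matrix.smul_mul, Matrix.mul_smul, one_mul, mul_one, Pi.mul_apply]
      ring
  have cV : ContinuousOn V J := hρ.continuousOn_integral _
  have cI : ContinuousOn I J := (hS.mul hρ).continuousOn_integral _
  have cE : ContinuousOn E J := (hT.mul hρ).continuousOn_integral _
  have hV0 : ∀ t ∈ J, V t ≠ 0 := fun t ht => (hVpos t ht).ne'
  constructor
  · rw [eI t ht, eI s hs]
    refine eq_of_hasDerivAt_zero_interior hJc (f := fun t => I t / V t) (cI.div cV hV0)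
      (fun u hu => ?_) hs ht
    have hne := hV0 u (interior_subset hu)
    refine ((dI u hu).div (dV u hu) hne).congr_deriv ?_
    field_simp
    ring
  · rw [eE t ht, eE s hs]
    refine eq_of_hasDerivAt_zero_interior hJc (f := fun t => E t / V t) (cE.div cV hV0)
      (fun u hu => ?_) hs ht
    have hne := hV0 u (interior_subset hu)
    refine ((dE u hu).div (dV u hu) hne).congr_deriv ?_
    field_simp
    ring

/-- A geodesic solves the pointwise system with constant coefficients. -/
theorem IsGeodesicFrom.solvesAt {J : Set ℝ} (hJc : Convex ℝ J) (hJ : UniqueDiffOn ℝ J)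
    (h0 : 0 ∈ J) {g₀ v : TensorField n M}
    {c : ℝ → TensorField n M} (hc : IsGeodesicFrom g₀ v J c) (x : M) :
    SolvesAt J (gN g₀ g₀ v) (gN g₀ v v) (fun t => gram (c t) x)
      (fun t => endo (c t) (velocity J c t) x) := by
  have hsm : SmoothTensor J c := isSmoothCurveOn_iff.1 hc.smooth
  refine ⟨fun t ht => (hc.metric t ht).det_pos x, fun t ht => ?_, fun t ht => ?_⟩
  · refine (hsm.hasDerivWithinAt_gram ht x).congr_deriv ?_
    rw [endo, ← mul_assoc, Matrix.mul_nonsing_inv _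
      (isUnit_iff_ne_zero.2 ((hc.metric t ht).det_pos x).ne'), one_mul]
  · have h1 := (geodesicOn_iff hJ hc.metric hsm).1 hc.geodesic t ht x
    obtain ⟨h2, h3⟩ := hc.conserved hJc hJ h0 ht
    rw [h2, h3, hc.init, hc.init_velocity] at h1
    exact h1

end
end GenCalabi

/-! ### Smooth dependence of an integral on parameters -/

open Set Filter Topology MeasureTheory
open scoped Manifold ContDiff
namespace GenCalabi

section ParametricIntegral

/-- Compactness of the unit interval gives, near `x₀`, slices inside `W` with one bound for the
integrand: the domination needed to differentiate under the integral. -/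
theorem eventually_bounded_slice {E F : Type*} [TopologicalSpace E]
    [NormedAddCommGroup F] {W : Set (E × ℝ)} (hW : IsOpen W) {k : E × ℝ → F}
    (hk : ContinuousOn k W) {x₀ : E} (hx₀ : ∀ τ ∈ Icc (0 : ℝ) 1, (x₀, τ) ∈ W) :
    ∃ C : ℝ, ∀ᶠ x in 𝓝 x₀, ∀ τ ∈ Icc (0 : ℝ) 1, (x, τ) ∈ W ∧ ‖k (x, τ)‖ ≤ C := by
  obtain ⟨C, hC⟩ := isCompact_Icc.exists_bound_of_continuousOn (s := Icc (0 : ℝ) 1)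
    (f := fun τ => k (x₀, τ)) (hk.comp (by fun_prop) fun τ hτ => hx₀ τ hτ)
  refine ⟨C + 1, isCompact_Icc.eventually_forall_of_forall_eventually fun τ hτ => ?_⟩
  have h1 : ContinuousAt k (x₀, τ) := hk.continuousAt (hW.mem_nhds (hx₀ τ hτ))
  have h2 : ‖k (x₀, τ)‖ < C + 1 := (hC τ hτ).trans_lt (lt_add_one C)
  filter_upwards [hW.mem_nhds (hx₀ τ hτ), h1.norm.eventually_lt_const h2] with p hp hp'
  exact ⟨hp, hp'.le⟩

theorem hasFDerivAt_integral_unit {E F : Type*} [NormedAddCommGroup E] [NormedSpace ℝ E]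
    [NormedAddCommGroup F] [NormedSpace ℝ F]
    {W : Set (E × ℝ)} (hW : IsOpen W) {h : E × ℝ → F} (hh : ContDiffOn ℝ 1 h W) {x₀ : E}
    (hx₀ : ∀ τ ∈ Icc (0 : ℝ) 1, (x₀, τ) ∈ W) :
    HasFDerivAt (fun x => ∫ τ in (0 : ℝ)..1, h (x, τ))
      (∫ τ in (0 : ℝ)..1, (fderiv ℝ h (x₀, τ)).comp (ContinuousLinearMap.inl ℝ E ℝ)) x₀ := by
  set D : E × ℝ → E →L[ℝ] F := fun p => (fderiv ℝ h p).comp (ContinuousLinearMap.inl ℝ E ℝ)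
    with hD
  have hDc : ContinuousOn D W :=
    ((ContinuousLinearMap.compL ℝ E (E × ℝ) F).flip
      (ContinuousLinearMap.inl ℝ E ℝ)).continuous.comp_continuousOn
      (hh.continuousOn_fderiv_of_isOpen hW le_rfl)
  obtain ⟨C, hC⟩ := eventually_bounded_slice hW hDc hx₀
  have hsub : uIoc (0 : ℝ) 1 ⊆ Icc 0 1 := by
    rw [uIoc_of_le zero_le_one]; exact Ioc_subset_Icc_self
  refine intervalIntegral.hasFDerivAt_integral_of_dominated_of_fderiv_le
    (F' := fun x τ => D (x, τ)) (bound := fun _ => C) hC ?_ ?_ ?_ ?_ ?_ ?_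
  · filter_upwards [hC] with x hx
    exact (hh.continuousOn.comp (by fun_prop) fun τ hτ => (hx τ (hsub hτ)).1).aestronglyMeasurable
      measurableSet_uIoc
  · refine ContinuousOn.intervalIntegrable ?_
    rw [uIcc_of_le zero_le_one]
    exact hh.continuousOn.comp (by fun_prop) fun τ hτ => hx₀ τ hτ
  · exact (hDc.comp (by fun_prop) fun τ hτ => hx₀ τ (hsub hτ)).aestronglyMeasurable
      measurableSet_uIoc
  · exact Eventually.of_forall fun τ hτ x hx => (hx τ (hsub hτ)).2
  · exact intervalIntegrable_const
  · refine Eventually.of_forall fun τ hτ x hx => ?_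
    have hxW := (hx τ (hsub hτ)).1
    have h1 := ((hh.contDiffAt (hW.mem_nhds hxW)).differentiableAt one_ne_zero).hasFDerivAt
    exact h1.comp x (hasFDerivAt_prodMk_left x τ)

/-- Induction on the order with the target space left free, because the derivative takes values in
`E →L[ℝ] F`. -/
theorem contDiffOn_integral_unit_nat {E : Type} [NormedAddCommGroup E] [NormedSpace ℝ E]
    {W : Set (E × ℝ)} (hW : IsOpen W) {U : Set E} (hU : IsOpen U)
    (hUW : ∀ x ∈ U, ∀ τ ∈ Icc (0 : ℝ) 1, (x, τ) ∈ W) (m : ℕ) :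
    ∀ {F : Type} [NormedAddCommGroup F] [NormedSpace ℝ F] {h : E × ℝ → F}, ContDiffOn ℝ m h W →
      ContDiffOn ℝ m (fun x => ∫ τ in (0 : ℝ)..1, h (x, τ)) U := by
  induction m with
  | zero =>
    intro F _ _ h hh
    have hhc : ContinuousOn h W := hh.continuousOn
    refine contDiffOn_zero.2 fun x₀ hx₀ => ContinuousAt.continuousWithinAt ?_
    obtain ⟨C, hC⟩ := eventually_bounded_slice hW hhc (hUW x₀ hx₀)
    have hsub : uIoc (0 : ℝ) 1 ⊆ Icc 0 1 := by
      rw [uIoc_of_le zero_le_one]; exact Ioc_subset_Icc_self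
    refine intervalIntegral.continuousAt_of_dominated_interval (bound := fun _ => C) ?_ ?_
      intervalIntegrable_const ?_
    · filter_upwards [hC] with x hx
      exact (hhc.comp (by fun_prop) fun τ hτ => (hx τ (hsub hτ)).1).aestronglyMeasurable
        measurableSet_uIoc
    · filter_upwards [hC] with x hx
      exact Eventually.of_forall fun τ hτ => (hx τ (hsub hτ)).2
    · refine Eventually.of_forall fun τ hτ => ?_
      have h1 : ContinuousAt h (x₀, τ) :=
        hhc.continuousAt (hW.mem_nhds (hUW x₀ hx₀ τ (hsub hτ)))
      exact h1.comp (f := fun x => (x, τ)) (by fun_prop)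
  | succ m ih =>
    intro F _ _ h hh
    have h1 : ContDiffOn ℝ 1 h W := hh.of_le (by exact_mod_cast Nat.le_add_left 1 m)
    have hd := fun x (hx : x ∈ U) => hasFDerivAt_integral_unit hW h1 (hUW x hx)
    push_cast
    rw [contDiffOn_succ_iff_fderiv_of_isOpen hU]
    refine ⟨fun x hx => (hd x hx).differentiableAt.differentiableWithinAt, by simp, ?_⟩
    have h2 : ContDiffOn ℝ m
        (fun p => (fderiv ℝ h p).comp (ContinuousLinearMap.inl ℝ E ℝ)) W :=
      ((ContinuousLinearMap.compL ℝ E (E × ℝ) F).flip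
        (ContinuousLinearMap.inl ℝ E ℝ)).contDiff.comp_contDiffOn
        (hh.fderiv_of_isOpen hW (by push_cast; exact le_rfl))
    exact (ih h2).congr fun x hx => (hd x hx).fderiv

theorem contDiffOn_integral_unit {E F : Type} [NormedAddCommGroup E] [NormedSpace ℝ E]
    [NormedAddCommGroup F] [NormedSpace ℝ F]
    {W : Set (E × ℝ)} (hW : IsOpen W) {U : Set E} (hU : IsOpen U)
    (hUW : ∀ x ∈ U, ∀ τ ∈ Icc (0 : ℝ) 1, (x, τ) ∈ W) {h : E × ℝ → F} (hh : ContDiffOn ℝ ∞ h W) :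
    ContDiffOn ℝ ∞ (fun x => ∫ τ in (0 : ℝ)..1, h (x, τ)) U :=
  contDiffOn_infty.2 fun m => contDiffOn_integral_unit_nat hW hU hUW m
    (hh.of_le (by exact_mod_cast le_top))

end ParametricIntegral

/-! ### The volume factor, its zeros and the primitive of its inverse -/

section Factor

/-- `volFactor` in terms of the square of its third argument. -/
noncomputable def volPoly (b q s t : ℝ) : ℝ :=
  (1 / 2) * (1 - (q ^ 2 + s) / b ^ 2) * Real.cos (b * t) + q / b * Real.sin (b * t)
    + (1 / 2) * (1 + (q ^ 2 + s) / b ^ 2)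

theorem volPoly_sq (b q r t : ℝ) : volPoly b q (r ^ 2) t = volFactor b q r t := rfl

/-- The time derivative of `volFactor`. -/
noncomputable def volFactorDeriv (b q r t : ℝ) : ℝ :=
  -((1 / 2) * (1 - (q ^ 2 + r ^ 2) / b ^ 2)) * (b * Real.sin (b * t)) + q * Real.cos (b * t)

variable {b q r : ℝ}

theorem hasDerivAt_cos_mul (b t : ℝ) :
    HasDerivAt (fun t => Real.cos (b * t)) (-(b * Real.sin (b * t))) t := by
  refine (((hasDerivAt_id t).const_mul b).cos).congr_deriv ?_
  simp only [id]; ring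

theorem hasDerivAt_sin_mul (b t : ℝ) :
    HasDerivAt (fun t => Real.sin (b * t)) (b * Real.cos (b * t)) t := by
  refine (((hasDerivAt_id t).const_mul b).sin).congr_deriv ?_
  simp only [id]; ring

theorem hasDerivAt_volFactor (hb : b ≠ 0) (t : ℝ) :
    HasDerivAt (volFactor b q r) (volFactorDeriv b q r t) t := by
  refine ((((hasDerivAt_cos_mul b t).const_mul _).add
    ((hasDerivAt_sin_mul b t).const_mul _)).add_const _).congr_deriv ?_
  rw [volFactorDeriv]
  field_simp

theorem hasDerivAt_volFactorDeriv (hb : b ≠ 0) (t : ℝ) :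
    HasDerivAt (volFactorDeriv b q r)
      ((q ^ 2 + b ^ 2 + r ^ 2) / 2 - b ^ 2 * volFactor b q r t) t := by
  refine ((((hasDerivAt_sin_mul b t).const_mul b).const_mul _).add
    ((hasDerivAt_cos_mul b t).const_mul q)).congr_deriv ?_
  rw [volFactor]
  field_simp
  ring

theorem volFactor_zero : volFactor b q r 0 = 1 := by
  rw [volFactor, mul_zero, Real.cos_zero, Real.sin_zero]; ring

theorem volFactorDeriv_zero : volFactorDeriv b q r 0 = q := by
  rw [volFactorDeriv, mul_zero, Real.cos_zero, Real.sin_zero]; ring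

theorem volFactor_first_integral (hb : b ≠ 0) (t : ℝ) :
    volFactorDeriv b q r t ^ 2 + b ^ 2 * volFactor b q r t ^ 2 + r ^ 2 =
      (q ^ 2 + b ^ 2 + r ^ 2) * volFactor b q r t := by
  rw [volFactor, volFactorDeriv]
  have h := Real.sin_sq_add_cos_sq (b * t)
  have h' : Real.sin (b * t) ^ 2 = 1 - Real.cos (b * t) ^ 2 := by linarith
  field_simp
  ring_nf
  rw [h']
  ring

/-- Exhibits the factor as a sum of two squares. Nonnegativity, the location of its zeros and the
arctangent formula are all read off from this form. -/
theorem volFactor_half_angle (hb : b ≠ 0) (u : ℝ) :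
    volFactor b q r (2 * u / b) =
      ((b * Real.cos u + q * Real.sin u) ^ 2 + (r * Real.sin u) ^ 2) / b ^ 2 := by
  have h1 : b * (2 * u / b) = 2 * u := by field_simp
  rw [volFactor, h1, Real.cos_two_mul, Real.sin_two_mul]
  have h' : Real.sin u ^ 2 = 1 - Real.cos u ^ 2 := by linarith [Real.sin_sq_add_cos_sq u]
  field_simp
  ring_nf
  rw [h']
  ring

/-- Writing `q = b tan φ` merges the two oscillations into one shifted cosine, whose zeros are
explicit. -/
theorem cos_sub_arctan (hb : b ≠ 0) (q u : ℝ) :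
    b * Real.cos u + q * Real.sin u =
      b * (Real.cos (u - Real.arctan (q / b)) / Real.cos (Real.arctan (q / b))) := by
  have h1 := (Real.cos_arctan_pos (q / b)).ne'
  have h2 : q = b * (Real.sin (Real.arctan (q / b)) / Real.cos (Real.arctan (q / b))) := by
    rw [← Real.tan_eq_sin_div_cos, Real.tan_arctan]; field_simp
  rw [Real.cos_sub]
  generalize Real.arctan (q / b) = φ at h1 h2
  rw [h2]
  field_simp

/-- The quotient inside the arccosine is `-cos (2 φ)` with `φ = arctan (q / b)`. The two cases of
the definition undo the cosine on the two halves of its period, so they join to one function,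
continuous in `q`. -/
theorem theta_eq (hb' : 0 < b) (q : ℝ) :
    theta b q = Real.pi + 2 * Real.arctan (q / b) := by
  have hb := hb'.ne'
  have h1 := (Real.cos_arctan_pos (q / b)).ne'
  have h2 : (q ^ 2 - b ^ 2) / (q ^ 2 + b ^ 2) = -Real.cos (2 * Real.arctan (q / b)) := by
    rw [Real.cos_two_mul, Real.cos_sq_arctan]
    have : q ^ 2 + b ^ 2 ≠ 0 := by positivity
    have : b ^ 2 + q ^ 2 ≠ 0 := by positivity
    field_simp
    ring
  have hl := Real.neg_pi_div_two_lt_arctan (q / b)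
  have hu := Real.arctan_lt_pi_div_two (q / b)
  rw [theta, h2]
  split_ifs with hq
  · have h3 : 0 ≤ Real.arctan (q / b) := Real.arctan_nonneg.2 (by positivity)
    rw [← Real.cos_pi_sub, Real.arccos_cos (by linarith) (by linarith)]
    ring
  · have h3 : Real.arctan (q / b) < 0 :=
      Real.arctan_lt_zero.2 (div_neg_of_neg_of_pos (not_le.1 hq) hb')
    rw [← Real.cos_pi_sub, ← Real.cos_neg, neg_sub,
      show 2 * Real.arctan (q / b) - Real.pi = (Real.pi + 2 * Real.arctan (q / b)) - 2 * Real.pi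
        by ring, Real.cos_sub_two_pi, Real.arccos_cos (by linarith) (by linarith)]

theorem theta_pos (hb : 0 < b) (q : ℝ) : 0 < theta b q := by
  rw [theta_eq hb q]
  linarith [Real.neg_pi_div_two_lt_arctan (q / b)]

/-- A zero would force `r sin u = 0`, hence `sin u = 0`, and then the other square is `b² cos² u ≠
0`. -/
theorem volFactor_pos_of_ne_zero (hb : b ≠ 0) (hr : r ≠ 0) (t : ℝ) : 0 < volFactor b q r t := by
  have h : t = 2 * (b * t / 2) / b := by field_simp
  rw [h, volFactor_half_angle hb]
  generalize b * t / 2 = u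
  by_cases hs : Real.sin u = 0
  · have hc : Real.cos u ≠ 0 := fun hc => by
      have := Real.sin_sq_add_cos_sq u
      rw [hs, hc] at this
      norm_num at this
    rw [hs]
    simp only [mul_zero, add_zero]
    positivity
  · positivity

/-- Here `r` may be zero, so positivity must come from the first square: up to time `θ / b` the
shifted cosine has its argument strictly between `-π / 2` and `π / 2`. -/
theorem volFactor_pos_of_lt_theta (hb : 0 < b) {t : ℝ} (h0 : 0 ≤ t) (ht : t < theta b q / b) :
    0 < volFactor b q r t := by
  have h : t = 2 * (b * t / 2) / b := by field_simp
  rw [h, volFactor_half_angle hb.ne']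
  rw [lt_div_iff₀ hb, theta_eq hb q] at ht
  have h1 : 0 ≤ b * t / 2 := by positivity
  have hc : 0 < Real.cos (b * t / 2 - Real.arctan (q / b)) :=
    Real.cos_pos_of_mem_Ioo ⟨by linarith [Real.arctan_lt_pi_div_two (q / b)], by linarith⟩
  rw [cos_sub_arctan hb.ne']
  have := Real.cos_arctan_pos (q / b)
  positivity

theorem volFactor_theta (hb : 0 < b) : volFactor b q 0 (theta b q / b) = 0 := by
  have h : theta b q / b = 2 * (theta b q / 2) / b := by field_simp
  rw [h, volFactor_half_angle hb.ne', cos_sub_arctan hb.ne', theta_eq hb q,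
    show (Real.pi + 2 * Real.arctan (q / b)) / 2 - Real.arctan (q / b) = Real.pi / 2 by ring,
    Real.cos_pi_div_two]
  simp

/-- The primitive of `1 / volPoly`. -/
noncomputable def invPrimitive (b q s t : ℝ) : ℝ :=
  ∫ τ in (0 : ℝ)..1, t / volPoly b q s (t * τ)

theorem continuous_volPoly (b q s : ℝ) : Continuous (volPoly b q s) := by
  unfold volPoly; fun_prop

theorem invPrimitive_zero (b q s : ℝ) : invPrimitive b q s 0 = 0 := by
  simp [invPrimitive]

theorem hasDerivAt_invPrimitive {s t : ℝ} (h : ∀ u ∈ uIcc 0 t, volPoly b q s u ≠ 0) :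
    HasDerivAt (invPrimitive b q s) (1 / volPoly b q s t) t := by
  -- The substitution `u = t τ` recovers the usual primitive. The unit-interval form keeps the
  -- limits of integration fixed, so that `t` is a parameter like `q` and `s`.
  have h1 : invPrimitive b q s = fun t => ∫ u in (0 : ℝ)..t, 1 / volPoly b q s u := by
    funext t
    have h2 := intervalIntegral.smul_integral_comp_mul_left (a := 0) (b := 1)
      (fun u => 1 / volPoly b q s u) t
    rw [mul_zero, mul_one] at h2
    rw [← h2, invPrimitive, smul_eq_mul, ← intervalIntegral.integral_const_mul]
    simp only [mul_one_div]
  rw [h1]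
  have hc := continuous_volPoly b q s
  refine intervalIntegral.integral_hasDerivAt_right ?_ ?_ ?_
  · exact (continuousOn_const.div hc.continuousOn h).intervalIntegrable
  · exact (measurable_const.div hc.measurable).stronglyMeasurable.stronglyMeasurableAtFilter
  · exact continuousAt_const.div hc.continuousAt (h t right_mem_uIcc)

/-- The third parameter is `s = r²`, because `r` is a square root and need not be smooth where `A`
vanishes. The domain is open by compactness of `[0, 1]`, and its explicit description is what makes
membership checkable. -/
theorem contDiffOn_invPrimitive (b : ℝ) : ∃ U : Set (ℝ × ℝ × ℝ), IsOpen U ∧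
    (∀ p, p ∈ U ↔ ∀ τ ∈ Icc (0 : ℝ) 1, volPoly b p.2.1 p.2.2 (p.1 * τ) ≠ 0) ∧
    ContDiffOn ℝ ∞ (fun p : ℝ × ℝ × ℝ => invPrimitive b p.2.1 p.2.2 p.1) U := by
  have hF : ContDiff ℝ ∞ (fun z : (ℝ × ℝ × ℝ) × ℝ => volPoly b z.1.2.1 z.1.2.2 (z.1.1 * z.2)) := by
    unfold volPoly; fun_prop
  have hW : IsOpen {z : (ℝ × ℝ × ℝ) × ℝ | volPoly b z.1.2.1 z.1.2.2 (z.1.1 * z.2) ≠ 0} :=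
    isOpen_ne.preimage hF.continuous
  have hU : IsOpen {p : ℝ × ℝ × ℝ | ∀ τ ∈ Icc (0 : ℝ) 1,
      volPoly b p.2.1 p.2.2 (p.1 * τ) ≠ 0} := by
    refine isOpen_iff_eventually.2 fun p hp => ?_
    exact isCompact_Icc.eventually_forall_of_forall_eventually fun τ hτ =>
      hW.mem_nhds (hp τ hτ)
  refine ⟨_, hU, fun p => Iff.rfl, ?_⟩
  refine contDiffOn_integral_unit hW hU (fun p hp => hp)
    (h := fun z : (ℝ × ℝ × ℝ) × ℝ => z.1.1 / volPoly b z.1.2.1 z.1.2.2 (z.1.1 * z.2)) ?_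
  exact (contDiff_fst.comp contDiff_fst).contDiffOn.div hF.contDiffOn fun z hz => hz

end Factor
end GenCalabi

/-! ### The explicit curves are geodesics -/

open Set Filter Topology MeasureTheory
open scoped Manifold ContDiff
namespace GenCalabi

section
open scoped Matrix.Norms.Operator

variable {n : ℕ}
local notation "Mat" => Matrix (Fin n) (Fin n) ℝ
local notation "𝔼" n => EuclideanSpace ℝ (Fin n)

theorem hasDerivAt_exp_smul (B : Mat) (s : ℝ) :
    HasDerivAt (fun u : ℝ => NormedSpace.exp (u • B)) (NormedSpace.exp (s • B) * B) s :=
  hasDerivAt_exp_smul_const B s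

theorem det_exp_ne_zero (B : Mat) : (NormedSpace.exp B).det ≠ 0 :=
  isUnit_iff_ne_zero.1 ((Matrix.isUnit_iff_isUnit_det _).1 (Matrix.isUnit_exp B))

theorem det_exp_smul_eq_one {B : Mat} (hB : B.trace = 0) (s : ℝ) :
    (NormedSpace.exp (s • B)).det = 1 := by
  have h1 : ∀ t ∈ (univ : Set ℝ),
      HasDerivWithinAt (fun u : ℝ => (NormedSpace.exp (u • B)).det) 0 univ t := by
    intro t _
    refine (HasDerivWithinAt.matrix_det (hasDerivAt_exp_smul B t).hasDerivWithinAt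
      (det_exp_ne_zero _)).congr_deriv ?_
    rw [← mul_assoc, Matrix.nonsing_inv_mul _ (isUnit_iff_ne_zero.2 (det_exp_ne_zero _)), one_mul,
      hB, mul_zero]
  have h2 := eq_of_hasDerivWithinAt_zero convex_univ h1 (mem_univ 0) (mem_univ s)
  simpa using h2

/-- With `Y = (s / 2) G⁻¹ A` one has `G Y G⁻¹ = Yᵀ`, hence `G exp (2 Y) = (exp Y)ᵀ G exp Y`, a
congruence of `G` by an invertible matrix. -/
theorem posDef_mul_exp {G A : Mat} (hG : G.PosDef) (hA : A.transpose = A) (s : ℝ) :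
    (G * NormedSpace.exp (s • (G⁻¹ * A))).PosDef := by
  have hu : IsUnit G.det := isUnit_iff_ne_zero.2 hG.det_pos.ne'
  have hGT : G.transpose = G := by
    rw [← Matrix.conjTranspose_eq_transpose_of_trivial]; exact hG.isHermitian
  set Y : Mat := (s / 2) • (G⁻¹ * A) with hY
  have h1 : G * Y * G⁻¹ = Y.transpose := by
    rw [hY, Matrix.transpose_smul, Matrix.transpose_mul, Matrix.transpose_nonsing_inv, hA, hGT,
      Matrix.mul_smul, Matrix.smul_mul, ← mul_assoc, Matrix.mul_nonsing_inv _ hu, one_mul]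
  have h2 : (NormedSpace.exp Y).transpose * G = G * NormedSpace.exp Y := by
    rw [← Matrix.exp_transpose, ← h1, Matrix.exp_conj _ _ ((Matrix.isUnit_iff_isUnit_det G).2 hu),
      mul_assoc, Matrix.nonsing_inv_mul _ hu, mul_one]
  have h3 : NormedSpace.exp (s • (G⁻¹ * A)) = NormedSpace.exp Y * NormedSpace.exp Y := by
    rw [← Matrix.exp_add_of_commute _ _ (Commute.refl Y), hY, ← add_smul, add_halves]
  rw [h3, ← mul_assoc, ← h2, ← Matrix.conjTranspose_eq_transpose_of_trivial]
  exact hG.conjTranspose_mul_mul_same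
    (Matrix.mulVec_injective_iff_isUnit.2 (Matrix.isUnit_exp Y))

variable {M : Type*} [TopologicalSpace M] [ChartedSpace (𝔼 n) M]

theorem gram_tangentVector (g₀ : TensorField n M) (a : M → ℝ) (A : TensorField n M) (x : M) :
    gram (tangentVector g₀ a A) x = (2 / (n : ℝ) * a x) • gram g₀ x + gram A x := by
  ext i j; rfl

theorem endo_tangentVector {g₀ : TensorField n M} {x : M} (hd : (gram g₀ x).det ≠ 0) (a : M → ℝ)
    (A : TensorField n M) :
    endo g₀ (tangentVector g₀ a A) x = (2 / (n : ℝ) * a x) • (1 : Mat) + endo g₀ A x := by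
  rw [endo, gram_tangentVector, mul_add, Matrix.mul_smul,
    Matrix.nonsing_inv_mul _ (isUnit_iff_ne_zero.2 hd), endo]

theorem trace_scalar_add (hn : 0 < n) {B : Mat} (hB : B.trace = 0) (u : ℝ) :
    ((u / (n : ℝ)) • (1 : Mat) + B).trace = u := by
  have hn' : (n : ℝ) ≠ 0 := by exact_mod_cast hn.ne'
  rw [Matrix.trace_add, Matrix.trace_smul, hB, Matrix.trace_one, Fintype.card_fin, smul_eq_mul,
    add_zero, div_mul_cancel₀ _ hn']

theorem trace_sq_scalar_add (hn : 0 < n) {B : Mat} (hB : B.trace = 0) (u : ℝ) :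
    (((u / (n : ℝ)) • (1 : Mat) + B) * ((u / (n : ℝ)) • (1 : Mat) + B)).trace =
      u ^ 2 / n + (B * B).trace := by
  have hn' : (n : ℝ) ≠ 0 := by exact_mod_cast hn.ne'
  simp only [add_mul, mul_add, Matrix.smul_mul, Matrix.mul_smul, one_mul, mul_one,
    Matrix.trace_add, Matrix.trace_smul, hB, Matrix.trace_one, Fintype.card_fin, smul_eq_mul]
  field_simp
  ring

/-- The curve with volume factor `p`, exponential growth rate `τ` and angle `Ψ`. -/
noncomputable def expCurve (g₀ A : TensorField n M) (τ : ℝ) (p Ψ : ℝ → M → ℝ) (t : ℝ) :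
    TensorField n M :=
  ofGram fun x => (p t x ^ (2 / (n : ℝ)) * Real.exp (τ * t / n)) •
    (gram g₀ x * NormedSpace.exp (Ψ t x • ((gram g₀ x)⁻¹ * gram A x)))

theorem gram_expCurve (g₀ A : TensorField n M) (τ : ℝ) (p Ψ : ℝ → M → ℝ) (t : ℝ) (x : M) :
    gram (expCurve g₀ A τ p Ψ t) x = (p t x ^ (2 / (n : ℝ)) * Real.exp (τ * t / n)) •
      (gram g₀ x * NormedSpace.exp (Ψ t x • ((gram g₀ x)⁻¹ * gram A x))) := gram_ofGram _ _

/-- Taking determinants raises the scalar factor to the power `n`. The exponent `2 / n` makes the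
volume density scale by exactly `p exp (τ t / 2)`. -/
theorem conformal_factor_pow (hn : 0 < n) {p : ℝ} (hp : 0 < p) (τ t : ℝ) :
    (p ^ (2 / (n : ℝ)) * Real.exp (τ * t / n)) ^ n = (p * Real.exp (τ * t / 2)) ^ 2 := by
  have hn' : (n : ℝ) ≠ 0 := by exact_mod_cast hn.ne'
  rw [mul_pow, mul_pow, ← Real.rpow_natCast (p ^ (2 / (n : ℝ))), ← Real.rpow_mul hp.le,
    div_mul_cancel₀ _ hn', ← Real.exp_nat_mul, ← Real.exp_nat_mul]
  congr 1
  · norm_cast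
  · congr 1; push_cast; field_simp

theorem hasDerivWithinAt_conformal_factor (hn : 0 < n) {J : Set ℝ} {p : ℝ → ℝ} {dp τ t : ℝ}
    (hp : HasDerivWithinAt p dp J t) (hpos : 0 < p t) :
    HasDerivWithinAt (fun t => p t ^ (2 / (n : ℝ)) * Real.exp (τ * t / n))
      ((p t ^ (2 / (n : ℝ)) * Real.exp (τ * t / n)) * ((2 * dp / p t + τ) / n)) J t := by
  have hn' : (n : ℝ) ≠ 0 := by exact_mod_cast hn.ne'
  have h1 : HasDerivAt (fun t => Real.exp (τ * t / n)) (Real.exp (τ * t / n) * (τ * 1 / n)) t :=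
    (((hasDerivAt_id t).const_mul τ).div_const (n : ℝ)).exp
  refine ((hp.rpow_const (Or.inl hpos.ne')).mul h1.hasDerivWithinAt).congr_deriv ?_
  rw [Real.rpow_sub_one hpos.ne']
  field_simp

variable [IsManifold (𝓡 n) ∞ M]

omit [IsManifold (𝓡 n) ∞ M] in
theorem SmoothFun.rpow_const {J : Set ℝ} {f : ℝ → M → ℝ} (hf : SmoothFun (n := n) J f)
    (h : ∀ t ∈ J, ∀ x, 0 < f t x) (e : ℝ) : SmoothFun (n := n) J (fun t x => f t x ^ e) :=
  fun y => (hf y).rpow_const_of_ne fun _ hp => (h _ hp.1 _).ne'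

theorem smoothTensor_expCurve {J : Set ℝ} {g₀ A : TensorField n M} (hg₀ : IsMetric g₀)
    (hA : IsSmoothSym A) (τ : ℝ) {p Ψ : ℝ → M → ℝ} (hp : SmoothFun (n := n) J p)
    (hpos : ∀ t ∈ J, ∀ x, 0 < p t x) (hΨ : SmoothFun (n := n) J Ψ) :
    SmoothTensor J (expCurve g₀ A τ p Ψ) := by
  have h1 := (hg₀.smoothTensor.const_curve J).mul_exp (hA.smoothTensor.const_curve J) hΨ
    fun _ _ x => (hg₀.det_pos x).ne'
  have h2 : SmoothFun (n := n) (M := M) J (fun t _ => Real.exp (τ * t / n)) :=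
    SmoothFun.time (by fun_prop)
  refine (SmoothTensor.smul ((hp.rpow_const hpos (2 / (n : ℝ))).mul h2) h1).congr
    fun t _ x => ?_
  rw [gram_expCurve, gram_fun_smul_apply, gram_ofGram]

omit [IsManifold (𝓡 n) ∞ M] in
theorem det_expCurve (hn : 0 < n) {g₀ A : TensorField n M} {τ : ℝ} {p Ψ : ℝ → M → ℝ} {t : ℝ}
    {x : M} (hpos : 0 < p t x) (hAtr : ((gram g₀ x)⁻¹ * gram A x).trace = 0) :
    (gram (expCurve g₀ A τ p Ψ t) x).det =
      (p t x * Real.exp (τ * t / 2)) ^ 2 * (gram g₀ x).det := by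
  rw [gram_expCurve, Matrix.det_smul, Matrix.det_mul, det_exp_smul_eq_one hAtr, Fintype.card_fin,
    conformal_factor_pow hn hpos, mul_one]

omit [IsManifold (𝓡 n) ∞ M] in
theorem volRatio_expCurve (hn : 0 < n) {g₀ A : TensorField n M} {τ : ℝ} {p Ψ : ℝ → M → ℝ} {t : ℝ}
    {x : M} (hd : (gram g₀ x).det ≠ 0) (hpos : 0 < p t x)
    (hAtr : ((gram g₀ x)⁻¹ * gram A x).trace = 0) :
    volRatio g₀ (expCurve g₀ A τ p Ψ t) x = p t x * Real.exp (τ * t / 2) := by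
  rw [volRatio, det_expCurve hn hpos hAtr, mul_div_cancel_right₀ _ hd, Real.sqrt_sq (by positivity)]

theorem isMetric_expCurve {J : Set ℝ} {g₀ A : TensorField n M} (hg₀ : IsMetric g₀)
    (hA : IsSmoothSym A) {τ : ℝ} {p Ψ : ℝ → M → ℝ} (hp : SmoothFun (n := n) J p)
    (hpos : ∀ t ∈ J, ∀ x, 0 < p t x) (hΨ : SmoothFun (n := n) J Ψ) {t : ℝ} (ht : t ∈ J) :
    IsMetric (expCurve g₀ A τ p Ψ t) := by
  refine isMetric_iff_gram.2 ⟨fun x => ?_, (smoothTensor_expCurve hg₀ hA τ hp hpos hΨ).slice ht⟩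
  rw [gram_expCurve]
  exact (posDef_mul_exp (hg₀.posDef x) (hA.gram_symm x) _).smul
    (mul_pos (Real.rpow_pos_of_pos (hpos t ht x) _) (Real.exp_pos _))

omit [IsManifold (𝓡 n) ∞ M] in
-- Computes `H = g⁻¹ g'`. Taking `Ψ' = 1 / p` makes its traceless part equal to `g₀⁻¹ A / p`, as the
-- conservation law demands.
theorem hasDerivWithinAt_gram_expCurve (hn : 0 < n) {J : Set ℝ} {g₀ A : TensorField n M} {τ : ℝ}
    {p Ψ : ℝ → M → ℝ} {dp t : ℝ} {x : M} (hp : HasDerivWithinAt (fun t => p t x) dp J t)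
    (hpos : 0 < p t x) (hΨ : HasDerivWithinAt (fun t => Ψ t x) (1 / p t x) J t) :
    HasDerivWithinAt (fun t => gram (expCurve g₀ A τ p Ψ t) x)
      (gram (expCurve g₀ A τ p Ψ t) x *
        (((2 * dp / p t x + τ) / n) • (1 : Mat) + (1 / p t x) • endo g₀ A x)) J t := by
  have h1 := (hasDerivAt_exp_smul ((gram g₀ x)⁻¹ * gram A x)
    (Ψ t x)).scomp_hasDerivWithinAt t hΨ
  have h2 := (hasDerivWithinAt_conformal_factor (τ := τ) hn hp hpos).smul
    (h1.const_mul (gram g₀ x))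
  have h3 : (fun t => gram (expCurve g₀ A τ p Ψ t) x) = fun t =>
      (p t x ^ (2 / (n : ℝ)) * Real.exp (τ * t / n)) •
      (gram g₀ x * NormedSpace.exp (Ψ t x • ((gram g₀ x)⁻¹ * gram A x))) :=
    funext fun t => gram_expCurve _ _ _ _ _ _ _
  rw [h3]
  refine h2.congr_deriv ?_
  rw [gram_expCurve]
  simp only [Function.comp, Matrix.smul_mul, Matrix.mul_smul, mul_add, mul_one,
    smul_smul, mul_assoc, endo]
  module

variable [CompactSpace M] [Nonempty M] [MeasurableSpace M] [BorelSpace M] [T2Space M]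

/-- Existence of geodesics with given volume factor. -/
theorem isGeodesicFrom_expCurve (hn : 0 < n) {J : Set ℝ} (hJ : UniqueDiffOn ℝ J) (h0 : 0 ∈ J)
    {g₀ A : TensorField n M} (hg₀ : IsMetric g₀) (hA : IsSmoothSym A)
    (hAtr : ∀ x, ((gram g₀ x)⁻¹ * gram A x).trace = 0) {τ ε b : ℝ}
    (hb : 4 * b ^ 2 = n * ε - τ ^ 2) {q r : M → ℝ}
    (hr : ∀ x, 4 * r x ^ 2 = n * traceProd g₀ A A x) {p dp Ψ : ℝ → M → ℝ}
    (hpS : SmoothFun (n := n) J p) (hΨS : SmoothFun (n := n) J Ψ)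
    (hpos : ∀ t ∈ J, ∀ x, 0 < p t x)
    (hp : ∀ t ∈ J, ∀ x, HasDerivWithinAt (fun t => p t x) (dp t x) J t)
    (hdp : ∀ t ∈ J, ∀ x, HasDerivWithinAt (fun t => dp t x)
      ((q x ^ 2 + b ^ 2 + r x ^ 2) / 2 - b ^ 2 * p t x) J t)
    (hΨ : ∀ t ∈ J, ∀ x, HasDerivWithinAt (fun t => Ψ t x) (1 / p t x) J t)
    (hfi : ∀ t ∈ J, ∀ x, dp t x ^ 2 + b ^ 2 * p t x ^ 2 + r x ^ 2 =
      (q x ^ 2 + b ^ 2 + r x ^ 2) * p t x)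
    (hp0 : ∀ x, p 0 x = 1) (hdp0 : ∀ x, dp 0 x = q x) (hΨ0 : ∀ x, Ψ 0 x = 0)
    (hqrc : Continuous fun x => q x ^ 2 + r x ^ 2)
    (ip : ∀ t ∈ J, ∫ x, p t x ∂(vol g₀) = totalVol g₀)
    (idp : ∀ t ∈ J, ∫ x, dp t x ∂(vol g₀) = 0)
    (iqr : ∫ x, (q x ^ 2 + r x ^ 2) ∂(vol g₀) = b ^ 2 * totalVol g₀) :
    IsGeodesicFrom g₀ (tangentVector g₀ (fun x => q x + τ / 2) A) J (expCurve g₀ A τ p Ψ) := by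
  have hn' : (n : ℝ) ≠ 0 := by exact_mod_cast hn.ne'
  have := hg₀.isFiniteMeasure
  set c := expCurve g₀ A τ p Ψ with hcdef
  have hsm : SmoothTensor J c := smoothTensor_expCurve hg₀ hA τ hpS hpos hΨS
  have hm : ∀ t ∈ J, IsMetric (c t) := fun t ht => isMetric_expCurve hg₀ hA hpS hpos hΨS ht
  have hdet : ∀ t ∈ J, ∀ x, (gram (c t) x).det ≠ 0 := fun t ht x => ((hm t ht).det_pos x).ne'
  set H : ℝ → M → Mat := fun t x =>
    ((2 * dp t x / p t x + τ) / n) • (1 : Mat) + (1 / p t x) • endo g₀ A x with hH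
  have hv : ∀ t ∈ J, ∀ x, gram (velocity J c t) x = gram (c t) x * H t x := fun t ht x =>
    (hJ t ht).eq_deriv _ (hsm.hasDerivWithinAt_gram ht x)
      (hasDerivWithinAt_gram_expCurve hn (hp t ht x) (hpos t ht x) (hΨ t ht x))
  have hendo : ∀ t ∈ J, ∀ x, endo (c t) (velocity J c t) x = H t x := by
    intro t ht x
    rw [endo, hv t ht, ← mul_assoc, Matrix.nonsing_inv_mul _ (isUnit_iff_ne_zero.2 (hdet t ht x)),
      one_mul]
  have hBtr : ∀ t x, ((1 / p t x) • endo g₀ A x).trace = 0 := fun t x => by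
    rw [Matrix.trace_smul, endo, hAtr x, smul_zero]
  have htr : ∀ t x, (H t x).trace = 2 * dp t x / p t x + τ := fun t x =>
    trace_scalar_add hn (hBtr t x) _
  have htr2 : ∀ t ∈ J, ∀ x, (H t x * H t x).trace =
      (2 * dp t x / p t x + τ) ^ 2 / n + 4 * r x ^ 2 / (n * p t x ^ 2) := by
    intro t ht x
    have hp' := (hpos t ht x).ne'
    refine (trace_sq_scalar_add hn (hBtr t x) _).trans ?_
    rw [Matrix.smul_mul, Matrix.mul_smul, Matrix.trace_smul, Matrix.trace_smul,
      ← traceProd_eq_endo, hr x, smul_eq_mul, smul_eq_mul]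
    field_simp
  have hvol : ∀ t ∈ J, ∀ x, volRatio g₀ (c t) x = p t x * Real.exp (τ * t / 2) := fun t ht x =>
    volRatio_expCurve hn (hg₀.det_pos x).ne' (hpos t ht x) (hAtr x)
  have hV := hg₀.totalVol_pos
  have hVt : ∀ t ∈ J, totalVol (c t) = totalVol g₀ * Real.exp (τ * t / 2) := by
    intro t ht
    rw [totalVol_eq_integral hg₀ (hsm.slice ht)]
    simp only [hvol t ht]
    rw [integral_mul_const, ip t ht]
  have hdpS : SmoothFun (n := n) J dp := (hpS.derivWithin hJ).congr fun t ht x =>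
    ((hp t ht x).derivWithin (hJ t ht)).symm
  have hpi : ∀ t ∈ J, Integrable (fun x => p t x) (vol g₀) := fun t ht => hpS.integrable _ ht
  have hdpi : ∀ t ∈ J, Integrable (fun x => dp t x) (vol g₀) := fun t ht => hdpS.integrable _ ht
  have hqri : Integrable (fun x => q x ^ 2 + r x ^ 2) (vol g₀) :=
    hqrc.integrable_of_hasCompactSupport (HasCompactSupport.of_compactSpace _)
  -- Consistency of the nonlocal equation: the average of `tr H` must return the constant `τ` built
  -- into the curve. This uses `∫ p = V` and `∫ p' = 0`.
  have hτ : ∀ t ∈ J, gN (c t) (c t) (velocity J c t) = τ := by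
    intro t ht
    have h1 : ∀ x, traceProd (c t) (c t) (velocity J c t) x * volRatio g₀ (c t) x =
        Real.exp (τ * t / 2) * (2 * dp t x + τ * p t x) := by
      intro x
      have hp' := (hpos t ht x).ne'
      rw [traceProd_self_left (hdet t ht x), hendo t ht, htr, hvol t ht]
      field_simp
    rw [gN, ebin, integral_vol hg₀ (hsm.slice ht), hVt t ht]
    simp only [h1]
    rw [integral_const_mul, integral_add ((hdpi t ht).const_mul _) ((hpi t ht).const_mul _),
      integral_const_mul, integral_const_mul, ip t ht, idp t ht]
    field_simp
    ring
  have hε : ∀ t ∈ J, gN (c t) (velocity J c t) (velocity J c t) = ε := by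
    intro t ht
    have h1 : ∀ x, traceProd (c t) (velocity J c t) (velocity J c t) x * volRatio g₀ (c t) x =
        Real.exp (τ * t / 2) / n * (4 * (q x ^ 2 + r x ^ 2) + (4 * b ^ 2 +
          (4 * τ * dp t x + (τ ^ 2 - 4 * b ^ 2) * p t x))) := by
      intro x
      have hp' := (hpos t ht x).ne'
      rw [traceProd_eq_endo, hendo t ht, htr2 t ht, hvol t ht]
      -- The first integral removes `r² / p`, so the energy density becomes affine in `p`, `p'` and
      -- `q² + r²`, all with known integrals.
      have h2 : r x ^ 2 = (q x ^ 2 + b ^ 2 + r x ^ 2) * p t x - dp t x ^ 2 - b ^ 2 * p t x ^ 2 := by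
        linarith [hfi t ht x]
      have h3 : 4 * r x ^ 2 / (n * p t x ^ 2) = 4 * ((q x ^ 2 + b ^ 2 + r x ^ 2) * p t x -
          dp t x ^ 2 - b ^ 2 * p t x ^ 2) / (n * p t x ^ 2) := by rw [← h2]
      rw [h3]
      field_simp
      ring
    rw [gN, ebin, integral_vol hg₀ (hsm.slice ht), hVt t ht]
    simp only [h1]
    have i1 : Integrable (fun x => 4 * τ * dp t x + (τ ^ 2 - 4 * b ^ 2) * p t x) (vol g₀) :=
      ((hdpi t ht).const_mul _).add ((hpi t ht).const_mul _)
    have i2 : Integrable (fun x => 4 * b ^ 2 + (4 * τ * dp t x + (τ ^ 2 - 4 * b ^ 2) * p t x))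
      (vol g₀) := (integrable_const _).add i1
    rw [integral_const_mul, integral_add (hqri.const_mul _) i2,
      integral_add (integrable_const _) i1,
      integral_add ((hdpi t ht).const_mul _) ((hpi t ht).const_mul _),
      integral_const, integral_const_mul, integral_const_mul, integral_const_mul, ip t ht, idp t ht,
      iqr, smul_eq_mul, show (vol g₀).real univ = totalVol g₀ from rfl]
    have h4 : ε = (4 * b ^ 2 + τ ^ 2) / n := by rw [hb]; field_simp; ring
    rw [h4]
    field_simp
    ring
  refine ⟨⟨hm, isSmoothCurveOn_iff.2 hsm, (geodesicOn_iff hJ hm hsm).2 fun t ht x => ?_⟩, ?_, ?_⟩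
  · have hp' := (hpos t ht x).ne'
    rw [hτ t ht, hε t ht, hendo t ht x, htr, htr2 t ht]
    have h1 : HasDerivWithinAt (fun s => H s x) _ J t :=
      ((((((hdp t ht x).const_mul 2).div (hp t ht x) hp').add_const τ).div_const
        (n : ℝ)).smul_const (1 : Mat)).add
          (((hasDerivWithinAt_const t J (1 : ℝ)).div (hp t ht x) hp').smul_const (endo g₀ A x))
    refine (h1.congr (fun s hs => hendo s hs x) (hendo t ht x)).congr_deriv ?_
    simp only [hH, smul_add, smul_smul]
    -- The coefficients of the identity and of `g₀⁻¹ A` in the equation for `H` are compared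
    -- separately: the first by the first integral, the second by differentiating `1 / p`.
    have h2 : (2 * ((q x ^ 2 + b ^ 2 + r x ^ 2) / 2 - b ^ 2 * p t x) * p t x -
        2 * dp t x * dp t x) / p t x ^ 2 / n =
        -(1 / 2) * (2 * dp t x / p t x + τ - τ) * ((2 * dp t x / p t x + τ) / n) +
        1 / 4 * ((2 * dp t x / p t x + τ) ^ 2 / n + 4 * r x ^ 2 / (n * p t x ^ 2) - ε) := by
      have h4 : ε = (4 * b ^ 2 + τ ^ 2) / n := by rw [hb]; field_simp; ring
      have h5 : r x ^ 2 + dp t x ^ 2 + b ^ 2 * p t x ^ 2 =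
        (q x ^ 2 + b ^ 2 + r x ^ 2) * p t x := by linarith [hfi t ht x]
      rw [h4]
      field_simp
      linear_combination (-8) * h5
    have h3 : (0 * p t x - 1 * dp t x) / p t x ^ 2 =
        -(1 / 2) * (2 * dp t x / p t x + τ - τ) * (1 / p t x) := by
      field_simp
      ring
    rw [h2, h3]
    module
  · refine funext fun x => tensorField_ext ?_
    rw [hcdef, gram_expCurve, hp0, hΨ0]
    simp
  · refine funext fun x => tensorField_ext ?_
    have hc0 : gram (c 0) x = gram g₀ x := by
      rw [hcdef, gram_expCurve, hp0, hΨ0]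
      simp
    rw [hv 0 h0, gram_tangentVector, hc0, hH]
    simp only [hp0, hdp0, mul_add, Matrix.mul_smul, mul_one, div_one, one_smul, endo]
    rw [← mul_assoc, Matrix.mul_nonsing_inv _ (isUnit_iff_ne_zero.2 (hg₀.det_pos x).ne'), one_mul]
    congr 2
    ring

end
end GenCalabi

/-! ### Maximality criterion and initial data -/

open Set Filter Topology MeasureTheory
open scoped Manifold ContDiff
namespace GenCalabi

section
open scoped Matrix.Norms.Operator

variable {n : ℕ}
local notation "Mat" => Matrix (Fin n) (Fin n) ℝ
local notation "𝔼" n => EuclideanSpace ℝ (Fin n)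

theorem uniqueDiffOn_of_ordConnected {J : Set ℝ} (hJ : J.OrdConnected) (hJ' : J.Nontrivial) :
    UniqueDiffOn ℝ J := by
  obtain ⟨a, ha, b, hb, hab⟩ := hJ'.exists_lt
  refine uniqueDiffOn_convex hJ.convex ((nonempty_Ioo.2 hab).mono ?_)
  exact interior_maximal (Ioo_subset_Icc_self.trans (hJ.out ha hb)) isOpen_Ioo

theorem ordConnected_domain (T : EReal) : (domain T).OrdConnected :=
  ⟨fun _ hx _ hy _ hz => ⟨hx.1.trans hz.1, (EReal.coe_le_coe_iff.2 hz.2).trans_lt hy.2⟩⟩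

theorem zero_mem_domain {T : EReal} (hT : 0 < T) : (0 : ℝ) ∈ domain T := ⟨le_rfl, hT⟩

theorem nontrivial_domain {T : EReal} (hT : 0 < T) : (domain T).Nontrivial := by
  obtain ⟨s, hs0, hsT⟩ := EReal.lt_iff_exists_real_btwn.1 hT
  have hs : (0 : ℝ) < s := by exact_mod_cast hs0
  exact ⟨0, zero_mem_domain hT, s, ⟨hs.le, hsT⟩, hs.ne⟩

theorem uniqueDiffOn_domain {T : EReal} (hT : 0 < T) : UniqueDiffOn ℝ (domain T) :=
  uniqueDiffOn_of_ordConnected (ordConnected_domain T) (nontrivial_domain hT)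

variable {M : Type*} [TopologicalSpace M] [ChartedSpace (𝔼 n) M] [IsManifold (𝓡 n) ∞ M]
  [CompactSpace M] [Nonempty M] [MeasurableSpace M] [BorelSpace M] [T2Space M]

/-- A geodesic on `[0, T)` is maximal if the volume factor which is determined by its initial data
vanishes somewhere before any later time. -/
theorem isMaximalGeodesic_of_volume {g₀ v : TensorField n M} {T : EReal} (hn : 0 < n)
    (hT : 0 < T) {c : ℝ → TensorField n M} (hc : IsGeodesicFrom g₀ v (domain T) c) {b : ℝ}
    (hb : 4 * b ^ 2 = n * gN g₀ v v - gN g₀ g₀ v ^ 2) {q r : M → ℝ}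
    (hq : ∀ x, 2 * q x = (endo g₀ v x).trace - gN g₀ g₀ v)
    (hr : ∀ x, 4 * r x ^ 2 = n * (endo g₀ v x * endo g₀ v x).trace - (endo g₀ v x).trace ^ 2)
    {p dp : M → ℝ → ℝ} (hp : ∀ x t, HasDerivAt (p x) (dp x t) t)
    (hdp : ∀ x t, HasDerivAt (dp x) ((q x ^ 2 + b ^ 2 + r x ^ 2) / 2 - b ^ 2 * p x t) t)
    (hp0 : ∀ x, p x 0 = 1) (hdp0 : ∀ x, dp x 0 = q x)
    (hexit : ∀ t, 0 ≤ t → t ∉ domain T → ∃ s ∈ Icc 0 t, ∃ x, p x s ≤ 0) :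
    IsMaximalGeodesic g₀ v T c := by
  refine ⟨hT, hc, fun J γ hJo hJn h0 hJ0 hγ => ?_⟩
  have hJu := uniqueDiffOn_of_ordConnected hJo hJn
  have hsol := fun x => hγ.solvesAt hJo.convex hJu h0 x
  have hH0 : ∀ x, endo (γ 0) (velocity J γ 0) x = endo g₀ v x := fun x => by
    rw [hγ.init, hγ.init_velocity]
  have hsub : J ⊆ domain T := by
    intro t ht
    by_contra hcon
    -- A geodesic defined at `t` is also defined at the earlier `s`. There its normalised volume
    -- ratio is positive, yet it equals the prescribed `p x s ≤ 0`.
    obtain ⟨s, hs, x, hsx⟩ := hexit t (hJ0 ht) hcon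
    have hsJ : s ∈ J := hJo.out h0 ht hs
    have h1 := (hsol x).volume_eq hJo.convex h0 (b := b) (q := q x) (r := r x) hb
      (by simp only [hH0, hq]) (by simp only [hH0, hr])
      (fun t _ => (hp x t).hasDerivWithinAt) (fun t _ => (hdp x t).hasDerivWithinAt) (hp0 x)
      (hdp0 x) hsJ
    have h2 : 0 < Real.sqrt ((gram (γ s) x).det / (gram (γ 0) x).det) *
        Real.exp (-(gN g₀ g₀ v * s / 2)) :=
      mul_pos (Real.sqrt_pos.2 (div_pos ((hsol x).det_pos s hsJ) ((hsol x).det_pos 0 h0)))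
        (Real.exp_pos _)
    rw [h1.1] at h2
    exact absurd h2 hsx.not_gt
  refine ⟨hsub, fun t ht => funext fun x => tensorField_ext ?_⟩
  have hsol' := (hc.solvesAt (ordConnected_domain T).convex (uniqueDiffOn_domain hT)
    (zero_mem_domain hT) x).mono hsub
  refine (hsol x).unique hJo.convex h0 (b := b) (q := q x) (r := r x) hsol' hn hb
    (by simp only [hH0, hq]) (by simp only [hH0, hr])
    (fun t _ => (hp x t).hasDerivWithinAt) (fun t _ => (hdp x t).hasDerivWithinAt) (hp0 x)
    (hdp0 x) ?_ ?_ ht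
  · simp only [hγ.init, hc.init]
  · simp only [hγ.init, hc.init, hγ.init_velocity, hc.init_velocity]

omit [CompactSpace M] [Nonempty M] [MeasurableSpace M] [BorelSpace M] [T2Space M] in
theorem smoothFun_of_contMDiff {a : M → ℝ} (ha : ContMDiff (𝓡 n) 𝓘(ℝ, ℝ) ∞ a) :
    SmoothFun (n := n) univ (fun _ => a) :=
  smoothFun_iff.2 (ha.comp contMDiff_snd).contMDiffOn

omit [CompactSpace M] [Nonempty M] [MeasurableSpace M] [BorelSpace M] [T2Space M] in
theorem traceProd_nonneg {g A : TensorField n M} (hg : IsMetric g) (hA : IsSmoothSym A) (x : M) :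
    0 ≤ traceProd g A A x := trace_sq_nonneg (hg.posDef x) (hA.gram_symm x)

omit [CompactSpace M] [Nonempty M] [MeasurableSpace M] [BorelSpace M] [T2Space M] in
theorem traceProd_eq_zero_iff {g A : TensorField n M} (hg : IsMetric g) (hA : IsSmoothSym A)
    (x : M) : traceProd g A A x = 0 ↔ A x = 0 := by
  have h0 : gram (0 : TensorField n M) x = 0 := by ext i j; rfl
  constructor
  · intro h
    have h1 := eq_zero_of_trace_sq_eq_zero (hg.posDef x) (hA.gram_symm x) h
    exact tensorField_ext (h := A) (k := 0) (h1.trans h0.symm)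
  · intro h
    have h1 : gram A x = 0 := by
      rw [← h0]
      ext i j
      rw [gram, gram, Matrix.of_apply, Matrix.of_apply, h]
      rfl
    rw [traceProd, h1]
    simp

omit [BorelSpace M] [T2Space M] in
theorem gN_self_tangentVector (hn : 0 < n) {g₀ A : TensorField n M} (hg₀ : IsMetric g₀)
    (hAtr : ∀ x, ((gram g₀ x)⁻¹ * gram A x).trace = 0) (a : M → ℝ) :
    gN g₀ g₀ (tangentVector g₀ a A) = 2 / totalVol g₀ * ∫ x, a x ∂(vol g₀) := by
  have h1 : ∀ x, traceProd g₀ g₀ (tangentVector g₀ a A) x = 2 * a x := fun x => by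
    rw [traceProd_self_left (hg₀.det_pos x).ne', endo_tangentVector (hg₀.det_pos x).ne',
      div_mul_eq_mul_div, trace_scalar_add hn (B := endo g₀ A x) (hAtr x)]
  rw [gN, ebin]
  simp only [h1]
  rw [integral_const_mul]
  ring

omit [CompactSpace M] [Nonempty M] [MeasurableSpace M] [BorelSpace M] [T2Space M] in
theorem traceProd_tangentVector (hn : 0 < n) {g₀ A : TensorField n M} (hg₀ : IsMetric g₀)
    (hAtr : ∀ x, ((gram g₀ x)⁻¹ * gram A x).trace = 0) (a : M → ℝ) (x : M) :
    traceProd g₀ (tangentVector g₀ a A) (tangentVector g₀ a A) x =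
      (2 * a x) ^ 2 / n + traceProd g₀ A A x := by
  rw [traceProd_eq_endo, endo_tangentVector (hg₀.det_pos x).ne', div_mul_eq_mul_div,
    trace_sq_scalar_add hn (B := endo g₀ A x) (hAtr x), ← traceProd_eq_endo]

/-- The initial data of the geodesic emanating from `g₀`. -/
theorem initial_data (hn : 0 < n) {g₀ A : TensorField n M} (hg₀ : IsMetric g₀)
    {a : M → ℝ} (ha : ContMDiff (𝓡 n) 𝓘(ℝ, ℝ) ∞ a) (hA : IsSmoothSym A)
    (hAtr : ∀ x, ((gram g₀ x)⁻¹ * gram A x).trace = 0) {σ a₀ b₀ : ℝ} {q r : M → ℝ}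
    (hσ : σ = Real.sqrt (gN g₀ (tangentVector g₀ a A) (tangentVector g₀ a A)))
    (ha₀ : a₀ = 2 / totalVol g₀ * ∫ x, a x ∂(vol g₀))
    (hb₀ : b₀ = Real.sqrt ((n * σ ^ 2 - a₀ ^ 2) / 4))
    (hq : ∀ x, q x = a x - a₀ / 2)
    (hr : ∀ x, r x = Real.sqrt (n / 4 * traceProd g₀ A A x)) :
    σ ^ 2 = gN g₀ (tangentVector g₀ a A) (tangentVector g₀ a A) ∧
    4 * b₀ ^ 2 = n * σ ^ 2 - a₀ ^ 2 ∧ (∀ x, 4 * r x ^ 2 = n * traceProd g₀ A A x) ∧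
    ∫ x, q x ∂(vol g₀) = 0 ∧ ∫ x, (q x ^ 2 + r x ^ 2) ∂(vol g₀) = b₀ ^ 2 * totalVol g₀ ∧
    SmoothFun (n := n) univ (fun _ => q) ∧ SmoothFun (n := n) univ (fun _ x => r x ^ 2) := by
  have hnp : (0 : ℝ) < n := by exact_mod_cast hn
  have := hg₀.isFiniteMeasure
  have hV := hg₀.totalVol_pos
  have hr2 : ∀ x, r x ^ 2 = n / 4 * traceProd g₀ A A x := fun x => by
    rw [hr, Real.sq_sqrt (mul_nonneg (by positivity) (traceProd_nonneg hg₀ hA x))]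
  have haS := smoothFun_of_contMDiff ha
  have hqS : SmoothFun (n := n) univ (fun _ => q) :=
    (haS.sub (SmoothFun.const (a₀ / 2))).congr fun _ _ x => hq x
  have htS := hg₀.smoothTensor.traceProd hA.smoothTensor hA.smoothTensor
    fun _ _ x => (hg₀.det_pos x).ne'
  have hrS : SmoothFun (n := n) univ (fun _ x => r x ^ 2) :=
    ((SmoothFun.const (n / 4)).mul htS).congr fun _ _ x => hr2 x
  have ia : Integrable a (vol g₀) := haS.integrable _ (mem_univ 0)
  have ia2 : Integrable (fun x => a x ^ 2) (vol g₀) := by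
    simpa only [pow_two] using! (haS.mul haS).integrable (vol g₀) (mem_univ 0)
  have ir : Integrable (fun x => r x ^ 2) (vol g₀) := hrS.integrable _ (mem_univ 0)
  have hVr : (vol g₀).real univ = totalVol g₀ := rfl
  have hnn : ∀ x, 0 ≤ traceProd g₀ (tangentVector g₀ a A) (tangentVector g₀ a A) x := fun x => by
    rw [traceProd_tangentVector hn hg₀ hAtr]
    have := traceProd_nonneg hg₀ hA x
    positivity
  have hσ2 : σ ^ 2 = gN g₀ (tangentVector g₀ a A) (tangentVector g₀ a A) := by
    rw [hσ, Real.sq_sqrt]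
    exact div_nonneg (integral_nonneg hnn) hV.le
  have iA : ∫ x, a x ∂(vol g₀) = a₀ / 2 * totalVol g₀ := by rw [ha₀]; field_simp
  have iq : ∫ x, q x ∂(vol g₀) = 0 := by
    simp only [hq]
    rw [integral_sub ia (integrable_const _), integral_const, smul_eq_mul, hVr, iA]
    ring
  -- The traceless splitting makes the norm of the velocity a sum of squares, and `q` is the
  -- deviation of `a` from its mean; so this is a variance identity. It also shows the radicand in
  -- `b₀` to be nonnegative.
  have iqr : 4 * ∫ x, (q x ^ 2 + r x ^ 2) ∂(vol g₀) =
      (n * σ ^ 2 - a₀ ^ 2) * totalVol g₀ := by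
    have h1 : n * σ ^ 2 * totalVol g₀ =
        4 * (∫ x, a x ^ 2 ∂(vol g₀)) + 4 * ∫ x, r x ^ 2 ∂(vol g₀) := by
      rw [hσ2, gN, mul_assoc, div_mul_cancel₀ _ hV.ne', ebin, ← integral_const_mul,
        ← integral_const_mul, ← integral_const_mul, ← integral_add (ia2.const_mul 4)
          (ir.const_mul 4)]
      refine integral_congr_ae (Eventually.of_forall fun x => ?_)
      simp only [traceProd_tangentVector hn hg₀ hAtr, hr2]
      field_simp
      ring
    have h2 : ∀ x, q x ^ 2 + r x ^ 2 = a x ^ 2 + (r x ^ 2 + (a₀ ^ 2 / 4 - a₀ * a x)) := fun x => by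
      rw [hq]; ring
    simp only [h2]
    have i1 : Integrable (fun x => a₀ ^ 2 / 4 - a₀ * a x) (vol g₀) :=
      (integrable_const _).sub (ia.const_mul _)
    have i2 : Integrable (fun x => r x ^ 2 + (a₀ ^ 2 / 4 - a₀ * a x)) (vol g₀) := ir.add i1
    rw [integral_add ia2 i2, integral_add ir i1, integral_sub (integrable_const _)
      (ia.const_mul _), integral_const, integral_const_mul, iA, smul_eq_mul, hVr, sub_mul, h1]
    ring
  have hnonneg : 0 ≤ n * σ ^ 2 - a₀ ^ 2 := by
    have h1 : 0 ≤ (n * σ ^ 2 - a₀ ^ 2) * totalVol g₀ := by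
      rw [← iqr]
      exact mul_nonneg (by norm_num) (integral_nonneg fun x => by positivity)
    exact nonneg_of_mul_nonneg_left h1 hV
  have hb2 : 4 * b₀ ^ 2 = n * σ ^ 2 - a₀ ^ 2 := by
    rw [hb₀, Real.sq_sqrt (by linarith)]; ring
  refine ⟨hσ2, hb2, fun x => by rw [hr2]; ring, iq, ?_, hqS, hrS⟩
  rw [← hb2] at iqr
  linarith

end
end GenCalabi

/-! ### Maximal geodesics in the oscillating and homothetic cases -/

open Set Filter Topology MeasureTheory
open scoped Manifold ContDiff
namespace GenCalabi

theorem contDiff_volPoly (b : ℝ) :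
    ContDiff ℝ ∞ (fun z : ℝ × ℝ × ℝ => volPoly b z.2.1 z.2.2 z.1) := by
  unfold volPoly; fun_prop

section
open scoped Matrix.Norms.Operator

variable {n : ℕ}
local notation "Mat" => Matrix (Fin n) (Fin n) ℝ
local notation "𝔼" n => EuclideanSpace ℝ (Fin n)

variable {M : Type*} [TopologicalSpace M] [ChartedSpace (𝔼 n) M]

omit [ChartedSpace (𝔼 n) M] in
theorem isCompact_setOf_eq_zero [CompactSpace M] {r : M → ℝ} (hr : Continuous fun x => r x ^ 2) :
    IsCompact {x | r x = 0} := by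
  have h : {x | r x = 0} = {x | r x ^ 2 = 0} := by
    ext x; simp
  rw [h]
  exact (isClosed_eq hr continuous_const).isCompact

theorem continuous_theta {b : ℝ} (hb : 0 < b) : Continuous (theta b) := by
  have h : theta b = fun q => Real.pi + 2 * Real.arctan (q / b) := funext fun q => theta_eq hb q
  rw [h]
  exact continuous_const.add (continuous_const.mul (Real.continuous_arctan.comp (by fun_prop)))

omit [ChartedSpace (𝔼 n) M] in
/-- The maximal time of existence is attained. -/
theorem exists_eq_iInf_theta [CompactSpace M] {P : M → Prop} {b : ℝ} {q r : M → ℝ}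
    (hb : 0 < b) (hq : Continuous q) (hr : Continuous fun x => r x ^ 2)
    (hP : ∀ x, P x ↔ r x = 0)
    (h : (⨅ (x : M) (_ : P x), ((theta b (q x) / b : ℝ) : EReal)) ≠ ⊤) :
    ∃ x, r x = 0 ∧
      (⨅ (x : M) (_ : P x), ((theta b (q x) / b : ℝ) : EReal)) = (theta b (q x) / b : ℝ) := by
  have hne : {x | r x = 0}.Nonempty := by
    by_contra hcon
    refine h (iInf₂_eq_top.2 fun x hx => ?_)
    exact absurd ⟨x, (hP x).1 hx⟩ hcon
  -- The set `r = 0` is closed in a compact space and `θ` is continuous in `q`. The empty set has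
  -- already been excluded, since its infimum is `⊤`.
  obtain ⟨x, hx, hmin⟩ := (isCompact_setOf_eq_zero hr).exists_isMinOn hne
    (f := fun x => theta b (q x) / b)
    (((continuous_theta hb).comp hq).div_const b).continuousOn
  refine ⟨x, hx, le_antisymm (iInf₂_le x ((hP x).2 hx)) (le_iInf₂ fun y hy => ?_)⟩
  exact EReal.coe_le_coe_iff.2 (hmin ((hP y).1 hy))

omit [TopologicalSpace M] [ChartedSpace (𝔼 n) M] in
theorem volFactor_pos_of_mem_domain {P : M → Prop} {b : ℝ} {q r : M → ℝ}
    (hb : 0 < b) (hP : ∀ x, P x ↔ r x = 0) {t : ℝ}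
    (ht : t ∈ domain (⨅ (x : M) (_ : P x), ((theta b (q x) / b : ℝ) : EReal))) (x : M) :
    0 < volFactor b (q x) (r x) t := by
  by_cases hx : r x = 0
  · have h1 : (t : EReal) < ((theta b (q x) / b : ℝ) : EReal) :=
      ht.2.trans_le (iInf₂_le x ((hP x).2 hx))
    exact volFactor_pos_of_lt_theta hb ht.1 (EReal.coe_lt_coe_iff.1 h1)
  · exact volFactor_pos_of_ne_zero hb.ne' hx t

theorem SmoothFun.comp_prod {J : Set ℝ} {f g : ℝ → M → ℝ} (hf : SmoothFun (n := n) J f)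
    (hg : SmoothFun (n := n) J g) {F : ℝ × ℝ × ℝ → ℝ} {U : Set (ℝ × ℝ × ℝ)}
    (hF : ContDiffOn ℝ ∞ F U) (hU : ∀ t ∈ J, ∀ x, (t, f t x, g t x) ∈ U) :
    SmoothFun (n := n) J (fun t x => F (t, f t x, g t x)) := fun y =>
  hF.comp (contDiff_fst.contDiffOn.prodMk ((hf y).prodMk (hg y))) fun _ hz => hU _ hz.1 _

theorem smoothFun_volFactor {b : ℝ} {q r : M → ℝ}
    (hq : SmoothFun (n := n) univ (fun _ => q))
    (hr : SmoothFun (n := n) univ (fun _ x => r x ^ 2)) (J : Set ℝ) :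
    SmoothFun (n := n) J (fun t x => volFactor b (q x) (r x) t) := by
  have h2 := (hq.mono (subset_univ J)).comp_prod (hr.mono (subset_univ J))
    (contDiff_volPoly b).contDiffOn (U := univ) fun _ _ _ => mem_univ _
  exact h2.congr fun t _ x => (volPoly_sq b (q x) (r x) t).symm
-- Nonvanishing is required on all of `[0, t]`, the range of the integration variable, and not only
-- at `t`.
theorem smoothFun_invPrimitive {b : ℝ} {q r : M → ℝ}
    (hq : SmoothFun (n := n) univ (fun _ => q))
    (hr : SmoothFun (n := n) univ (fun _ x => r x ^ 2)) {J : Set ℝ}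
    (hJ : ∀ t ∈ J, ∀ u ∈ Icc 0 t, ∀ x, volFactor b (q x) (r x) u ≠ 0) (hJ0 : J ⊆ Ici 0) :
    SmoothFun (n := n) J (fun t x => invPrimitive b (q x) (r x ^ 2) t) := by
  obtain ⟨U, -, hU, hΨ⟩ := contDiffOn_invPrimitive b
  refine (hq.mono (subset_univ J)).comp_prod (hr.mono (subset_univ J)) hΨ fun t ht x => ?_
  refine (hU _).2 fun τ hτ => hJ t ht _ ?_ x
  have h0 : 0 ≤ t := hJ0 ht
  exact ⟨mul_nonneg h0 hτ.1, mul_le_of_le_one_right h0 hτ.2⟩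

variable [IsManifold (𝓡 n) ∞ M] [CompactSpace M] [Nonempty M] [MeasurableSpace M] [BorelSpace M]
  [T2Space M]

/-- At fixed time both integrands are affine in `q` and `q² + r²`, whose integrals are known; the
trigonometric terms then cancel. -/
theorem integral_volFactor {g₀ : TensorField n M} (hg₀ : IsMetric g₀) {b : ℝ} (hb : b ≠ 0)
    {q r : M → ℝ} (hq : SmoothFun (n := n) univ (fun _ => q))
    (hr : SmoothFun (n := n) univ (fun _ x => r x ^ 2)) (iq : ∫ x, q x ∂(vol g₀) = 0)
    (iqr : ∫ x, (q x ^ 2 + r x ^ 2) ∂(vol g₀) = b ^ 2 * totalVol g₀) (t : ℝ) :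
    ∫ x, volFactor b (q x) (r x) t ∂(vol g₀) = totalVol g₀ ∧
      ∫ x, volFactorDeriv b (q x) (r x) t ∂(vol g₀) = 0 := by
  have := hg₀.isFiniteMeasure
  have i1 : Integrable q (vol g₀) := hq.integrable _ (mem_univ 0)
  have i2 : Integrable (fun x => q x ^ 2 + r x ^ 2) (vol g₀) := by
    simpa only [pow_two] using! ((hq.mul hq).add hr).integrable (vol g₀) (mem_univ 0)
  have hVr : (vol g₀).real univ = totalVol g₀ := rfl
  have key : ∀ α β γ : ℝ, ∫ x, (α + (β * q x + γ * (q x ^ 2 + r x ^ 2))) ∂(vol g₀) =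
      (α + γ * b ^ 2) * totalVol g₀ := by
    intro α β γ
    have i3 : Integrable (fun x => β * q x + γ * (q x ^ 2 + r x ^ 2)) (vol g₀) :=
      (i1.const_mul _).add (i2.const_mul _)
    rw [integral_add (integrable_const _) i3, integral_add (i1.const_mul _) (i2.const_mul _),
      integral_const, integral_const_mul, integral_const_mul, iq, iqr, smul_eq_mul, hVr]
    ring
  constructor
  · have h1 : ∀ x, volFactor b (q x) (r x) t = (1 / 2 * Real.cos (b * t) + 1 / 2) +
        (Real.sin (b * t) / b * q x +
          (1 / 2 * (1 - Real.cos (b * t)) / b ^ 2) * (q x ^ 2 + r x ^ 2)) := fun x => by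
      rw [volFactor]; ring
    simp only [h1]
    rw [key]
    field_simp
    ring
  · have h1 : ∀ x, volFactorDeriv b (q x) (r x) t = (-(1 / 2) * (b * Real.sin (b * t))) +
        (Real.cos (b * t) * q x +
          (1 / 2 * (b * Real.sin (b * t)) / b ^ 2) * (q x ^ 2 + r x ^ 2)) := fun x => by
      rw [volFactorDeriv]; ring
    simp only [h1]
    rw [key]
    field_simp
    ring

theorem isMaximalGeodesic_volFactor (hn : 0 < n) {g₀ A : TensorField n M} (hg₀ : IsMetric g₀)
    (hA : IsSmoothSym A) (hAtr : ∀ x, ((gram g₀ x)⁻¹ * gram A x).trace = 0) {τ b : ℝ}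
    {q r : M → ℝ} (hb : 0 < b)
    (hr : ∀ x, 4 * r x ^ 2 = n * traceProd g₀ A A x)
    (hqS : SmoothFun (n := n) univ (fun _ => q))
    (hrS : SmoothFun (n := n) univ (fun _ x => r x ^ 2))
    (hτ : gN g₀ g₀ (tangentVector g₀ (fun x => q x + τ / 2) A) = τ)
    (hε : 4 * b ^ 2 = n * gN g₀ (tangentVector g₀ (fun x => q x + τ / 2) A)
      (tangentVector g₀ (fun x => q x + τ / 2) A) - τ ^ 2)
    (iq : ∫ x, q x ∂(vol g₀) = 0)
    (iqr : ∫ x, (q x ^ 2 + r x ^ 2) ∂(vol g₀) = b ^ 2 * totalVol g₀) {P : M → Prop}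
    (hP : ∀ x, P x ↔ r x = 0) :
    IsMaximalGeodesic g₀ (tangentVector g₀ (fun x => q x + τ / 2) A)
      (⨅ (x : M) (_ : P x), ((theta b (q x) / b : ℝ) : EReal))
      (expCurve g₀ A τ (fun t x => volFactor b (q x) (r x) t)
        (fun t x => invPrimitive b (q x) (r x ^ 2) t)) := by
  have hn' : (n : ℝ) ≠ 0 := by exact_mod_cast hn.ne'
  have hqc : Continuous q := hqS.continuous (mem_univ (0 : ℝ))
  have hrc : Continuous (fun x => r x ^ 2) := hrS.continuous (mem_univ (0 : ℝ))
  set T := (⨅ (x : M) (_ : P x), ((theta b (q x) / b : ℝ) : EReal)) with hTdef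
  have hT : 0 < T := by
    by_cases h : T = ⊤
    · rw [h]; exact EReal.zero_lt_top
    · obtain ⟨x, -, hx⟩ := exists_eq_iInf_theta hb hqc hrc hP h
      rw [hTdef, hx]
      exact EReal.coe_pos.2 (div_pos (theta_pos hb _) hb)
  have hpos : ∀ t ∈ domain T, ∀ x, 0 < volFactor b (q x) (r x) t := fun t ht x =>
    volFactor_pos_of_mem_domain hb hP ht x
  have hne : ∀ t ∈ domain T, ∀ u ∈ Icc 0 t, ∀ x, volFactor b (q x) (r x) u ≠ 0 :=
    fun t ht u hu x => (hpos u ((ordConnected_domain T).out (zero_mem_domain hT) ht hu) x).ne'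
  have hJu := uniqueDiffOn_domain hT
  have hgeo := isGeodesicFrom_expCurve hn hJu (zero_mem_domain hT) hg₀ hA hAtr hε hr
    (p := fun t x => volFactor b (q x) (r x) t)
    (dp := fun t x => volFactorDeriv b (q x) (r x) t)
    (Ψ := fun t x => invPrimitive b (q x) (r x ^ 2) t)
    (smoothFun_volFactor hqS hrS _)
    (smoothFun_invPrimitive hqS hrS hne fun t ht => ht.1) hpos
    (fun t _ x => (hasDerivAt_volFactor hb.ne' t).hasDerivWithinAt)
    (fun t _ x => (hasDerivAt_volFactorDeriv hb.ne' t).hasDerivWithinAt)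
    (fun t ht x => (hasDerivAt_invPrimitive fun u hu =>
      hne t ht u (uIcc_of_le ht.1 ▸ hu) x).hasDerivWithinAt)
    (fun t _ x => volFactor_first_integral hb.ne' t)
    (fun x => volFactor_zero) (fun x => volFactorDeriv_zero) (fun x => invPrimitive_zero _ _ _)
    ((hqc.pow 2).add hrc)
    (fun t _ => (integral_volFactor hg₀ hb.ne' hqS hrS iq iqr t).1)
    (fun t _ => (integral_volFactor hg₀ hb.ne' hqS hrS iq iqr t).2) iqr
  have etr : ∀ x, (endo g₀ (tangentVector g₀ (fun x => q x + τ / 2) A) x).trace =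
      2 * (q x + τ / 2) := fun x => by
    rw [endo_tangentVector (hg₀.det_pos x).ne', div_mul_eq_mul_div,
      trace_scalar_add hn (B := endo g₀ A x) (hAtr x)]
  refine isMaximalGeodesic_of_volume hn hT hgeo (b := b) (q := q) (r := r) (by rw [hτ]; exact hε)
    (fun x => by rw [etr, hτ]; ring) (fun x => ?_)
    (fun x t => hasDerivAt_volFactor hb.ne' t) (fun x t => hasDerivAt_volFactorDeriv hb.ne' t)
    (fun x => volFactor_zero) (fun x => volFactorDeriv_zero) fun t ht htT => ?_
  · rw [etr, ← traceProd_eq_endo, traceProd_tangentVector hn hg₀ hAtr, hr x]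
    field_simp
    ring
  -- The exit time is attained at some `x`, where the volume factor vanishes at `θ / b ≤ t`.
  · have htT' : T ≤ t := not_lt.1 fun h => htT ⟨ht, h⟩
    have hTtop : T ≠ ⊤ := (htT'.trans_lt (EReal.coe_lt_top t)).ne
    obtain ⟨x, hx0, hx⟩ := exists_eq_iInf_theta hb hqc hrc hP hTtop
    rw [hTdef, hx] at htT'
    refine ⟨theta b (q x) / b, ⟨(div_pos (theta_pos hb _) hb).le,
      EReal.coe_le_coe_iff.1 htT'⟩, x, ?_⟩
    rw [hx0, volFactor_theta hb]

theorem isMaximalGeodesic_homothetic (hn : 0 < n) {g₀ A : TensorField n M} (hg₀ : IsMetric g₀)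
    (hA : IsSmoothSym A) {τ : ℝ} {q : M → ℝ} (hA0 : ∀ x, A x = 0) (hq0 : ∀ x, q x = 0)
    (hτ : gN g₀ g₀ (tangentVector g₀ (fun x => q x + τ / 2) A) = τ)
    (hε : 0 = n * gN g₀ (tangentVector g₀ (fun x => q x + τ / 2) A)
      (tangentVector g₀ (fun x => q x + τ / 2) A) - τ ^ 2) :
    IsMaximalGeodesic g₀ (tangentVector g₀ (fun x => q x + τ / 2) A) ⊤
      (fun t => Real.exp (τ * t / n) • g₀) := by
  have hn' : (n : ℝ) ≠ 0 := by exact_mod_cast hn.ne'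
  have htp : ∀ x, traceProd g₀ A A x = 0 := fun x => (traceProd_eq_zero_iff hg₀ hA x).2 (hA0 x)
  have hgA : ∀ x, gram A x = 0 := fun x =>
    eq_zero_of_trace_sq_eq_zero (hg₀.posDef x) (hA.gram_symm x) (htp x)
  have hAtr : ∀ x, ((gram g₀ x)⁻¹ * gram A x).trace = 0 := fun x => by rw [hgA]; simp
  have hT : (0 : EReal) < ⊤ := EReal.zero_lt_top
  have hV : (vol g₀).real univ = totalVol g₀ := rfl
  -- With `b = q = r = 0` the volume factor is constantly `1`. The angle `Ψ t = t` satisfies `Ψ' = 1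
  -- / p` and has no effect, since `A = 0`.
  have hgeo := isGeodesicFrom_expCurve hn (uniqueDiffOn_domain hT) (zero_mem_domain hT) hg₀ hA hAtr
    (τ := τ) (b := 0) (q := q) (r := fun _ => 0) (p := fun _ _ => 1) (dp := fun _ _ => 0)
    (Ψ := fun t _ => t) (by simpa using hε) (fun x => by rw [htp]; simp)
    (SmoothFun.const 1) (SmoothFun.time contDiffOn_id) (fun _ _ _ => one_pos)
    (fun t _ x => hasDerivWithinAt_const _ _ _)
    (fun t _ x => (hasDerivWithinAt_const _ _ _).congr_deriv (by simp [hq0]))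
    (fun t _ x => (hasDerivWithinAt_id t _).congr_deriv (by simp))
    (fun t _ x => by simp [hq0]) (fun _ => rfl) (fun x => (hq0 x).symm) (fun _ => rfl)
    (by simpa [hq0] using continuous_const) (fun t _ => by simp [hV]) (fun t _ => by simp)
    (by simp [hq0])
  have hcurve : expCurve g₀ A τ (fun _ _ => 1) (fun t _ => t) =
      fun t => Real.exp (τ * t / n) • g₀ := by
    funext t x
    refine tensorField_ext ?_
    rw [gram_expCurve, gram_smul, hgA]
    simp
  rw [hcurve] at hgeo
  have etr : ∀ x, (endo g₀ (tangentVector g₀ (fun x => q x + τ / 2) A) x).trace =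
      2 * (q x + τ / 2) := fun x => by
    rw [endo_tangentVector (hg₀.det_pos x).ne', div_mul_eq_mul_div,
      trace_scalar_add hn (B := endo g₀ A x) (hAtr x)]
  refine isMaximalGeodesic_of_volume hn hT hgeo (b := 0) (q := q) (r := fun _ => 0)
    (p := fun _ _ => 1) (dp := fun _ _ => 0) (by rw [hτ, ← hε]; simp)
    (fun x => by rw [etr, hτ]; ring) (fun x => ?_) (fun x t => hasDerivAt_const _ _)
    (fun x t => (hasDerivAt_const _ _).congr_deriv (by simp [hq0]))
    (fun x => rfl) (fun x => (hq0 x).symm) fun t ht htT => ?_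
  · rw [etr, ← traceProd_eq_endo, traceProd_tangentVector hn hg₀ hAtr, htp x]
    field_simp
    ring
  · exact absurd ⟨ht, EReal.coe_lt_top t⟩ htT

end
end GenCalabi

/-! ### The continuous branch of the arctangent -/

open Set Filter Topology MeasureTheory
open scoped Manifold ContDiff
namespace GenCalabi

section Branch

/-- The continuous branch of the arctangent. -/
noncomputable def branch (b q r t : ℝ) : ℝ := r / 2 * invPrimitive b q (r ^ 2) t

variable {b q r : ℝ}

theorem hasDerivAt_branch (hb : 0 < b) (hr : 0 < r) (t : ℝ) :
    HasDerivAt (branch b q r) (r / 2 * (1 / volFactor b q r t)) t := by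
  rw [← volPoly_sq]
  refine (hasDerivAt_invPrimitive fun u _ => ?_).const_mul _
  rw [volPoly_sq]
  exact (volFactor_pos_of_ne_zero hb.ne' hr.ne' u).ne'

theorem branch_zero : branch b q r 0 = 0 := by
  rw [branch, invPrimitive_zero, mul_zero]

theorem volFactor_eq_sq_add_sq (hb : b ≠ 0) (t : ℝ) :
    b ^ 2 * volFactor b q r t = (b * Real.cos (b / 2 * t) + q * Real.sin (b / 2 * t)) ^ 2 +
      (r * Real.sin (b / 2 * t)) ^ 2 := by
  have h : t = 2 * (b / 2 * t) / b := by field_simp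
  conv_lhs => rw [h, volFactor_half_angle hb]
  field_simp

/-- `branch` is the argument of `b cos (b t / 2) + q sin (b t / 2) + i r sin (b t / 2)`. -/
theorem cos_sin_branch (hb : 0 < b) (hr : 0 < r) (t : ℝ) :
    b * Real.cos (b / 2 * t) + q * Real.sin (b / 2 * t) =
      b * Real.sqrt (volFactor b q r t) * Real.cos (branch b q r t) ∧
    r * Real.sin (b / 2 * t) =
      b * Real.sqrt (volFactor b q r t) * Real.sin (branch b q r t) := by
  set X : ℝ → ℝ := fun t => b * Real.cos (b / 2 * t) + q * Real.sin (b / 2 * t) with hX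
  set Y : ℝ → ℝ := fun t => r * Real.sin (b / 2 * t) with hY
  set p : ℝ → ℝ := volFactor b q r with hp
  set ψ : ℝ → ℝ := branch b q r with hψ
  have hpos : ∀ t, 0 < p t := fun t => volFactor_pos_of_ne_zero hb.ne' hr.ne' t
  set dX : ℝ → ℝ := fun t =>
    b * -(b / 2 * Real.sin (b / 2 * t)) + q * (b / 2 * Real.cos (b / 2 * t)) with hdX
  set dY : ℝ → ℝ := fun t => r * (b / 2 * Real.cos (b / 2 * t)) with hdY
  have dx : ∀ t, HasDerivAt X (dX t) t := fun t =>
    ((hasDerivAt_cos_mul _ t).const_mul b).add ((hasDerivAt_sin_mul _ t).const_mul q)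
  have dy : ∀ t, HasDerivAt Y (dY t) t := fun t => (hasDerivAt_sin_mul _ t).const_mul r
  have dψ : ∀ t, HasDerivAt ψ (r / 2 * (1 / p t)) t := hasDerivAt_branch hb hr
  have hXY : ∀ t, b ^ 2 * p t = X t ^ 2 + Y t ^ 2 := volFactor_eq_sq_add_sq hb.ne'
  have dp : ∀ t, HasDerivAt p ((2 * X t * dX t + 2 * Y t * dY t) / b ^ 2) t := by
    intro t
    have h1 : p = fun t => (X t ^ 2 + Y t ^ 2) / b ^ 2 := by
      funext t; rw [← hXY t]; field_simp
    rw [h1]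
    refine ((((dx t).pow 2).add ((dy t).pow 2)).div_const (b ^ 2)).congr_deriv ?_
    push_cast
    ring
  -- The angular momentum of `X + i Y` is constant; divided by the squared modulus `b² p` it gives
  -- the angular velocity `r / (2 p)`, which is the derivative of `ψ`.
  have hw : ∀ t, X t * dY t - Y t * dX t = b ^ 2 * r / 2 := by
    intro t
    simp only [hX, hY, hdX, hdY]
    linear_combination (b ^ 2 * r / 2) * Real.sin_sq_add_cos_sq (b / 2 * t)
  -- Together with the next identity this says `z' = (p' / (2 p) + i ψ') z` for `z = X + i Y`.
  have ex : ∀ t, dX t = (2 * X t * dX t + 2 * Y t * dY t) / b ^ 2 / (2 * p t) * X t -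
      r / 2 * (1 / p t) * Y t := by
    intro t
    have h1 := (hpos t).ne'
    have h2 : r = 2 * (X t * dY t - Y t * dX t) / b ^ 2 := by rw [hw t]; field_simp
    have h3 : p t = (X t ^ 2 + Y t ^ 2) / b ^ 2 := by rw [← hXY t]; field_simp
    have h4 : X t ^ 2 + Y t ^ 2 ≠ 0 := by rw [← hXY t]; positivity
    rw [h2, h3]
    field_simp
    ring
  have ey : ∀ t, dY t = (2 * X t * dX t + 2 * Y t * dY t) / b ^ 2 / (2 * p t) * Y t +
      r / 2 * (1 / p t) * X t := by
    intro t
    have h1 := (hpos t).ne'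
    have h2 : r = 2 * (X t * dY t - Y t * dX t) / b ^ 2 := by rw [hw t]; field_simp
    have h3 : p t = (X t ^ 2 + Y t ^ 2) / b ^ 2 := by rw [← hXY t]; field_simp
    have h4 : X t ^ 2 + Y t ^ 2 ≠ 0 := by rw [← hXY t]; positivity
    rw [h2, h3]
    field_simp
    ring
  have dsq : ∀ t, HasDerivAt (fun t => Real.sqrt (p t))
      ((2 * X t * dX t + 2 * Y t * dY t) / b ^ 2 / (2 * p t) * Real.sqrt (p t)) t := by
    intro t
    refine ((dp t).sqrt (hpos t).ne').congr_deriv ?_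
    have h1 : 0 < Real.sqrt (p t) := Real.sqrt_pos.2 (hpos t)
    have h2 : Real.sqrt (p t) ^ 2 = p t := Real.sq_sqrt (hpos t).le
    generalize Real.sqrt (p t) = s at h1 h2
    rw [← h2]
    field_simp
  have hsq : ∀ t, Real.sqrt (p t) ≠ 0 := fun t => (Real.sqrt_pos.2 (hpos t)).ne'
  have h0 : X 0 = b ∧ Y 0 = 0 ∧ ψ 0 = 0 ∧ p 0 = 1 := by
    refine ⟨by simp [hX], by simp [hY], branch_zero, volFactor_zero⟩
  -- Hence `z exp (-i ψ) / √p` is constant. Its real part is `b` here, and its imaginary part,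
  -- treated next, is `0`.
  have hU : ∀ t, (X t * Real.cos (ψ t) + Y t * Real.sin (ψ t)) / Real.sqrt (p t) = b := by
    intro t
    have h1 : ∀ t ∈ (univ : Set ℝ), HasDerivWithinAt
        (fun t => (X t * Real.cos (ψ t) + Y t * Real.sin (ψ t)) / Real.sqrt (p t)) 0 univ t := by
      intro t _
      refine (((((dx t).mul (dψ t).cos).add ((dy t).mul (dψ t).sin)).div (dsq t)
        (hsq t)).congr_deriv ?_).hasDerivWithinAt
      refine div_eq_zero_iff.2 (Or.inl ?_)
      simp only [Pi.add_apply, Pi.mul_apply]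
      linear_combination Real.sqrt (p t) * Real.cos (ψ t) * ex t +
        Real.sqrt (p t) * Real.sin (ψ t) * ey t
    rw [eq_of_hasDerivWithinAt_zero convex_univ h1 (mem_univ 0) (mem_univ t)]
    simp [h0]
  have hW : ∀ t, (Y t * Real.cos (ψ t) - X t * Real.sin (ψ t)) / Real.sqrt (p t) = 0 := by
    intro t
    have h1 : ∀ t ∈ (univ : Set ℝ), HasDerivWithinAt
        (fun t => (Y t * Real.cos (ψ t) - X t * Real.sin (ψ t)) / Real.sqrt (p t)) 0 univ t := by
      intro t _
      refine (((((dy t).mul (dψ t).cos).sub ((dx t).mul (dψ t).sin)).div (dsq t)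
        (hsq t)).congr_deriv ?_).hasDerivWithinAt
      refine div_eq_zero_iff.2 (Or.inl ?_)
      simp only [Pi.sub_apply, Pi.mul_apply]
      linear_combination Real.sqrt (p t) * Real.cos (ψ t) * ey t -
        Real.sqrt (p t) * Real.sin (ψ t) * ex t
    rw [eq_of_hasDerivWithinAt_zero convex_univ h1 (mem_univ 0) (mem_univ t)]
    simp [h0]
  have h1 := (div_eq_iff (hsq t)).1 (hU t)
  have h2 := (div_eq_iff (hsq t)).1 (hW t)
  have h3 := Real.sin_sq_add_cos_sq (ψ t)
  constructor
  · linear_combination Real.cos (ψ t) * h1 - Real.sin (ψ t) * h2 - X t * h3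
  · linear_combination Real.sin (ψ t) * h1 + Real.cos (ψ t) * h2 - Y t * h3

/-- The difference starts at `arctan (q / b)`, of modulus below `π / 2`, and by continuity could
leave `(-π, π)` only through `±π`. There `z` would point opposite to the angle `b t / 2 - φ`,
forcing both the cosine and the sine of that angle to vanish. -/
theorem abs_branch_sub_lt_pi (hb : 0 < b) (hr : 0 < r) (t : ℝ) :
    |branch b q r t - (b / 2 * t - Real.arctan (q / b))| < Real.pi := by
  set φ := Real.arctan (q / b) with hφ
  have hφl := Real.neg_pi_div_two_lt_arctan (q / b)
  have hφu := Real.arctan_lt_pi_div_two (q / b)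
  have hcφ : 0 < Real.cos φ := Real.cos_arctan_pos (q / b)
  set D : ℝ → ℝ := fun t => branch b q r t - (b / 2 * t - φ) with hD
  have hDc : Continuous D :=
    (continuous_iff_continuousAt.2 fun t => (hasDerivAt_branch hb hr t).continuousAt).sub
      (by fun_prop)
  have hD0 : D 0 = φ := by simp [hD, branch_zero]
  have hne : ∀ t, |D t| ≠ Real.pi := by
    intro t ht
    have hU : 0 < b * Real.sqrt (volFactor b q r t) :=
      mul_pos hb (Real.sqrt_pos.2 (volFactor_pos_of_ne_zero hb.ne' hr.ne' t))
    obtain ⟨h1, h2⟩ := cos_sin_branch (q := q) hb hr t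
    rw [cos_sub_arctan hb.ne', ← hφ] at h1
    set U := b * Real.sqrt (volFactor b q r t)
    have h3 : b / 2 * t = (b / 2 * t - φ) + φ := by ring
    rw [h3, Real.sin_add] at h2
    have hcs : Real.cos (branch b q r t) = -Real.cos (b / 2 * t - φ) ∧
        Real.sin (branch b q r t) = -Real.sin (b / 2 * t - φ) := by
      have h4 : branch b q r t = (b / 2 * t - φ) + D t := by simp only [hD]; ring
      rcases (abs_eq Real.pi_pos.le).1 ht with h | h
      · rw [h4, h, Real.cos_add_pi, Real.sin_add_pi]
        exact ⟨rfl, rfl⟩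
      · rw [h4, h, ← sub_eq_add_neg, Real.cos_sub_pi, Real.sin_sub_pi]
        exact ⟨rfl, rfl⟩
    rw [hcs.1] at h1
    rw [hcs.2] at h2
    generalize b / 2 * t - φ = u at h1 h2
    have hcu : Real.cos u = 0 := by
      have h5 : Real.cos u * (b / Real.cos φ + U) = 0 := by
        have : b * (Real.cos u / Real.cos φ) = Real.cos u * (b / Real.cos φ) := by ring
        rw [this] at h1
        linear_combination h1
      exact (mul_eq_zero.1 h5).resolve_right (by positivity)
    rw [hcu] at h2
    have h6 : Real.sin u * (r * Real.cos φ + U) = 0 := by linear_combination h2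
    have h7 : Real.sin u = 0 := (mul_eq_zero.1 h6).resolve_right (by positivity)
    have h8 := Real.sin_sq_add_cos_sq u
    rw [h7, hcu] at h8
    norm_num at h8
  by_contra hcon
  have h1 : Real.pi ∈ uIcc |D 0| |D t| := by
    rw [uIcc_of_le] <;> rw [hD0]
    · exact ⟨(abs_lt.2 ⟨by linarith [Real.pi_pos], by linarith [Real.pi_pos]⟩).le, not_lt.1 hcon⟩
    · exact (abs_lt.2 ⟨by linarith [Real.pi_pos], by linarith [Real.pi_pos]⟩).le.trans
        (not_lt.1 hcon)
  obtain ⟨s, -, hs⟩ := intermediate_value_uIcc hDc.abs.continuousOn h1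
  exact hne s hs

/-- On the `k`-th time interval `u = b t / 2 - φ` runs through the `k`-th half period. There `cos ψ`
is a positive multiple of `cos u` and `|ψ - u| < π`, which places `ψ` in the same closed half
period. -/
theorem isArctanBranch_branch (hb : 0 < b) (hr : 0 < r) :
    IsArctanBranch b q r (branch b q r) := by
  have hmem : ∀ (k : ℤ) (t : ℝ),
      t ∈ Icc ((2 * Real.pi * (k - 1) + theta b q) / b) ((2 * Real.pi * k + theta b q) / b) →
      branch b q r t ∈ Icc (Real.pi * k - Real.pi / 2) (Real.pi * k + Real.pi / 2) := by
    intro k t ht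
    rw [mem_Icc, div_le_iff₀ hb, le_div_iff₀ hb, theta_eq hb q] at ht
    have habs := abs_lt.1 (abs_branch_sub_lt_pi (q := q) hb hr t)
    have h1 := (cos_sin_branch (q := q) hb hr t).1
    rw [cos_sub_arctan hb.ne'] at h1
    have hcφ := Real.cos_arctan_pos (q / b)
    generalize Real.arctan (q / b) = φ at *
    have hU : 0 < b * Real.sqrt (volFactor b q r t) :=
      mul_pos hb (Real.sqrt_pos.2 (volFactor_pos_of_ne_zero hb.ne' hr.ne' t))
    set U := b * Real.sqrt (volFactor b q r t)
    set u := b / 2 * t - φ with hu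
    have hu1 : Real.pi * k - Real.pi / 2 ≤ u := by rw [hu]; linarith [ht.1]
    have hu2 : u ≤ Real.pi * k + Real.pi / 2 := by rw [hu]; linarith [ht.2]
    have hcosu : 0 ≤ Real.cos (u - k * Real.pi) :=
      Real.cos_nonneg_of_mem_Icc ⟨by linarith, by linarith⟩
    have hcosψ : 0 ≤ Real.cos (branch b q r t - k * Real.pi) := by
      rw [Real.cos_sub_int_mul_pi] at hcosu ⊢
      have h2 : Real.cos (branch b q r t) = Real.cos u * (b / Real.cos φ / U) := by
        field_simp
        linear_combination (-Real.cos φ) * h1 + b * Real.cos u * (mul_inv_cancel₀ hcφ.ne')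
      rw [h2, ← mul_assoc]
      exact mul_nonneg hcosu (by positivity)
    constructor
    · by_contra hcon
      have := Real.cos_neg_of_pi_div_two_lt_of_lt (x := -(branch b q r t - k * Real.pi))
        (by linarith) (by linarith)
      rw [Real.cos_neg] at this
      linarith
    · by_contra hcon
      have := Real.cos_neg_of_pi_div_two_lt_of_lt (x := branch b q r t - k * Real.pi)
        (by linarith) (by linarith)
      linarith
  refine ⟨continuous_iff_continuousAt.2 fun t => (hasDerivAt_branch hb hr t).continuousAt, hmem,
    fun k t ht hne => ?_⟩
  obtain ⟨h1, h2⟩ := cos_sin_branch (q := q) hb hr t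
  have hU : 0 < b * Real.sqrt (volFactor b q r t) :=
    mul_pos hb (Real.sqrt_pos.2 (volFactor_pos_of_ne_zero hb.ne' hr.ne' t))
  have hm := hmem k t ht
  set U := b * Real.sqrt (volFactor b q r t)
  have e1 : b * t = 2 * (b / 2 * t) := by ring
  -- Numerator and denominator of the stated quotient share the factor `2 cos (b t / 2)`, whose
  -- zeros produce the `0 / 0` times; cancelling it leaves `tan ψ`.
  have e2 : b + b * Real.cos (b * t) + q * Real.sin (b * t) =
      2 * Real.cos (b / 2 * t) * (U * Real.cos (branch b q r t)) := by
    rw [← h1, e1, Real.cos_two_mul, Real.sin_two_mul]; ring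
  have e3 : r * Real.sin (b * t) = 2 * Real.cos (b / 2 * t) * (U * Real.sin (branch b q r t)) := by
    rw [← h2, e1, Real.sin_two_mul]; ring
  rw [e2] at hne ⊢
  rw [e3]
  have hc : Real.cos (b / 2 * t) ≠ 0 := fun h => hne (by rw [h]; ring)
  have hcψ : Real.cos (branch b q r t) ≠ 0 := fun h => hne (by rw [h]; ring)
  have e4 : 2 * Real.cos (b / 2 * t) * (U * Real.sin (branch b q r t)) /
      (2 * Real.cos (b / 2 * t) * (U * Real.cos (branch b q r t))) =
      Real.tan (branch b q r t - k * Real.pi) := by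
    rw [Real.tan_sub_int_mul_pi, Real.tan_eq_sin_div_cos]
    generalize Real.cos (b / 2 * t) = γ at hc ⊢
    field_simp
  have hcψ' : Real.cos (branch b q r t - k * Real.pi) ≠ 0 := by
    rw [Real.cos_sub_int_mul_pi]
    exact mul_ne_zero (zpow_ne_zero _ (by norm_num)) hcψ
  rw [e4, Real.arctan_tan]
  · ring
  · refine lt_of_le_of_ne (by linarith [hm.1]) fun h => hcψ' ?_
    rw [← h, Real.cos_neg, Real.cos_pi_div_two]
  · refine lt_of_le_of_ne (by linarith [hm.2]) fun h => hcψ' ?_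
    rw [h, Real.cos_pi_div_two]

end Branch
end GenCalabi

/-! ### Uniform estimates and continuity of limits -/

open Set Filter Topology MeasureTheory
open scoped Manifold ContDiff
namespace GenCalabi

section
open scoped Matrix.Norms.Operator

variable {n : ℕ}
local notation "Mat" => Matrix (Fin n) (Fin n) ℝ
local notation "𝔼" n => EuclideanSpace ℝ (Fin n)
local notation "𝔹" n => (EuclideanSpace ℝ (Fin n)) →L[ℝ] (EuclideanSpace ℝ (Fin n)) →L[ℝ] ℝ

theorem norm_le_of_entry_le {X : Mat} {C : ℝ} (hC : 0 ≤ C) (h : ∀ i j, |X i j| ≤ C) :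
    ‖X‖ ≤ n * C := by
  rw [Matrix.linfty_opNorm_def]
  have h1 : (Finset.univ.sup fun i => ∑ j, ‖X i j‖₊) ≤ (n * C.toNNReal : NNReal) := by
    refine Finset.sup_le fun i _ => ?_
    refine (Finset.sum_le_card_nsmul _ _ C.toNNReal fun j _ => ?_).trans (by simp)
    rw [← NNReal.coe_le_coe, Real.coe_toNNReal _ hC, coe_nnnorm, Real.norm_eq_abs]
    exact h i j
  refine (NNReal.coe_le_coe.2 h1).trans ?_
  rw [NNReal.coe_mul, Real.coe_toNNReal _ hC]
  simp

/-- For symmetric `X` the trace of `X²` is the sum of the squared entries and bounds each of them.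
The factor `n` arises because the norm is the maximal row sum. -/
theorem norm_le_of_transpose_eq {X : Mat} (hX : X.transpose = X) :
    ‖X‖ ≤ n * Real.sqrt (X * X).trace := by
  refine norm_le_of_entry_le (Real.sqrt_nonneg _) fun i j => Real.abs_le_sqrt ?_
  have h1 : (X * X).trace = ∑ i, ∑ j, X i j ^ 2 := by
    simp only [Matrix.trace, Matrix.diag_apply, Matrix.mul_apply]
    refine Finset.sum_congr rfl fun i _ => Finset.sum_congr rfl fun j _ => ?_
    rw [pow_two]
    congr 1
    conv_rhs => rw [← hX]
    rfl
  rw [h1]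
  refine (Finset.single_le_sum (f := fun j => X i j ^ 2) (fun j _ => sq_nonneg _)
    (Finset.mem_univ j)).trans ?_
  exact Finset.single_le_sum (f := fun i => ∑ j, X i j ^ 2)
    (fun i _ => Finset.sum_nonneg fun j _ => sq_nonneg _) (Finset.mem_univ i)

/-- Diagonalisation-free normal form of `G exp (s G⁻¹ A)` in a `G`-orthonormal frame. -/
theorem exists_orthonormal_frame {G A : Mat} (hG : G.PosDef) (hA : A.transpose = A) :
    ∃ S X : Mat, G = S.transpose * S ∧ ‖X‖ ≤ n * Real.sqrt (G⁻¹ * A * (G⁻¹ * A)).trace ∧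
      ∀ s : ℝ, G * NormedSpace.exp (s • (G⁻¹ * A)) =
        S.transpose * NormedSpace.exp (s • X) * S := by
  obtain ⟨S, hS, hGS⟩ := exists_isUnit_transpose_mul_self hG
  have hd : IsUnit S.det := (Matrix.isUnit_iff_isUnit_det S).1 hS
  have hd' : IsUnit S.transpose.det := by rwa [Matrix.det_transpose]
  -- Conjugating by `S` turns the `G`-symmetric endomorphism `G⁻¹ A` into a symmetric matrix with
  -- the same trace of the square.
  set X : Mat := S * (G⁻¹ * A) * S⁻¹ with hX
  have h1 : X = S.transpose⁻¹ * A * S⁻¹ := by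
    rw [hX, hGS, Matrix.mul_inv_rev, ← mul_assoc, ← mul_assoc, Matrix.mul_nonsing_inv _ hd, one_mul]
  have hXs : X.transpose = X := by
    rw [h1, Matrix.transpose_mul, Matrix.transpose_mul, hA, Matrix.transpose_nonsing_inv,
      Matrix.transpose_nonsing_inv, Matrix.transpose_transpose, mul_assoc]
  have htr : (X * X).trace = (G⁻¹ * A * (G⁻¹ * A)).trace := by
    have h2 : X * X = S * (G⁻¹ * A * (G⁻¹ * A)) * S⁻¹ := by
      rw [hX]
      have h3 : S⁻¹ * S = 1 := Matrix.nonsing_inv_mul _ hd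
      calc S * (G⁻¹ * A) * S⁻¹ * (S * (G⁻¹ * A) * S⁻¹)
          = S * (G⁻¹ * A) * (S⁻¹ * S) * (G⁻¹ * A) * S⁻¹ := by noncomm_ring
        _ = S * (G⁻¹ * A * (G⁻¹ * A)) * S⁻¹ := by rw [h3]; noncomm_ring
    rw [h2, Matrix.trace_mul_comm, ← mul_assoc, Matrix.nonsing_inv_mul _ hd, one_mul]
  refine ⟨S, X, hGS, htr ▸ norm_le_of_transpose_eq hXs, fun s => ?_⟩
  have h4 : s • X = S * (s • (G⁻¹ * A)) * S⁻¹ := by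
    rw [hX, Matrix.mul_smul, Matrix.smul_mul]
  rw [h4, Matrix.exp_conj _ _ hS]
  generalize NormedSpace.exp (s • (G⁻¹ * A)) = E
  rw [mul_assoc, mul_assoc, Matrix.nonsing_inv_mul _ hd, mul_one, ← mul_assoc, ← hGS]

theorem abs_quadratic_le (Z : Mat) (w : Fin n → ℝ) :
    |dotProduct w (Z.mulVec w)| ≤ n * ‖Z‖ * dotProduct w w := by
  have h1 : ‖w‖ ^ 2 ≤ dotProduct w w := by
    have h2 : ‖w‖ ≤ Real.sqrt (dotProduct w w) := by
      refine (pi_norm_le_iff_of_nonneg (Real.sqrt_nonneg _)).2 fun i => Real.abs_le_sqrt ?_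
      rw [pow_two]
      exact Finset.single_le_sum (f := fun i => w i * w i) (fun i _ => mul_self_nonneg _)
        (Finset.mem_univ i)
    calc ‖w‖ ^ 2 ≤ Real.sqrt (dotProduct w w) ^ 2 := by gcongr
      _ = dotProduct w w := Real.sq_sqrt (Finset.sum_nonneg fun i _ => mul_self_nonneg _)
  have h3 : ∀ i, |w i * (Z.mulVec w) i| ≤ ‖w‖ * (‖Z‖ * ‖w‖) := by
    intro i
    rw [abs_mul]
    refine mul_le_mul (norm_le_pi_norm w i) ?_ (abs_nonneg _) (norm_nonneg _)
    exact (norm_le_pi_norm (Z.mulVec w) i).trans (Matrix.linfty_opNorm_mulVec Z w)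
  calc |dotProduct w (Z.mulVec w)| ≤ ∑ i, |w i * (Z.mulVec w) i| := Finset.abs_sum_le_sum_abs _ _
    _ ≤ ∑ _i : Fin n, ‖w‖ * (‖Z‖ * ‖w‖) := Finset.sum_le_sum fun i _ => h3 i
    _ = n * ‖Z‖ * ‖w‖ ^ 2 := by
      rw [Finset.sum_const, Finset.card_univ, Fintype.card_fin, nsmul_eq_mul]; ring
    _ ≤ n * ‖Z‖ * dotProduct w w := by gcongr

theorem dotProduct_congruence (S Z : Mat) (v : Fin n → ℝ) :
    dotProduct v ((S.transpose * Z * S).mulVec v) =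
      dotProduct (S.mulVec v) (Z.mulVec (S.mulVec v)) := by
  rw [mul_assoc, ← Matrix.mulVec_mulVec, Matrix.dotProduct_mulVec, Matrix.vecMul_transpose,
    Matrix.mulVec_mulVec]

section Limit

variable {M : Type*} [TopologicalSpace M]

/-- Uniform convergence of `λ exp (Ψ X)`, where `Ψ` may be discontinuous when `λ` vanishes. -/
theorem eventually_norm_smul_exp_sub_lt [CompactSpace M] {T : ℝ} (hT : 0 < T)
    {lam Ψ : ℝ → M → ℝ} {ρ : M → ℝ} {C : ℝ}
    (hlam : ∀ x, ContinuousAt (fun z : ℝ × M => lam z.1 z.2) (T, x)) (hρ : Continuous ρ)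
    (hΨ : ∀ x, lam T x ≠ 0 → ContinuousAt (fun z : ℝ × M => Ψ z.1 z.2) (T, x))
    (hC : ∀ t ∈ Icc 0 T, ∀ x, |Ψ t x| * ρ x ≤ C) {ε : ℝ} (hε : 0 < ε) :
    ∀ᶠ t in 𝓝[<] T, ∀ x, ∀ X : Mat, ‖X‖ ≤ ρ x →
      ‖lam t x • NormedSpace.exp (Ψ t x • X) - lam T x • NormedSpace.exp (Ψ T x • X)‖ < ε := by
  have hexp : Continuous (fun X : Mat => NormedSpace.exp X) := contDiff_matrix_exp.continuous
  have key := (isCompact_univ (X := M)).eventually_forall_of_forall_eventually (x₀ := T)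
    (P := fun t x => t ∈ Icc 0 T → ∀ X : Mat, ‖X‖ ≤ ρ x →
      ‖lam t x • NormedSpace.exp (Ψ t x • X) - lam T x • NormedSpace.exp (Ψ T x • X)‖ < ε) ?_
  · have h1 : ∀ᶠ t in 𝓝[<] T, t ∈ Icc 0 T := by
      filter_upwards [mem_nhdsWithin_of_mem_nhds (Ioi_mem_nhds hT), self_mem_nhdsWithin]
        with t ht ht'
      exact ⟨le_of_lt ht, le_of_lt ht'⟩
    filter_upwards [h1, mem_nhdsWithin_of_mem_nhds key] with t ht h x
    exact h x (mem_univ x) ht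
  intro x₀ _
  have hTx : ContinuousAt (fun z : ℝ × M => (T, z.2)) (T, x₀) := by fun_prop
  have hlamT : ContinuousAt (fun z : ℝ × M => lam T z.2) (T, x₀) :=
    (hlam x₀).comp_of_eq (f := fun z : ℝ × M => (T, z.2)) hTx rfl
  by_cases h0 : lam T x₀ = 0
  -- Where the scalar vanishes in the limit nothing is known about continuity of `Ψ`. The exponent
  -- stays in a fixed ball, so the exponential is bounded and the small scalar suffices.
  · obtain ⟨C', hC'⟩ := (isCompact_closedBall (0 : Mat) C).exists_bound_of_continuousOn
      hexp.continuousOn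
    have hCp : 0 < |C'| + 1 := by positivity
    have hlt : |lam T x₀| < ε / (2 * (|C'| + 1)) := by rw [h0, abs_zero]; positivity
    filter_upwards [(hlam x₀).abs.eventually_lt_const hlt, hlamT.abs.eventually_lt_const hlt]
      with z hz hz' hzT X hX
    have hb : ∀ t ∈ Icc 0 T, ‖NormedSpace.exp (Ψ t z.2 • X)‖ ≤ |C'| + 1 := by
      intro t ht
      refine (hC' _ ?_).trans ((le_abs_self C').trans (by linarith))
      rw [mem_closedBall_zero_iff, norm_smul, Real.norm_eq_abs]
      exact (mul_le_mul_of_nonneg_left hX (abs_nonneg _)).trans (hC t ht z.2)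
    have e1 : ∀ t ∈ Icc 0 T, |lam t z.2| < ε / (2 * (|C'| + 1)) →
        ‖lam t z.2 • NormedSpace.exp (Ψ t z.2 • X)‖ < ε / 2 := by
      intro t ht hl
      rw [norm_smul, Real.norm_eq_abs]
      calc |lam t z.2| * ‖NormedSpace.exp (Ψ t z.2 • X)‖ ≤ |lam t z.2| * (|C'| + 1) :=
            mul_le_mul_of_nonneg_left (hb t ht) (abs_nonneg _)
        _ < ε / (2 * (|C'| + 1)) * (|C'| + 1) := mul_lt_mul_of_pos_right hl hCp
        _ = ε / 2 := by field_simp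
    calc _ ≤ ‖lam z.1 z.2 • NormedSpace.exp (Ψ z.1 z.2 • X)‖ +
          ‖lam T z.2 • NormedSpace.exp (Ψ T z.2 • X)‖ := norm_sub_le _ _
      _ < ε / 2 + ε / 2 := add_lt_add (e1 _ hzT hz) (e1 T ⟨hT.le, le_rfl⟩ hz')
      _ = ε := add_halves ε
  · have hΨT : ContinuousAt (fun z : ℝ × M => Ψ T z.2) (T, x₀) :=
      (hΨ x₀ h0).comp_of_eq (f := fun z : ℝ × M => (T, z.2)) hTx rfl
    -- Elsewhere joint continuity is made uniform over the compact ball of admissible `X`; the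
    -- radius `ρ x₀ + 1` absorbs the variation of `ρ`.
    have h1 := (isCompact_closedBall (0 : Mat) (ρ x₀ + 1)).eventually_forall_of_forall_eventually
      (x₀ := (lam T x₀, Ψ T x₀, lam T x₀, Ψ T x₀))
      (P := fun (u : ℝ × ℝ × ℝ × ℝ) (X : Mat) =>
        ‖u.1 • NormedSpace.exp (u.2.1 • X) - u.2.2.1 • NormedSpace.exp (u.2.2.2 • X)‖ < ε) ?_
    · have h2 : ContinuousAt (fun z : ℝ × M => (lam z.1 z.2, Ψ z.1 z.2, lam T z.2, Ψ T z.2))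
        (T, x₀) := (hlam x₀).prodMk ((hΨ x₀ h0).prodMk (hlamT.prodMk hΨT))
      have h3 : ∀ᶠ z : ℝ × M in 𝓝 (T, x₀), ρ z.2 < ρ x₀ + 1 :=
        (hρ.comp continuous_snd).continuousAt.eventually_lt_const (lt_add_one (ρ x₀))
      filter_upwards [h2.eventually h1, h3] with z hz hz' _ X hX
      exact hz X (mem_closedBall_zero_iff.2 (hX.trans hz'.le))
    · intro X _
      have h2 : Continuous (fun z : (ℝ × ℝ × ℝ × ℝ) × Mat =>
          ‖z.1.1 • NormedSpace.exp (z.1.2.1 • z.2) -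
            z.1.2.2.1 • NormedSpace.exp (z.1.2.2.2 • z.2)‖) := by
        have c1 : Continuous fun z : (ℝ × ℝ × ℝ × ℝ) × Mat => z.1.1 := by fun_prop
        have c2 : Continuous fun z : (ℝ × ℝ × ℝ × ℝ) × Mat => z.1.2.1 := by fun_prop
        have c3 : Continuous fun z : (ℝ × ℝ × ℝ × ℝ) × Mat => z.1.2.2.1 := by fun_prop
        have c4 : Continuous fun z : (ℝ × ℝ × ℝ × ℝ) × Mat => z.1.2.2.2 := by fun_prop
        exact ((c1.smul (hexp.comp (c2.smul continuous_snd))).sub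
          (c3.smul (hexp.comp (c4.smul continuous_snd)))).norm
      refine h2.continuousAt.eventually_lt_const ?_
      simpa using hε

end Limit

variable {M : Type*} [TopologicalSpace M] [ChartedSpace (𝔼 n) M]

theorem apply_self_eq_dotProduct (h : TensorField n M) (x : M) (v : 𝔼 n) :
    h x v v = dotProduct v.ofLp ((gram h x).mulVec v.ofLp) := by
  rw [apply_eq_gram h x v v]
  simp only [dotProduct, Matrix.mulVec, Finset.mul_sum, mul_assoc]

/-- The hypothesis ranges over all matrices of bounded norm, so no continuous choice of
`g₀`-orthonormal frames is needed. -/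
theorem abs_expCurve_sub_le {g₀ A : TensorField n M} {x : M} (hg : (gram g₀ x).PosDef)
    (hA : (gram A x).transpose = gram A x) {τ : ℝ} {p Ψ : ℝ → M → ℝ} {t t' ε : ℝ}
    (h : ∀ X : Mat, ‖X‖ ≤ n * Real.sqrt (traceProd g₀ A A x) →
      n * ‖(p t x ^ (2 / (n : ℝ)) * Real.exp (τ * t / n)) • NormedSpace.exp (Ψ t x • X) -
        (p t' x ^ (2 / (n : ℝ)) * Real.exp (τ * t' / n)) • NormedSpace.exp (Ψ t' x • X)‖ ≤ ε)
    (v : TangentSpace (𝓡 n) x) :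
    |expCurve g₀ A τ p Ψ t x v v - expCurve g₀ A τ p Ψ t' x v v| ≤ ε * g₀ x v v := by
  obtain ⟨S, X, hS, hX, hexp⟩ := exists_orthonormal_frame hg hA
  have e := fun k : TensorField n M => apply_self_eq_dotProduct k x v
  rw [e, e, e, gram_expCurve, gram_expCurve, hexp, hexp, ← dotProduct_sub, ← Matrix.sub_mulVec]
  have h1 := h X hX
  set Z := (p t x ^ (2 / (n : ℝ)) * Real.exp (τ * t / n)) • NormedSpace.exp (Ψ t x • X) -
        (p t' x ^ (2 / (n : ℝ)) * Real.exp (τ * t' / n)) • NormedSpace.exp (Ψ t' x • X) with hZ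
  have h2 : (p t x ^ (2 / (n : ℝ)) * Real.exp (τ * t / n)) •
        (S.transpose * NormedSpace.exp (Ψ t x • X) * S) -
      (p t' x ^ (2 / (n : ℝ)) * Real.exp (τ * t' / n)) •
        (S.transpose * NormedSpace.exp (Ψ t' x • X) * S) = S.transpose * Z * S := by
    rw [hZ, mul_sub, sub_mul, Matrix.mul_smul, Matrix.mul_smul, Matrix.smul_mul, Matrix.smul_mul]
  have h3 : gram g₀ x = S.transpose * 1 * S := by rw [mul_one, ← hS]
  rw [h2, h3, dotProduct_congruence, dotProduct_congruence, Matrix.one_mulVec]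
  refine (abs_quadratic_le Z _).trans (mul_le_mul_of_nonneg_right h1 ?_)
  exact Finset.sum_nonneg fun i _ => mul_self_nonneg _

variable [IsManifold (𝓡 n) ∞ M]

theorem isContinuousTensor_of_chartGram {h : TensorField n M}
    (hh : ∀ y, ContinuousOn (fun z => chartGram h y z) (chartAt (𝔼 n) y).target) :
    IsContinuousTensor h := by
  refine continuous_iff_continuousAt.2 fun y => ?_
  have : ∀ x : M, ContinuousAdd (TangentSpace (𝓡 n) x →L[ℝ] ℝ) :=
    fun x => inferInstanceAs (ContinuousAdd ((𝔼 n) →L[ℝ] ℝ))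
  refine (FiberBundle.continuousAt_totalSpace (𝔹 n) _).2 ⟨continuousAt_id, ?_⟩
  have h1 : ContinuousAt (fun x => chartGram h y (chartAt (𝔼 n) y x)) y := by
    have h2 := (hh y).continuousAt ((chartAt (𝔼 n) y).open_target.mem_nhds (mem_chart_target _ y))
    exact h2.comp (f := chartAt (𝔼 n) y)
      ((chartAt (𝔼 n) y).continuousAt (mem_chart_source (𝔼 n) y))
  have h3 : ContinuousAt (fun x => (bilinCLE n).symm (chartGram h y (chartAt (𝔼 n) y x))) y :=
    (bilinCLE n).symm.continuous.continuousAt.comp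
      (f := fun x => chartGram h y (chartAt (𝔼 n) y x)) h1
  refine h3.congr ?_
  filter_upwards [(chartAt (𝔼 n) y).open_source.mem_nhds (mem_chart_source (𝔼 n) y)] with x hx
  rw [ContinuousLinearEquiv.symm_apply_eq]
  have h4 := bilinCLE_trivialization y ((chartAt (𝔼 n) y).map_source hx) h
  rw [(chartAt (𝔼 n) y).left_inv hx] at h4
  exact h4.symm

omit [IsManifold (𝓡 n) ∞ M] in
-- Polarisation: twice the off-diagonal difference is bounded by `ε` times the sum of `g` at `v +
-- w`, `v` and `w`, which expands to the stated expression.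
theorem abs_sub_le_of_quadratic {g h k : TensorField n M} {x : M} {ε : ℝ}
    (hh : ∀ v w : TangentSpace (𝓡 n) x, h x v w = h x w v)
    (hk : ∀ v w : TangentSpace (𝓡 n) x, k x v w = k x w v)
    (hg : ∀ v w : TangentSpace (𝓡 n) x, g x v w = g x w v)
    (hhk : ∀ v : TangentSpace (𝓡 n) x, |k x v v - h x v v| ≤ ε * g x v v)
    (v w : TangentSpace (𝓡 n) x) :
    |k x v w - h x v w| ≤ ε * (g x v v + g x w w + g x v w) := by
  have e : ∀ l : TensorField n M, (∀ v w : TangentSpace (𝓡 n) x, l x v w = l x w v) →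
      l x (v + w) (v + w) = l x v v + l x w w + 2 * l x v w := by
    intro l hl
    have h1 : l x (v + w) (v + w) = l x v v + l x v w + (l x w v + l x w w) := by
      rw [(l x).map_add]
      change l x v (v + w) + l x w (v + w) = _
      rw [(l x v).map_add, (l x w).map_add]
    rw [h1, hl w v]; ring
  have h1 := abs_le.1 (hhk v)
  have h2 := abs_le.1 (hhk w)
  have h3 := abs_le.1 (hhk (v + w))
  rw [e k hk, e h hh, e g hg] at h3
  rw [abs_le]
  constructor <;> nlinarith [h1.1, h1.2, h2.1, h2.2, h3.1, h3.2]

/-- A uniform limit of smooth symmetric tensor fields is continuous. -/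
theorem isContinuousTensor_of_approx {g h : TensorField n M} (hg : IsSmoothSym g)
    (hh : ∀ (x : M) (v w : TangentSpace (𝓡 n) x), h x v w = h x w v)
    (happ : ∀ ε > 0, ∃ k : TensorField n M, IsSmoothSym k ∧
      ∀ (x : M) (v : TangentSpace (𝓡 n) x), |k x v v - h x v v| ≤ ε * g x v v) :
    IsContinuousTensor h := by
  refine isContinuousTensor_of_chartGram fun y => ?_
  have hcont : ∀ {k : TensorField n M}, IsSmoothSym k → ∀ i j,
      ContinuousOn (fun z => chartGram k y z i j) (chartAt (𝔼 n) y).target := fun hk i j =>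
    (contDiff_matrix_entry i j).continuous.comp_continuousOn
      (hk.smoothTensor.continuousOn_chartGram y)
  refine continuousOn_pi.2 fun i => continuousOn_pi.2 fun j => fun z hz => ?_
  -- The error in a coefficient is `ε` times the expression `B` in the coefficients of `g`, which is
  -- bounded near `z`; this makes the approximation locally uniform.
  refine continuousWithinAt_of_locally_uniform_approx_of_continuousWithinAt hz fun u hu => ?_
  obtain ⟨ε, hε, hεu⟩ := Metric.mem_uniformity_dist.1 hu
  set B : (𝔼 n) → ℝ := fun z => chartGram g y z i i + chartGram g y z j j + chartGram g y z i j
    with hB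
  have hBc : ContinuousWithinAt B (chartAt (𝔼 n) y).target z :=
    (((hcont hg i i).add (hcont hg j j)).add (hcont hg i j)) z hz
  have hBz : ∀ᶠ z' in 𝓝[(chartAt (𝔼 n) y).target] z, B z' < |B z| + 1 :=
    hBc.eventually_lt_const ((le_abs_self _).trans_lt (lt_add_one _))
  have hBp : 0 < |B z| + 1 := by positivity
  obtain ⟨k, hk, hkh⟩ := happ (ε / (|B z| + 1)) (by positivity)
  refine ⟨_, hBz, fun z => chartGram k y z i j, (hcont hk i j) z hz, fun z' hz' => hεu ?_⟩
  rw [Real.dist_eq, abs_sub_comm]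
  have h1 := abs_sub_le_of_quadratic (hh _) (hk.symm _) (hg.symm _)
    (hkh ((chartAt (𝔼 n) y).symm z')) (chartDeriv y z' (EuclideanSpace.single i (1 : ℝ)))
    (chartDeriv y z' (EuclideanSpace.single j (1 : ℝ)))
  refine lt_of_le_of_lt h1 ?_
  calc ε / (|B z| + 1) * B z' < ε / (|B z| + 1) * (|B z| + 1) :=
        mul_lt_mul_of_pos_left hz' (by positivity)
    _ = ε := by field_simp

end
end GenCalabi

/-! ### Degeneration at the end of the interval, and the theorem -/

open Set Filter Topology MeasureTheory
open scoped Manifold ContDiff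
namespace GenCalabi

section
open scoped Matrix.Norms.Operator

variable {n : ℕ}
local notation "Mat" => Matrix (Fin n) (Fin n) ℝ
local notation "𝔼" n => EuclideanSpace ℝ (Fin n)

/-- A bound independent of `q` and `r`, which survives as `r` tends to zero near the zero set of
`A`. -/
theorem abs_branch_le {b q r : ℝ} (hb : 0 < b) (hr : 0 < r) {t : ℝ} (ht : 0 ≤ t) :
    |branch b q r t| ≤ 2 * Real.pi + b / 2 * t := by
  have h1 := abs_lt.1 (abs_branch_sub_lt_pi (q := q) hb hr t)
  have h2 := Real.neg_pi_div_two_lt_arctan (q / b)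
  have h3 := Real.arctan_lt_pi_div_two (q / b)
  have h4 : 0 ≤ b / 2 * t := by positivity
  have h5 := Real.pi_pos
  rw [abs_le]
  constructor <;> linarith [h1.1, h1.2]

variable {M : Type*} [TopologicalSpace M] [ChartedSpace (𝔼 n) M] [IsManifold (𝓡 n) ∞ M]
  [CompactSpace M]

omit [CompactSpace M] in
theorem gram_expCurve_transpose {g₀ A : TensorField n M} (hg₀ : IsMetric g₀) (hA : IsSmoothSym A)
    (τ : ℝ) (p Ψ : ℝ → M → ℝ) (t : ℝ) (x : M) :
    (gram (expCurve g₀ A τ p Ψ t) x).transpose = gram (expCurve g₀ A τ p Ψ t) x := by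
  rw [gram_expCurve, Matrix.transpose_smul]
  congr 1
  rw [← Matrix.conjTranspose_eq_transpose_of_trivial]
  exact (posDef_mul_exp (hg₀.posDef x) (hA.gram_symm x) _).isHermitian

/-- The behaviour of the geodesic at the end of its interval of existence. -/
theorem exists_degenerate_limit (hn : 0 < n) {g₀ A : TensorField n M} (hg₀ : IsMetric g₀)
    (hA : IsSmoothSym A) (hAtr : ∀ x, ((gram g₀ x)⁻¹ * gram A x).trace = 0) {τ b : ℝ}
    {q r : M → ℝ} (hb : 0 < b) (hr0 : ∀ x, 0 ≤ r x)
    (hr : ∀ x, 4 * r x ^ 2 = n * traceProd g₀ A A x)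
    (hqS : SmoothFun (n := n) univ (fun _ => q))
    (hrS : SmoothFun (n := n) univ (fun _ x => r x ^ 2)) {P : M → Prop}
    (hP : ∀ x, P x ↔ r x = 0) {c : ℝ → TensorField n M}
    (hc : c = expCurve g₀ A τ (fun t x => volFactor b (q x) (r x) t)
        (fun t x => invPrimitive b (q x) (r x ^ 2) t)) {T₀ : EReal}
    (hT₀ : T₀ = ⨅ (x : M) (_ : P x), ((theta b (q x) / b : ℝ) : EReal))
    (hm : ∀ t ∈ domain T₀, IsMetric (c t)) {T : ℝ} (hT : T₀ = T) :
    ∃ G : TensorField n M, IsContinuousTensor G ∧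
      (∀ (x : M) (v w : TangentSpace (𝓡 n) x), G x v w = G x w v) ∧
      (∀ ε > 0, ∀ᶠ t in 𝓝[<] T, ∀ (x : M) (v : TangentSpace (𝓡 n) x),
        |c t x v v - G x v v| ≤ ε * g₀ x v v) ∧
      ∃ x : M, (∃ v : TangentSpace (𝓡 n) x, v ≠ 0 ∧ G x v v = 0) ∧
        Tendsto (fun t => volDensity (c t) x / volDensity g₀ x) (𝓝[<] T) (𝓝 0) := by
  have hnp : (0 : ℝ) < n := by exact_mod_cast hn
  have hn1 : (1 : ℝ) ≤ n := by exact_mod_cast hn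
  have he : (0 : ℝ) < 2 / n := by positivity
  have hqc : Continuous q := hqS.continuous (mem_univ (0 : ℝ))
  have hrc : Continuous (fun x => r x ^ 2) := hrS.continuous (mem_univ (0 : ℝ))
  have htop : T₀ ≠ ⊤ := by rw [hT]; exact EReal.coe_ne_top T
  obtain ⟨x₁, hx₁, hx₁'⟩ := exists_eq_iInf_theta hb hqc hrc hP (hT₀ ▸ htop)
  have hTx₁ : T = theta b (q x₁) / b := by
    rw [← hT₀, hT] at hx₁'
    exact EReal.coe_injective hx₁'
  have hTpos : 0 < T := hTx₁ ▸ div_pos (theta_pos hb _) hb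
  have hdom : ∀ t, 0 ≤ t → t < T → t ∈ domain T₀ := fun t h0 h1 =>
    ⟨h0, hT ▸ EReal.coe_lt_coe_iff.2 h1⟩
  have hev : ∀ᶠ t in 𝓝[<] T, t ∈ domain T₀ := by
    filter_upwards [mem_nhdsWithin_of_mem_nhds (Ioi_mem_nhds hTpos), self_mem_nhdsWithin]
      with t ht ht'
    exact hdom t (le_of_lt ht) ht'
  have hppos : ∀ t ∈ domain T₀, ∀ x, 0 < volFactor b (q x) (r x) t := fun t ht x =>
    volFactor_pos_of_mem_domain hb hP (hT₀ ▸ ht) x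
  set p : ℝ → M → ℝ := fun t x => volFactor b (q x) (r x) t with hp
  set Ψ : ℝ → M → ℝ := fun t x => invPrimitive b (q x) (r x ^ 2) t with hΨ
  have hpc : Continuous fun z : ℝ × M => p z.1 z.2 := by
    have h1 := (contDiff_volPoly b).continuous
    exact h1.comp (f := fun z : ℝ × M => (z.1, q z.2, r z.2 ^ 2))
      (continuous_fst.prodMk ((hqc.comp continuous_snd).prodMk (hrc.comp continuous_snd)))
  have hlam : ∀ x, ContinuousAt (fun z : ℝ × M =>
      p z.1 z.2 ^ (2 / (n : ℝ)) * Real.exp (τ * z.1 / n)) (T, x) := fun x =>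
    (hpc.continuousAt.rpow_const (Or.inr he.le)).mul (by fun_prop)
  -- If `p T x ≠ 0`, the factor is nonzero on all of `[0, T]` at `x`, so the parameters lie in the
  -- open set on which the primitive is smooth.
  have hΨc : ∀ x, p T x ^ (2 / (n : ℝ)) * Real.exp (τ * T / n) ≠ 0 →
      ContinuousAt (fun z : ℝ × M => Ψ z.1 z.2) (T, x) := by
    intro x hx
    have hpT : p T x ≠ 0 := fun h => hx (by rw [h, Real.zero_rpow he.ne', zero_mul])
    obtain ⟨U, hUo, hU, hs⟩ := contDiffOn_invPrimitive b
    have hmem : (T, q x, r x ^ 2) ∈ U := by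
      refine (hU _).2 fun s hs => ?_
      rcases hs.2.lt_or_eq with h | h
      · exact (hppos (T * s) (hdom _ (mul_nonneg hTpos.le hs.1)
          (mul_lt_of_lt_one_right hTpos h)) x).ne'
      · rw [h, mul_one]; exact hpT
    have h1 := hs.continuousOn.continuousAt (hUo.mem_nhds hmem)
    exact h1.comp (f := fun z : ℝ × M => (z.1, q z.2, r z.2 ^ 2))
      (x := (T, x)) (continuous_fst.prodMk ((hqc.comp continuous_snd).prodMk
        (hrc.comp continuous_snd))).continuousAt
  have hρeq : ∀ x, traceProd g₀ A A x = 4 * r x ^ 2 / n := fun x => by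
    rw [hr x]; field_simp
  have hρc : Continuous fun x => (n : ℝ) * Real.sqrt (traceProd g₀ A A x) := by
    simp only [hρeq]
    exact continuous_const.mul (Real.continuous_sqrt.comp ((continuous_const.mul hrc).div_const _))
  have hρle : ∀ x, (n : ℝ) * Real.sqrt (traceProd g₀ A A x) ≤ n * (2 * r x) := by
    intro x
    refine mul_le_mul_of_nonneg_left (Real.sqrt_le_iff.2
      ⟨mul_nonneg zero_le_two (hr0 x), ?_⟩) hnp.le
    rw [hρeq, div_le_iff₀ hnp]
    nlinarith [sq_nonneg (r x)]
  -- For `r > 0` one has `Ψ = 2 branch / r`, so the product with `2 n r` is `4 n` times the branch.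
  -- For `r = 0` it vanishes, whatever value the integral takes.
  have hC : ∀ t ∈ Icc 0 T, ∀ x, |Ψ t x| * ((n : ℝ) * Real.sqrt (traceProd g₀ A A x)) ≤
      4 * n * (2 * Real.pi + b / 2 * T) := by
    intro t ht x
    have hC0 : 0 ≤ 4 * n * (2 * Real.pi + b / 2 * T) := by
      have := Real.pi_pos
      positivity
    rcases (hr0 x).eq_or_lt with h0 | h0
    · have h1 : Real.sqrt (traceProd g₀ A A x) = 0 := by rw [hρeq, ← h0]; simp
      rw [h1, mul_zero, mul_zero]
      exact hC0
    · have h1 : |Ψ t x| * (n * (2 * r x)) = 4 * n * |branch b (q x) (r x) t| := by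
        rw [branch, abs_mul, abs_of_pos (half_pos h0)]; ring
      refine (mul_le_mul_of_nonneg_left (hρle x) (abs_nonneg _)).trans (h1.le.trans ?_)
      refine mul_le_mul_of_nonneg_left ((abs_branch_le hb h0 ht.1).trans ?_) (by positivity)
      have := ht.2
      gcongr
  have hunif : ∀ ε > 0, ∀ᶠ t in 𝓝[<] T, ∀ (x : M) (v : TangentSpace (𝓡 n) x),
      |c t x v v - c T x v v| ≤ ε * g₀ x v v := by
    intro ε hε
    filter_upwards [eventually_norm_smul_exp_sub_lt (n := n)
      (lam := fun t x => p t x ^ (2 / (n : ℝ)) * Real.exp (τ * t / n)) (Ψ := Ψ)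
      (ρ := fun x => (n : ℝ) * Real.sqrt (traceProd g₀ A A x)) hTpos hlam hρc hΨc hC
      (div_pos hε hnp)] with t ht x v
    rw [hc]
    refine abs_expCurve_sub_le (hg₀.posDef x) (hA.gram_symm x) (fun X hX => ?_) v
    rw [mul_comm]
    exact ((lt_div_iff₀ hnp).1 (ht x X hX)).le
  have hsymm : ∀ (x : M) (v w : TangentSpace (𝓡 n) x), c T x v w = c T x w v := fun x =>
    gram_transpose_iff.1 (by rw [hc]; exact gram_expCurve_transpose hg₀ hA _ _ _ _ _)
  have hpT : p T x₁ = 0 := by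
    rw [hp]
    simp only [hx₁, hTx₁]
    exact volFactor_theta hb
  -- The limit is the explicit formula evaluated at `T`. At the minimising point its scalar factor
  -- is `0`, so the whole form vanishes there and any nonzero vector is degenerate.
  refine ⟨c T, isContinuousTensor_of_approx hg₀.toIsSmoothSym hsymm fun ε hε => ?_, hsymm, hunif,
    x₁, ⟨frame x₁ ⟨0, hn⟩, ?_, ?_⟩, ?_⟩
  · obtain ⟨t, ht, ht'⟩ := ((hunif ε hε).and hev).exists
    exact ⟨c t, (hm t ht').toIsSmoothSym, ht⟩
  · intro h
    have h1 := congrArg (fun v : 𝔼 n => v ⟨0, hn⟩) h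
    simp only [frame] at h1
    exact one_ne_zero (α := ℝ) ((by simp : _ = (1 : ℝ)).symm.trans h1)
  · have h1 : gram (c T) x₁ = 0 := by
      rw [hc, gram_expCurve, hpT, Real.zero_rpow he.ne', zero_mul, zero_smul]
    exact congrFun (congrFun h1 ⟨0, hn⟩) ⟨0, hn⟩
  · have h1 : Tendsto (fun t => p t x₁ * Real.exp (τ * t / 2)) (𝓝[<] T) (𝓝 0) := by
      have h2 : Continuous fun t => p t x₁ * Real.exp (τ * t / 2) :=
        (hpc.comp (continuous_id.prodMk continuous_const)).mul (by fun_prop)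
      have h3 := h2.tendsto T
      rw [hpT, zero_mul] at h3
      exact h3.mono_left nhdsWithin_le_nhds
    refine h1.congr' ?_
    filter_upwards [hev] with t ht
    rw [volDensity, volDensity, ← Real.sqrt_div' _ (hg₀.det_pos x₁).le]
    have h2 := volRatio_expCurve hn (τ := τ) (p := p) (Ψ := Ψ) (hg₀.det_pos x₁).ne'
      (hppos t ht x₁) (hAtr x₁)
    rw [← h2, hc]
    rfl

end
end GenCalabi

open GenCalabi in
theorem theorem4p1 {n : ℕ} (hn : 0 < n) {M : Type*} [TopologicalSpace M] [T2Space M]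
    [CompactSpace M] [Nonempty M] [ChartedSpace (EuclideanSpace ℝ (Fin n)) M]
    [IsManifold (𝓡 n) ∞ M] [MeasurableSpace M] [BorelSpace M]
    (g₀ : TensorField n M) (hg₀ : IsMetric g₀)
    (a : M → ℝ) (ha : ContMDiff (𝓡 n) 𝓘(ℝ, ℝ) ∞ a)
    (A : TensorField n M) (hA : IsSmoothSym A)
    (hAtr : ∀ x, ((gram g₀ x)⁻¹ * gram A x).trace = 0)
    (σ a₀ b₀ : ℝ) (q r : M → ℝ)
    (hσ : σ = Real.sqrt (gN g₀ (tangentVector g₀ a A) (tangentVector g₀ a A)))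
    (ha₀ : a₀ = 2 / totalVol g₀ * ∫ x, a x ∂(vol g₀))
    (hb₀ : b₀ = Real.sqrt ((n * σ ^ 2 - a₀ ^ 2) / 4))
    (hq : ∀ x, q x = a x - a₀ / 2)
    (hr : ∀ x, r x = Real.sqrt (n / 4 * traceProd g₀ A A x)) :
    (b₀ = 0 →
      |a₀| = σ * Real.sqrt n ∧
      IsMaximalGeodesic g₀ (tangentVector g₀ a A) ⊤ (fun t => Real.exp (a₀ * t / n) • g₀)) ∧
    (b₀ ≠ 0 →
      ∃ (t₀ : EReal) (c : ℝ → TensorField n M) (ψ : M → ℝ → ℝ),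
        t₀ = (⨅ (x : M) (_ : A x = 0), ((theta b₀ (q x) / b₀ : ℝ) : EReal)) ∧
        IsMaximalGeodesic g₀ (tangentVector g₀ a A) t₀ c ∧
        (∀ x, A x ≠ 0 → IsArctanBranch b₀ (q x) (r x) (ψ x)) ∧
        (∀ t ∈ domain t₀, ∀ x,
          (A x = 0 →
            c t x = (volFactor b₀ (q x) (r x) t ^ (2 / (n : ℝ)) * Real.exp (a₀ * t / n)) • g₀ x) ∧
          (A x ≠ 0 →
            gram (c t) x = (volFactor b₀ (q x) (r x) t ^ (2 / (n : ℝ)) * Real.exp (a₀ * t / n)) •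
              (gram g₀ x * NormedSpace.exp
                ((2 / r x * ψ x t) • ((gram g₀ x)⁻¹ * gram A x))))) ∧
        (∀ T : ℝ, t₀ = T →
          ∃ G : TensorField n M, IsContinuousTensor G ∧
            (∀ (x : M) (v w : TangentSpace (𝓡 n) x), G x v w = G x w v) ∧
            (∀ ε > 0, ∀ᶠ t in 𝓝[<] T, ∀ (x : M) (v : TangentSpace (𝓡 n) x),
              |c t x v v - G x v v| ≤ ε * g₀ x v v) ∧
            ∃ x : M, (∃ v : TangentSpace (𝓡 n) x, v ≠ 0 ∧ G x v v = 0) ∧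
              Tendsto (fun t => volDensity (c t) x / volDensity g₀ x) (𝓝[<] T) (𝓝 0))) := by
  obtain ⟨hσ2, hb2, hr2, iq, iqr, hqS, hrS⟩ := initial_data hn hg₀ ha hA hAtr hσ ha₀ hb₀ hq hr
  have haq : a = fun x => q x + a₀ / 2 := funext fun x => by rw [hq]; ring
  have hτ : gN g₀ g₀ (tangentVector g₀ (fun x => q x + a₀ / 2) A) = a₀ := by
    rw [← haq, gN_self_tangentVector hn hg₀ hAtr, ha₀]
  have hε : 4 * b₀ ^ 2 = n * gN g₀ (tangentVector g₀ (fun x => q x + a₀ / 2) A)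
      (tangentVector g₀ (fun x => q x + a₀ / 2) A) - a₀ ^ 2 := by
    rw [← haq, ← hσ2, hb2]
  have hr0 : ∀ x, 0 ≤ r x := fun x => hr x ▸ Real.sqrt_nonneg _
  have hnp : (0 : ℝ) < n := by exact_mod_cast hn
  have hP : ∀ x, A x = 0 ↔ r x = 0 := by
    intro x
    -- Definiteness of the pointwise inner product makes the vanishing of `A` equivalent to that of
    -- `r`.
    rw [← traceProd_eq_zero_iff hg₀ hA x]
    have h1 := hr2 x
    constructor
    · intro h
      rw [h, mul_zero] at h1
      exact pow_eq_zero_iff two_ne_zero |>.1 (by linarith)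
    · intro h
      rw [h] at h1
      exact (mul_eq_zero.1 (by linarith : (n : ℝ) * traceProd g₀ A A x = 0)).resolve_left hnp.ne'
  have := hg₀.isFiniteMeasure
  have := isOpenPosMeasure_vol hg₀.smoothTensor hg₀.det_pos
  constructor
  · intro h0
    rw [h0] at hb2 hε iqr
    have hσ0 : 0 ≤ σ := hσ ▸ Real.sqrt_nonneg _
    have habs : |a₀| = σ * Real.sqrt n := by
      rw [← Real.sqrt_sq_eq_abs, show a₀ ^ 2 = σ ^ 2 * n by linarith, Real.sqrt_mul (sq_nonneg σ),
        Real.sqrt_sq hσ0]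
    -- When `b₀ = 0` the integral of this nonnegative continuous function is zero and the volume
    -- charges open sets. Hence the initial velocity is a constant multiple of `g₀`.
    have hqr : ∀ x, q x ^ 2 + r x ^ 2 = 0 := by
      have hc : Continuous fun x => q x ^ 2 + r x ^ 2 :=
        ((hqS.continuous (mem_univ (0 : ℝ))).pow 2).add (hrS.continuous (mem_univ (0 : ℝ)))
      rw [zero_pow two_ne_zero, zero_mul, integral_eq_zero_iff_of_nonneg (fun x => by positivity)
        (hc.integrable_of_hasCompactSupport (HasCompactSupport.of_compactSpace _)),
        Continuous.ae_eq_iff_eq (vol g₀) hc continuous_zero] at iqr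
      exact congrFun iqr
    have hq0 : ∀ x, q x = 0 := fun x =>
      pow_eq_zero_iff two_ne_zero |>.1 (by nlinarith [hqr x, sq_nonneg (q x), sq_nonneg (r x)])
    have hr00 : ∀ x, r x = 0 := fun x =>
      pow_eq_zero_iff two_ne_zero |>.1 (by nlinarith [hqr x, sq_nonneg (q x), sq_nonneg (r x)])
    refine ⟨habs, ?_⟩
    rw [haq]
    exact isMaximalGeodesic_homothetic hn hg₀ hA (fun x => (hP x).2 (hr00 x)) hq0 hτ
      (by linarith)
  · intro h0
    have hb : 0 < b₀ := lt_of_le_of_ne (hb₀ ▸ Real.sqrt_nonneg _) (Ne.symm h0)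
    have hmax := isMaximalGeodesic_volFactor hn hg₀ hA hAtr hb hr2 hqS hrS hτ hε iq iqr hP
    rw [← haq] at hmax
    refine ⟨_, _, fun x => branch b₀ (q x) (r x), rfl, hmax, fun x hx => ?_, fun t ht x => ?_,
      fun T hT => ?_⟩
    · exact isArctanBranch_branch hb (lt_of_le_of_ne (hr0 x) fun h => hx ((hP x).2 h.symm))
    · constructor
      · intro hx
        have hgA : gram A x = 0 := eq_zero_of_trace_sq_eq_zero (hg₀.posDef x) (hA.gram_symm x)
          ((traceProd_eq_zero_iff hg₀ hA x).2 hx)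
        refine tensorField_ext (k := fun x => (volFactor b₀ (q x) (r x) t ^ (2 / (n : ℝ)) *
          Real.exp (a₀ * t / n)) • g₀ x) ?_
        rw [gram_expCurve, gram_fun_smul_apply, hgA, mul_zero, smul_zero, NormedSpace.exp_zero,
          mul_one]
      · intro hx
        have hrx : r x ≠ 0 := fun h => hx ((hP x).2 h)
        -- The factor `2 / r` of the formula undoes the `r / 2` in the branch, leaving the angle `Ψ`
        -- of the constructed curve.
        have e : 2 / r x * branch b₀ (q x) (r x) t = invPrimitive b₀ (q x) (r x ^ 2) t := by
          rw [branch]; field_simp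
        rw [gram_expCurve, e]
    · exact exists_degenerate_limit hn hg₀ hA hAtr hb hr0 hr2 hqS hrS hP rfl rfl
        hmax.isGeodesicFrom.metric hT
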